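/- Let $S$ be a set (of colours), $\Bbbk$ a commutative ring and $A=(a_{s,t})$ an $S\times S$ matrix over $\Bbbk$. Let $S\mathcal{TL}(A)$ be the $\Bbbk$-linear strict 2-category with objects $S$, whose 1-morphisms are the non-empty sequences $\underline{x}=s_1\cdots s_m$ of colours with $s_i\neq s_{i+1}$ (composed by gluing along the common end colour), and whose 2-morphisms are generated by the cups $b\to bcb$ and caps $bcb\to b$ ($b\neq c$), subject to isotopy (both zigzags of cup and cap on the strand between any two colours are identities) and to the rule that a circle with colour $c$ inside and $b\ne c$ outside equals the scalar $a_{b,c}$. For a 1-morphism $\underline{x}$ let $I_{<\underline{x}}\subset\mathrm{End}(\underline{x})$ be the span of the morphisms factoring through sequences shorter than $\underline{x}$ (equivalently, of the non-identity coloured crossingless matchings); an endomorphism has identity coefficient $\lambda$ if it is congruent to $\lambda\mathbb 1$ modulo $I_{<\underline{x}}$. Let $B(\underline{x})$ be the space of all $f\in \mathrm{End}(\underline{x})$ with $fc=0$ for every cup $c$. The top idempotent $JW(\underline{x})$ is said to exist if $B(\underline{x})$ contains an element whose identity coefficient is invertible; $JW(\underline{x})$ is then the idempotent of $B(\underline{x})$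 with identity coefficient $1$. A subsequence means one of consecutive terms; it is alternating if it alternates between two colours, and maximal alternating if it is not contained in a longer alternating subsequence. For $s\neq t$ the two-coloured quantum numbers are $[0]_{s,t}=0$, $[1]_{s,t}=1$, $[2]_{s,t}=-a_{s,t}$, $[m+1]_{s,t}=[2]_{s,t}[m]_{t,s}-[m-1]_{s,t}$. The two-coloured quantum binomial ${k\brack m}_{s,t}$ ($0\le m\le k$) is the image in $\Bbbk$ of the quotient $[k]_{s,t}!/([m]_{s,t}!\,[k-m]_{s,t}!)$, where $[n]_{s,t}!=[1]_{s,t}[2]_{s,t}\cdots[n]_{s,t}$; the quotient is taken in the polynomial ring over $\mathbb Z$ in the two indeterminates $[2]_{s,t},[2]_{t,s}$, where it exists. The ordinary quantum numbers and binomials ${k\brack m}$ for a parameter $[2]=\delta\in\Bbbk$ are defined in the same way from $[2][m]=[m+1]+[m-1]$, with the quotient taken in $\mathbb Z[\delta]$. Let $\underline{x}$ be a 1-morphism. (1) Let $\delta\in\Bbbk$ and let $a_{s,t}=-\delta$ for all $s\neq t$. Suppose that ${k\brack m}$ is invertible in $\Bbbk$ whenever $0\le m\le k$ and $k+1$ is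 the length of a maximal alternating subsequence of $\underline{x}$. Then $JW(\underline{x})$ exists, $JW(\underline{y})$ exists for every maximal alternating subsequence $\underline{y}$ of $\underline{x}$, and $JW(\underline{x})$ is the horizontal composite, from left to right, of the maps $JW(\underline{y})$ of all maximal alternating subsequences of $\underline{x}$ (neighbouring ones share exactly one colour). If, on the other hand, some such ${k\brack m}$ is not invertible, then $JW(\underline{x})$ does not exist. (2) Let $A$ be arbitrary. Suppose that ${k\brack m}_{s,t}$ is invertible in $\Bbbk$ whenever $0\le m\le k$ and $\underline{x}$ has a maximal alternating subsequence $\cdots ts$ of length $k+1$ in the colours $s,t$ that ends in $s$. Then the same conclusions hold: $JW(\underline{x})$ and all these $JW(\underline{y})$ exist, and $JW(\underline{x})$ is the horizontal composite of the $JW(\underline{y})$. If one of these two-coloured quantum binomials is not invertible, then $JW(\underline{x})$ does not exist. -/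

import Mathlib

/-!
The `S`-coloured Temperley-Lieb 2-category attached to a matrix `A`, its top idempotents
(coloured Jones-Wenzl projectors), and two-coloured quantum binomial coefficients.
-/

universe u v

namespace ColoredTL

/-! ### Quantum numbers and quantum binomial coefficients -/

section Quantum

variable {R : Type*} [CommRing R]

/-- The quantum number `[n]` with `[2] = d`:
`[0] = 0`, `[1] = 1`, `[2][m] = [m+1] + [m-1]`. -/
def qnum (d : R) : ℕ → R
  | 0 => 0
  | 1 => 1
  | n + 2 => d * qnum d (n + 1) - qnum d n

/-- The two-coloured quantum number `[n]_{s,t}`, where `a = [2]_{s,t}` and `b = [2]_{t,s}`: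
`[0] = 0`, `[1] = 1`, `[2]_{s,t} [m]_{t,s} = [m+1]_{s,t} + [m-1]_{s,t}`.
Exchanging `s` and `t` is exchanging `a` and `b`. -/
def qnum₂ (a b : R) : ℕ → R
  | 0 => 0
  | 1 => 1
  | n + 2 => a * qnum₂ b a (n + 1) - qnum₂ a b n

/-- The quantum factorial `[n]! = [1][2]⋯[n]`. -/
def qfact (d : R) (n : ℕ) : R := ∏ i ∈ Finset.range n, qnum d (i + 1)

/-- The two-coloured quantum factorial `[n]_{s,t}! = [1]_{s,t} [2]_{s,t} ⋯ [n]_{s,t}`. -/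
def qfact₂ (a b : R) (n : ℕ) : R := ∏ i ∈ Finset.range n, qnum₂ a b (i + 1)

/-- Auxiliary: `[n]_{s,t}` with the factor `[2]_{s,t}` removed when `n` is even, as a function
of `p = [2]_{s,t} [2]_{t,s}`. -/
def rnum (p : R) : ℕ → R
  | 0 => 0
  | 1 => 1
  | n + 2 => (if Even n then 1 else p) * rnum p (n + 1) - rnum p n

theorem qnum₂_eq_rnum (n : ℕ) : ∀ a b : R,
    qnum₂ a b n = (if Even n then a else 1) * rnum (a * b) n := by
  induction n using Nat.strong_induction_on with
  | _ n ih =>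
    intro a b
    match n, ih with
    | 0, _ => simp [qnum₂, rnum]
    | 1, _ => simp [qnum₂, rnum]
    | n + 2, ih =>
      rw [qnum₂, rnum, ih (n + 1) (by omega), ih n (by omega), mul_comm b a]
      by_cases h : Even n
      · have h1 : ¬ Even (n + 1) := by simpa [Nat.even_add_one] using h
        have h2 : Even (n + 2) := by simpa [Nat.even_add] using h
        simp only [h, h1, h2, if_true, if_false]
        ring
      · have h1 : Even (n + 1) := by simpa [Nat.even_add_one] using h
        have h2 : ¬ Even (n + 2) := by simpa [Nat.even_add] using h
        simp only [h, h1, h2, if_true, if_false]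
        ring

theorem rnum_add (p : R) (m l : ℕ) :
    (if Even m ∧ ¬ Even l then p else 1) * rnum p (m + 2) * rnum p (l + 1)
      - (if ¬ Even m ∧ Even l then p else 1) * rnum p l * rnum p (m + 1)
      = rnum p (m + l + 2) := by
  induction l using Nat.strong_induction_on with
  | _ l ih =>
    match l, ih with
    | 0, _ => simp [rnum]
    | 1, _ =>
      have e : m + 1 + 2 = (m + 1) + 2 := rfl
      rw [e, rnum.eq_3 p (m + 1)]
      by_cases h : Even m <;> simp [rnum, h, Nat.even_add_one]
    | l + 2, ih =>
      have i0 := ih l (by omega)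
      have i1 := ih (l + 1) (by omega)
      have r1 : rnum p (l + 2 + 1)
          = (if Even (l + 1) then 1 else p) * rnum p (l + 2) - rnum p (l + 1) := rfl
      have r2 : rnum p (l + 2)
          = (if Even l then 1 else p) * rnum p (l + 1) - rnum p l := rfl
      have r3 : rnum p (m + (l + 2) + 2)
          = (if Even (m + l + 2) then 1 else p) * rnum p (m + (l + 1) + 2)
            - rnum p (m + l + 2) := rfl
      rw [r3, ← i0, ← i1, r1]
      have e : l + 1 + 1 = l + 2 := rfl
      rw [e, r2]
      by_cases h : Even m <;> by_cases h' : Even l <;>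
        simp [h, h', Nat.even_add_one, Nat.even_add] <;> ring

theorem rfact_dvd (p : R) (n : ℕ) : ∀ m l : ℕ, m + l = n →
    (∏ i ∈ Finset.range m, rnum p (i + 1)) * (∏ i ∈ Finset.range l, rnum p (i + 1)) ∣
      ∏ i ∈ Finset.range n, rnum p (i + 1) := by
  induction n with
  | zero =>
    intro m l h
    obtain ⟨rfl, rfl⟩ : m = 0 ∧ l = 0 := by omega
    simp
  | succ n ih =>
    intro m l h
    match m, l with
    | 0, l => obtain rfl : l = n + 1 := by omega
              simp
    | m + 1, 0 => obtain rfl : m = n := by omega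
                  simp
    | m + 1, l + 1 =>
      obtain ⟨c, hc⟩ := ih (m + 1) l (by omega)
      obtain ⟨d, hd⟩ := ih m (l + 1) (by omega)
      obtain rfl : n = m + l + 1 := by omega
      refine ⟨(if Even m ∧ ¬ Even l then p else 1) * rnum p (m + 2) * c
        - (if ¬ Even m ∧ Even l then p else 1) * rnum p l * d, ?_⟩
      rw [Finset.prod_range_succ, show m + l + 1 + 1 = m + l + 2 from rfl, ← rnum_add p m l]
      rw [Finset.prod_range_succ _ m] at hc ⊢
      rw [Finset.prod_range_succ _ l] at hd ⊢
      linear_combination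
        (if Even m ∧ ¬ Even l then p else 1) * rnum p (m + 2) * rnum p (l + 1) * hc
        - (if ¬ Even m ∧ Even l then p else 1) * rnum p l * rnum p (m + 1) * hd

theorem qfact₂_eq (a b : R) (n : ℕ) :
    qfact₂ a b n = a ^ (n / 2) * ∏ i ∈ Finset.range n, rnum (a * b) (i + 1) := by
  induction n with
  | zero => simp [qfact₂]
  | succ n ih =>
    rw [qfact₂, Finset.prod_range_succ, ← qfact₂, ih, Finset.prod_range_succ, qnum₂_eq_rnum]
    by_cases h : Even (n + 1)
    · have e : (n + 1) / 2 = n / 2 + 1 := by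
        obtain ⟨r, hr⟩ := h
        omega
      rw [if_pos h, e]
      ring
    · have e : (n + 1) / 2 = n / 2 := by
        rw [Nat.not_even_iff_odd] at h
        obtain ⟨r, hr⟩ := h
        omega
      rw [if_neg h, e]
      ring

/-- The two-coloured quantum factorials divide as ordinary factorials do. -/
theorem qfact₂_dvd (a b : R) {k m : ℕ} (h : m ≤ k) :
    qfact₂ a b m * qfact₂ a b (k - m) ∣ qfact₂ a b k := by
  rw [qfact₂_eq, qfact₂_eq, qfact₂_eq]
  obtain ⟨c, hc⟩ := rfact_dvd (a * b) k m (k - m) (by omega)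
  refine ⟨a ^ (k / 2 - m / 2 - (k - m) / 2) * c, ?_⟩
  have e : k / 2 = m / 2 + (k - m) / 2 + (k / 2 - m / 2 - (k - m) / 2) := by omega
  have ea : a ^ (k / 2)
      = a ^ (m / 2) * a ^ ((k - m) / 2) * a ^ (k / 2 - m / 2 - (k - m) / 2) := by
    rw [← pow_add, ← pow_add, ← e]
  rw [ea, hc]
  ring

theorem qnum₂_self (d : R) (n : ℕ) : qnum₂ d d n = qnum d n := by
  induction n using Nat.strong_induction_on with
  | _ n ih =>
    match n, ih with
    | 0, _ => rfl
    | 1, _ => rfl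
    | n + 2, ih => rw [qnum₂, qnum, ih (n + 1) (by omega), ih n (by omega)]

theorem qfact_dvd (d : R) {k m : ℕ} (h : m ≤ k) :
    qfact d m * qfact d (k - m) ∣ qfact d k := by
  simpa [qfact, qfact₂, qnum₂_self] using qfact₂_dvd d d h

open Classical in
/-- The quantum binomial coefficient as an element of `ℤ[δ]`, `δ = [2]`: the quotient
`[k]! / ([m]! [k-m]!)` of quantum factorials in this integral domain (all factors are nonzero);
it is `0` for `m > k`. -/
noncomputable def qbinomPoly (k m : ℕ) : Polynomial ℤ :=
  if h : m ≤ k then (qfact_dvd (Polynomial.X : Polynomial ℤ) h).choose else 0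

open Classical in
/-- The two-coloured quantum binomial coefficient as an element of `ℤ[x₀, x₁]`, where
`x₀ = [2]_{s,t}` and `x₁ = [2]_{t,s}`: the quotient `[k]_{s,t}! / ([m]_{s,t}! [k-m]_{s,t}!)` in
this integral domain (all factors are nonzero); it is `0` for `m > k`. -/
noncomputable def qbinomPoly₂ (k m : ℕ) : MvPolynomial (Fin 2) ℤ :=
  if h : m ≤ k then
    (qfact₂_dvd (MvPolynomial.X 0 : MvPolynomial (Fin 2) ℤ) (MvPolynomial.X 1) h).choose
  else 0

theorem qbinomPoly_spec {k m : ℕ} (h : m ≤ k) :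
    qfact (Polynomial.X : Polynomial ℤ) k
      = qfact Polynomial.X m * qfact Polynomial.X (k - m) * qbinomPoly k m := by
  rw [qbinomPoly, dif_pos h]
  exact (qfact_dvd (Polynomial.X : Polynomial ℤ) h).choose_spec

theorem qbinomPoly₂_spec {k m : ℕ} (h : m ≤ k) :
    qfact₂ (MvPolynomial.X 0 : MvPolynomial (Fin 2) ℤ) (MvPolynomial.X 1) k
      = qfact₂ (MvPolynomial.X 0) (MvPolynomial.X 1) m
        * qfact₂ (MvPolynomial.X 0) (MvPolynomial.X 1) (k - m) * qbinomPoly₂ k m := by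
  rw [qbinomPoly₂, dif_pos h]
  exact (qfact₂_dvd (MvPolynomial.X 0 : MvPolynomial (Fin 2) ℤ) (MvPolynomial.X 1) h).choose_spec

/-- The quantum binomial coefficient `[k choose m]` in a commutative ring, at `[2] = d`. -/
noncomputable def qbinom (d : R) (k m : ℕ) : R :=
  Polynomial.aeval d (qbinomPoly k m)

/-- The two-coloured quantum binomial coefficient `[k choose m]_{s,t}` in a commutative ring, at
`[2]_{s,t} = a` and `[2]_{t,s} = b`. -/
noncomputable def qbinom₂ (a b : R) (k m : ℕ) : R :=
  MvPolynomial.aeval ![a, b] (qbinomPoly₂ k m)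

end Quantum

/-! ### The coloured Temperley-Lieb 2-category

The 1-morphisms are the non-empty sequences of colours in which neighbours differ. A generating
cup or cap, placed inside such a sequence, again gives such a sequence with the same first and the
same last colour. It is therefore harmless to take all lists of colours as objects: the
2-morphisms between two 1-morphisms are then those of the full subcategory on these
sequences. -/

/-- A whiskered generating 2-morphism: a cup `b → bcb` or a cap `bcb → b` (`b ≠ c`), with
identity strands on its left and its right. -/
inductive Step {S : Type u} : List S → List S → Type u
  | cup {x y : List S} (l : List S) (b c : S) (r : List S) (hbc : b ≠ c)
      (hx : x = l ++ b :: r) (hy : y = l ++ b :: c :: b :: r) : Step x y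
  | cap {x y : List S} (l : List S) (b c : S) (r : List S) (hbc : b ≠ c)
      (hx : x = l ++ b :: c :: b :: r) (hy : y = l ++ b :: r) : Step x y

/-- Add further colours on the left and on the right of a generator. -/
def Step.whisker {S : Type u} {x y X Y : List S} (s : Step x y) (p q : List S)
    (hX : X = p ++ x ++ q) (hY : Y = p ++ y ++ q) : Step X Y :=
  match s with
  | .cup l b c r hbc hx hy =>
      .cup (p ++ l) b c (r ++ q) hbc (by simp [hX, hx]) (by simp [hY, hy])
  | .cap l b c r hbc hx hy =>
      .cap (p ++ l) b c (r ++ q) hbc (by simp [hX, hx]) (by simp [hY, hy])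

/-- Formal `k`-linear combinations of composites of generators. -/
inductive Term {S : Type u} (k : Type v) : List S → List S → Type (max u v)
  | of {x y : List S} (s : Step x y) : Term k x y
  | id (x : List S) : Term k x x
  | comp {x y z : List S} (f : Term k x y) (g : Term k y z) : Term k x z
  | zero {x y : List S} : Term k x y
  | add {x y : List S} (f g : Term k x y) : Term k x y
  | smul {x y : List S} (a : k) (f : Term k x y) : Term k x y

/-- The relations: those of a `k`-linear category, the interchange law of a 2-category, isotopy,
and the evaluation of circles. -/
inductive Rel {S : Type u} {k : Type v} [CommRing k] (A : Matrix S S k) :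
    ∀ {x y : List S}, Term k x y → Term k x y → Prop
  -- equivalence relation, compatible with the operations
  | refl {x y : List S} (f : Term k x y) : Rel A f f
  | symm {x y : List S} {f g : Term k x y} : Rel A f g → Rel A g f
  | trans {x y : List S} {f g h : Term k x y} : Rel A f g → Rel A g h → Rel A f h
  | comp_congr {x y z : List S} {f f' : Term k x y} {g g' : Term k y z} :
      Rel A f f' → Rel A g g' → Rel A (f.comp g) (f'.comp g')
  | add_congr {x y : List S} {f f' g g' : Term k x y} :
      Rel A f f' → Rel A g g' → Rel A (f.add g) (f'.add g')
  | smul_congr {x y : List S} (a : k) {f f' : Term k x y} :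
      Rel A f f' → Rel A (f.smul a) (f'.smul a)
  -- category
  | id_comp {x y : List S} (f : Term k x y) : Rel A ((Term.id x).comp f) f
  | comp_id {x y : List S} (f : Term k x y) : Rel A (f.comp (Term.id y)) f
  | assoc {x y z w : List S} (f : Term k x y) (g : Term k y z) (h : Term k z w) :
      Rel A ((f.comp g).comp h) (f.comp (g.comp h))
  -- module structure on morphisms
  | add_assoc {x y : List S} (f g h : Term k x y) : Rel A ((f.add g).add h) (f.add (g.add h))
  | add_comm {x y : List S} (f g : Term k x y) : Rel A (f.add g) (g.add f)
  | zero_add {x y : List S} (f : Term k x y) : Rel A (Term.zero.add f) f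
  | zero_smul {x y : List S} (f : Term k x y) : Rel A (f.smul 0) Term.zero
  | one_smul {x y : List S} (f : Term k x y) : Rel A (f.smul 1) f
  | mul_smul {x y : List S} (a b : k) (f : Term k x y) :
      Rel A (f.smul (a * b)) ((f.smul b).smul a)
  | add_smul {x y : List S} (a b : k) (f : Term k x y) :
      Rel A (f.smul (a + b)) ((f.smul a).add (f.smul b))
  | smul_add {x y : List S} (a : k) (f g : Term k x y) :
      Rel A ((f.add g).smul a) ((f.smul a).add (g.smul a))
  -- bilinearity of composition
  | add_comp {x y z : List S} (f f' : Term k x y) (g : Term k y z) :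
      Rel A ((f.add f').comp g) ((f.comp g).add (f'.comp g))
  | comp_add {x y z : List S} (f : Term k x y) (g g' : Term k y z) :
      Rel A (f.comp (g.add g')) ((f.comp g).add (f.comp g'))
  | smul_comp {x y z : List S} (a : k) (f : Term k x y) (g : Term k y z) :
      Rel A ((f.smul a).comp g) ((f.comp g).smul a)
  | comp_smul {x y z : List S} (a : k) (f : Term k x y) (g : Term k y z) :
      Rel A (f.comp (g.smul a)) ((f.comp g).smul a)
  -- interchange: horizontally composable generators, glued along the region of colour `d`
  | interchange {X Y Y' Z : List S} (p p' : List S) (d : S) (q q' : List S)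
      (f : Step (p ++ [d]) (p' ++ [d])) (g : Step (d :: q) (d :: q'))
      (hX : X = p ++ d :: q) (hY : Y = p' ++ d :: q) (hY' : Y' = p ++ d :: q')
      (hZ : Z = p' ++ d :: q') :
      Rel A
        ((Term.of (f.whisker (X := X) (Y := Y) [] q (by simp [hX]) (by simp [hY]))).comp
          (Term.of (g.whisker (Y := Z) p' [] (by simp [hY]) (by simp [hZ]))))
        ((Term.of (g.whisker (X := X) (Y := Y') p [] (by simp [hX]) (by simp [hY']))).comp
          (Term.of (f.whisker (Y := Z) [] q' (by simp [hY']) (by simp [hZ]))))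
  -- isotopy: both ways of straightening the strand between colours `b` and `c`
  | zigzag_left {x y : List S} (l : List S) (b c : S) (r : List S) (hbc : b ≠ c)
      (hx : x = l ++ b :: c :: r) (hy : y = l ++ b :: c :: b :: c :: r) :
      Rel A
        ((Term.of (Step.cup (x := x) (y := y) l b c (c :: r) hbc hx hy)).comp
          (Term.of (Step.cap (y := x) (l ++ [b]) c b r hbc.symm (by simp [hy]) (by simp [hx]))))
        (Term.id x)
  | zigzag_right {x y : List S} (l : List S) (b c : S) (r : List S) (hbc : b ≠ c)
      (hx : x = l ++ b :: c :: r) (hy : y = l ++ b :: c :: b :: c :: r) :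
      Rel A
        ((Term.of (Step.cup (x := x) (y := y) (l ++ [b]) c b r hbc.symm
          (by simp [hx]) (by simp [hy]))).comp
          (Term.of (Step.cap (y := x) l b c (c :: r) hbc hy hx)))
        (Term.id x)
  -- a circle with colour `c` inside and colour `b` outside is the scalar `A b c`
  | circle {x y : List S} (l : List S) (b c : S) (r : List S) (hbc : b ≠ c)
      (hx : x = l ++ b :: r) (hy : y = l ++ b :: c :: b :: r) :
      Rel A
        ((Term.of (Step.cup (x := x) (y := y) l b c r hbc hx hy)).comp
          (Term.of (Step.cap (y := x) l b c r hbc hy hx)))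
        ((Term.id x).smul (A b c))

/-- The `k`-linear category of 1-morphisms and 2-morphisms of the coloured Temperley-Lieb
2-category of `A`; horizontal composition is given by `whiskering` below. -/
@[ext]
structure STL {S : Type u} {k : Type v} (A : Matrix S S k) where
  /-- The sequence of colours. -/
  seq : List S

section Category

variable {S : Type u} {k : Type v} [CommRing k] (A : Matrix S S k)

/-- Formal combinations modulo the relations. -/
def homSetoid (x y : List S) : Setoid (Term k x y) :=
  ⟨Rel A, Rel.refl, Rel.symm, Rel.trans⟩

variable {A}

instance : CategoryTheory.Category.{max u v} (STL A) where
  Hom x y := Quotient (homSetoid A x.seq y.seq)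
  id x := Quotient.mk (homSetoid A x.seq x.seq) (Term.id x.seq)
  comp := Quotient.map₂ Term.comp fun _ _ hf _ _ hg => Rel.comp_congr hf hg
  id_comp := by
    rintro x y ⟨f⟩
    exact Quotient.sound (Rel.id_comp f)
  comp_id := by
    rintro x y ⟨f⟩
    exact Quotient.sound (Rel.comp_id f)
  assoc := by
    rintro x y z w ⟨f⟩ ⟨g⟩ ⟨h⟩
    exact Quotient.sound (Rel.assoc f g h)

/-- The morphism given by a formal combination. -/
def Term.toHom (A : Matrix S S k) {x y : List S} (f : Term k x y) :
    (⟨x⟩ : STL A) ⟶ ⟨y⟩ :=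
  Quotient.mk (homSetoid A x y) f

instance (x y : STL A) : Add (x ⟶ y) where
  add := Quotient.map₂ Term.add fun _ _ hf _ _ hg => Rel.add_congr hf hg

instance (x y : STL A) : Zero (x ⟶ y) where
  zero := Quotient.mk (homSetoid A x.seq y.seq) Term.zero

instance (x y : STL A) : Neg (x ⟶ y) where
  neg := Quotient.map (Term.smul (-1)) fun _ _ hf => Rel.smul_congr _ hf

instance (x y : STL A) : AddCommGroup (x ⟶ y) where
  nsmul := nsmulRec
  zsmul := zsmulRec
  add_assoc := by
    rintro ⟨f⟩ ⟨g⟩ ⟨h⟩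
    exact Quotient.sound (Rel.add_assoc f g h)
  add_comm := by
    rintro ⟨f⟩ ⟨g⟩
    exact Quotient.sound (Rel.add_comm f g)
  zero_add := by
    rintro ⟨f⟩
    exact Quotient.sound (Rel.zero_add f)
  add_zero := by
    rintro ⟨f⟩
    exact Quotient.sound ((Rel.add_comm f _).trans (Rel.zero_add f))
  neg_add_cancel := by
    rintro ⟨f⟩
    refine Quotient.sound ?_
    have h1 : Rel A ((f.smul (-1)).add f) ((f.smul (-1)).add (f.smul 1)) :=
      Rel.add_congr (Rel.refl _) (Rel.symm (Rel.one_smul f))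
    have h2 := Rel.symm (Rel.add_smul (A := A) (-1) 1 f)
    rw [neg_add_cancel] at h2
    exact (h1.trans h2).trans (Rel.zero_smul f)

instance : CategoryTheory.Preadditive (STL A) where
  add_comp := by
    rintro x y z ⟨f⟩ ⟨f'⟩ ⟨g⟩
    exact Quotient.sound (Rel.add_comp f f' g)
  comp_add := by
    rintro x y z ⟨f⟩ ⟨g⟩ ⟨g'⟩
    exact Quotient.sound (Rel.comp_add f g g')

instance (x y : STL A) : Module k (x ⟶ y) where
  smul a := Quotient.map (Term.smul a) fun _ _ hf => Rel.smul_congr _ hf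
  one_smul := by
    rintro ⟨f⟩
    exact Quotient.sound (Rel.one_smul f)
  mul_smul := by
    rintro a b ⟨f⟩
    exact Quotient.sound (Rel.mul_smul a b f)
  smul_zero := by
    intro a
    refine Quotient.sound ?_
    have h1 : Rel A (Term.smul a (Term.zero : Term k x.seq y.seq))
        (Term.smul a (Term.smul 0 Term.zero)) :=
      Rel.smul_congr a (Rel.symm (Rel.zero_smul _))
    have h2 := Rel.symm (Rel.mul_smul (A := A) a 0 (Term.zero : Term k x.seq y.seq))
    rw [mul_zero] at h2
    exact (h1.trans h2).trans (Rel.zero_smul _)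
  smul_add := by
    rintro a ⟨f⟩ ⟨g⟩
    exact Quotient.sound (Rel.smul_add a f g)
  add_smul := by
    rintro a b ⟨f⟩
    exact Quotient.sound (Rel.add_smul a b f)
  zero_smul := by
    rintro ⟨f⟩
    exact Quotient.sound (Rel.zero_smul f)

instance : CategoryTheory.Linear k (STL A) where
  smul_comp := by
    rintro x y z a ⟨f⟩ ⟨g⟩
    exact Quotient.sound (Rel.smul_comp a f g)
  comp_smul := by
    rintro x y z ⟨f⟩ a ⟨g⟩
    exact Quotient.sound (Rel.comp_smul a f g)

theorem Step.whisker_whisker {x y X Y X' Y' : List S} (s : Step x y) (p q p' q' : List S)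
    (hX : X = p ++ x ++ q) (hY : Y = p ++ y ++ q)
    (hX' : X' = p' ++ X ++ q') (hY' : Y' = p' ++ Y ++ q') :
    (s.whisker p q hX hY).whisker p' q' hX' hY'
      = s.whisker (p' ++ p) (q ++ q') (by simp [hX', hX]) (by simp [hY', hY]) := by
  cases s <;> simp [Step.whisker]

/-- Whiskering of formal combinations. -/
def Term.whisker (p q : List S) :
    ∀ {x y : List S}, Term k x y → Term k (p ++ x ++ q) (p ++ y ++ q)
  | _, _, .of s => .of (s.whisker p q rfl rfl)
  | _, _, .id x => .id (p ++ x ++ q)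
  | _, _, .comp f g => (f.whisker p q).comp (g.whisker p q)
  | _, _, .zero => .zero
  | _, _, .add f g => (f.whisker p q).add (g.whisker p q)
  | _, _, .smul a f => (f.whisker p q).smul a

theorem Rel.whisker (p q : List S) {x y : List S} {f g : Term k x y} (h : Rel A f g) :
    Rel A (f.whisker p q) (g.whisker p q) := by
  induction h with
  | refl f => exact .refl _
  | symm _ ih => exact .symm ih
  | trans _ _ ih ih' => exact .trans ih ih'
  | comp_congr _ _ ih ih' => exact .comp_congr ih ih'
  | add_congr _ _ ih ih' => exact .add_congr ih ih'
  | smul_congr a _ ih => exact .smul_congr a ih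
  | id_comp f => exact .id_comp _
  | comp_id f => exact .comp_id _
  | assoc f g h => exact .assoc _ _ _
  | add_assoc f g h => exact .add_assoc _ _ _
  | add_comm f g => exact .add_comm _ _
  | zero_add f => exact .zero_add _
  | zero_smul f => exact .zero_smul _
  | one_smul f => exact .one_smul _
  | mul_smul a b f => exact .mul_smul _ _ _
  | add_smul a b f => exact .add_smul _ _ _
  | smul_add a f g => exact .smul_add _ _ _
  | add_comp f f' g => exact .add_comp _ _ _
  | comp_add f g g' => exact .comp_add _ _ _
  | smul_comp a f g => exact .smul_comp _ _ _
  | comp_smul a f g => exact .comp_smul _ _ _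
  | @interchange X Y Y' Z u u' d w w' f g hX hY hY' hZ =>
    have key := Rel.interchange (A := A) (p ++ u) (p ++ u') d (w ++ q) (w' ++ q)
      (f.whisker p [] (by simp) (by simp)) (g.whisker [] q (by simp) (by simp))
      (X := p ++ X ++ q) (Y := p ++ Y ++ q) (Y' := p ++ Y' ++ q) (Z := p ++ Z ++ q)
      (by rw [hX]; simp) (by rw [hY]; simp) (by rw [hY']; simp) (by rw [hZ]; simp)
    simp only [Term.whisker, Step.whisker_whisker] at key ⊢
    simpa using key
  | @zigzag_left x y l b c r hbc hx hy =>
    have key := Rel.zigzag_left (A := A) (x := p ++ x ++ q) (y := p ++ y ++ q)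
      (p ++ l) b c (r ++ q) hbc (by rw [hx]; simp) (by rw [hy]; simp)
    simp only [Term.whisker, Step.whisker]
    simpa using key
  | @zigzag_right x y l b c r hbc hx hy =>
    have key := Rel.zigzag_right (A := A) (x := p ++ x ++ q) (y := p ++ y ++ q)
      (p ++ l) b c (r ++ q) hbc (by rw [hx]; simp) (by rw [hy]; simp)
    simp only [Term.whisker, Step.whisker]
    simpa using key
  | circle l b c r hbc hx hy =>
    exact Rel.circle (A := A) (p ++ l) b c (r ++ q) hbc (by rw [hx]; simp) (by rw [hy]; simp)

/-- Horizontal composition with identity strands on both sides: the functor that sends `x` to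
the sequence `p ++ x ++ q`. -/
def whiskering (A : Matrix S S k) (p q : List S) : CategoryTheory.Functor (STL A) (STL A) where
  obj x := ⟨p ++ x.seq ++ q⟩
  map := Quotient.map (Term.whisker p q) fun _ _ h => h.whisker p q
  map_id _ := rfl
  map_comp := by
    rintro x y z ⟨f⟩ ⟨g⟩
    rfl

end Category

/-! ### Top idempotents -/

section Top

open CategoryTheory

variable {S : Type u} {k : Type v} [CommRing k] (A : Matrix S S k)

/-- The elementary cup into `x = l bcb r`, as a morphism. -/
def cupInto (x l : List S) (b c : S) (r : List S) (hbc : b ≠ c)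
    (hx : x = l ++ b :: c :: b :: r) : (⟨l ++ b :: r⟩ : STL A) ⟶ ⟨x⟩ :=
  (Term.of (Step.cup l b c r hbc rfl hx)).toHom A

/-- The ideal `I_{<x}` of `End(x)`, spanned by the morphisms that factor through a shorter
sequence; equivalently by the non-identity diagrams. -/
def lowerIdeal (x : List S) : Submodule k ((⟨x⟩ : STL A) ⟶ ⟨x⟩) :=
  Submodule.span k {f | ∃ (y : List S) (g : (⟨x⟩ : STL A) ⟶ ⟨y⟩) (h : (⟨y⟩ : STL A) ⟶ ⟨x⟩),
    y.length < x.length ∧ f = g ≫ h}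

/-- The space `B(x)` of all endomorphisms `f` of `x` such that `f c = 0` for any cup `c`
(`c` is applied first). -/
def perp (x : List S) : Submodule k ((⟨x⟩ : STL A) ⟶ ⟨x⟩) where
  carrier := {f | ∀ (l : List S) (b c : S) (r : List S) (hbc : b ≠ c)
    (hx : x = l ++ b :: c :: b :: r), cupInto A x l b c r hbc hx ≫ f = 0}
  add_mem' := by
    intro f g hf hg l b c r hbc hx
    rw [Preadditive.comp_add, hf l b c r hbc hx, hg l b c r hbc hx, add_zero]
  zero_mem' := by
    intro l b c r hbc hx
    rw [Limits.comp_zero]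
  smul_mem' := by
    intro a f hf l b c r hbc hx
    rw [Linear.comp_smul, hf l b c r hbc hx, smul_zero]

/-- The coefficient of the identity in `f` is `a`: one has `f = a · 1` modulo `I_{<x}`. -/
def HasIdentityCoeff (x : List S) (f : (⟨x⟩ : STL A) ⟶ ⟨x⟩) (a : k) : Prop :=
  f - a • 𝟙 (⟨x⟩ : STL A) ∈ lowerIdeal A x

/-- The top idempotent of `x` exists: `B(x)` contains an element for which the coefficient of the
identity is invertible. -/
def TopIdempotentExists (x : List S) : Prop :=
  ∃ f ∈ perp A x, ∃ a : k, IsUnit a ∧ HasIdentityCoeff A x f a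

/-- `f` is the top idempotent of `x`: the idempotent of `B(x)` with identity
coefficient `1`. -/
def IsTopIdempotent (x : List S) (f : (⟨x⟩ : STL A) ⟶ ⟨x⟩) : Prop :=
  f ∈ perp A x ∧ f ≫ f = f ∧ HasIdentityCoeff A x f 1

open Classical in
/-- The top idempotent `JW(x)`; the value is `0` if there is none. -/
noncomputable def JW (x : List S) : (⟨x⟩ : STL A) ⟶ ⟨x⟩ :=
  if h : ∃ f, IsTopIdempotent A x f then h.choose else 0

end Top

/-! ### Maximal alternating subsequences -/

section Alternating

variable {S : Type u}

/-- The alternating sequence `…tsts` of length `n` in the colours `s` and `t`, ending in `s`. -/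
def altWord (s t : S) : ℕ → List S
  | 0 => []
  | n + 1 => altWord t s n ++ [s]

/-- The sequence alternates between two colours. In a sequence whose neighbours differ, `s` and
`t` differ as soon as both of them occur. -/
def IsAlternating (y : List S) : Prop := ∃ s t, y = altWord s t y.length

/-- The subsequence of `n` consecutive terms of `x` that begins at position `i`
(counted from `0`). -/
def seg (x : List S) (i n : ℕ) : List S := (x.drop i).take n

/-- The `n ≥ 1` terms of `x` from position `i` on form a maximal alternating subsequence: they
alternate, and no longer run of consecutive terms containing them does. -/
def IsMaxAlt (x : List S) (i n : ℕ) : Prop :=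
  0 < n ∧ i + n ≤ x.length ∧ IsAlternating (seg x i n) ∧
    ∀ i' n', i' ≤ i → i + n ≤ i' + n' → i' + n' ≤ x.length →
      IsAlternating (seg x i' n') → i' = i ∧ n' = n

open Classical in
/-- The maximal alternating subsequences of `x` from left to right, as pairs
(position, length). -/
noncomputable def maxAlts (x : List S) : List (ℕ × ℕ) :=
  (List.range x.length ×ˢ List.range (x.length + 1)).filter fun p => IsMaxAlt x p.1 p.2

theorem seg_split (x : List S) (i n : ℕ) :
    x.take i ++ seg x i n ++ (x.drop i).drop n = x := by
  simp [seg]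

end Alternating

section SideBySide

open CategoryTheory

variable {S : Type u} {k : Type v} [CommRing k] (A : Matrix S S k)

/-- The endomorphism `1 ⊗ f ⊗ 1` of `x`, for an endomorphism `f` of a subsequence. -/
def place (x : List S) (i n : ℕ) (f : (⟨seg x i n⟩ : STL A) ⟶ ⟨seg x i n⟩) :
    End (⟨x⟩ : STL A) :=
  eqToHom (congrArg STL.mk (seg_split x i n).symm) ≫
    (whiskering A (x.take i) ((x.drop i).drop n)).map f ≫
      eqToHom (congrArg STL.mk (seg_split x i n))

/-- The horizontal composite of the maps `JW(y)` of all maximal alternating subsequences `y` of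
`x`, placed side by side: two neighbouring ones share exactly one colour, so that each strand of
`x` belongs to exactly one of them. By interchange this is the composite, in any order, of the
endomorphisms `1 ⊗ JW(y) ⊗ 1`. -/
noncomputable def sideBySide (x : List S) : End (⟨x⟩ : STL A) :=
  ((maxAlts x).map fun p => place A x p.1 p.2 (JW A (seg x p.1 p.2))).prod

end SideBySide

end ColoredTL

/-! The proof combines a formal part, valid for every sequence, with a family of representations on
functions of up-down paths in which elements of `B(x)` become rank-one operators.

Formal part. Simplifying a cup followed by a cap shows that the diagrams consisting of caps followed
by cups span all morphisms (`mem_span_normalForms`). A morphism into `x` from a shorter sequence is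
therefore a combination of morphisms ending in a cup, so every element of `B(x)` is annihilated by
`I_{<x}` on one side. Together with reflection this makes an element of `B(x)` with identity
coefficient 1 unique and idempotent (`perp_unique`).

Path representations. Let `N` be a nowhere vanishing solution of `N (h + 1) + N (h - 1) = δ h * N
h`, where `δ` alternates between the two parameters. The peak weights `-N (h + 1) / N h` satisfy the
circle relation. Such solutions always exist among linear polynomials with coprime coefficients
(`exists_linear_sequence`), even where quantum numbers vanish. On an alternating subsequence an
element of `B(x)` kills cups, so its values on paths with `p` steps up and `m` down are determined
by a single one; a functional that kills caps sees only its identity coefficient. Comparing the two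
gives `homOp_perp_mul`: a matrix entry times a sum over paths equals the identity coefficient times
explicit non-zero weights. By a Pascal recursion this sum is the two-coloured binomial with entries
`p + m` and `m`, up to values of `N` (`QuantumSequence.pathSum_boxWeight`).

Non-existence. Modulo a maximal ideal that contains a non-invertible binomial the sum over paths
vanishes, while the other side does not. This works for a maximal alternating subsequence inside a
longer sequence because no cap straddles its ends.

Existence for alternating sequences. Over the fraction field of the polynomial ring in the entries
of a universal matrix, Wenzl's recursion yields the top idempotent (`exists_wenzl`). The rank-one
formula bounds the denominators of its matrix by binomials. The matrices of the diagrams are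
unitriangular up to invertible factors, so the bound carries over to the coefficients
(`diagram_coeff_mem`). The product of the binomials thus clears all denominators, and the result can
be specialised to any ring; where the binomials are invertible it is a top idempotent up to a unit.

General sequences. Every `bcb` inside `x` lies in a maximal alternating subsequence, and the maps
belonging to different ones commute. Hence the horizontal composite kills all cups, and by
uniqueness it is `JW(x)` (`sideBySide_spec`). -/

namespace ColoredTL

open CategoryTheory

/-! ### Morphisms: induction, whiskering and the interchange law. -/

section Homs

variable {S : Type u} {k : Type v} [CommRing k] {A : Matrix S S k}

/-- A generator as a morphism. -/
def Step.hom (A : Matrix S S k) {x y : List S} (s : Step x y) : (⟨x⟩ : STL A) ⟶ ⟨y⟩ :=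
  (Term.of s).toHom A

theorem Term.toHom_eq_of_rel {x y : List S} {f g : Term k x y} (h : Rel A f g) :
    f.toHom A = g.toHom A := Quotient.sound h

/-- Induction over the formation of morphisms. -/
theorem hom_induction {P : ∀ (x y : List S), ((⟨x⟩ : STL A) ⟶ ⟨y⟩) → Prop}
    (of : ∀ (x y) (s : Step x y), P x y (s.hom A))
    (id : ∀ x, P x x (𝟙 _))
    (comp : ∀ x y z (f : (⟨x⟩ : STL A) ⟶ ⟨y⟩) (g : (⟨y⟩ : STL A) ⟶ ⟨z⟩),
      P x y f → P y z g → P x z (f ≫ g))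
    (zero : ∀ x y, P x y 0)
    (add : ∀ x y (f g : (⟨x⟩ : STL A) ⟶ ⟨y⟩), P x y f → P x y g → P x y (f + g))
    (smul : ∀ x y (a : k) (f : (⟨x⟩ : STL A) ⟶ ⟨y⟩), P x y f → P x y (a • f))
    {x y : List S} (f : (⟨x⟩ : STL A) ⟶ ⟨y⟩) : P x y f := by
  suffices h : ∀ {x y : List S} (t : Term k x y), P x y (t.toHom A) from
    Quotient.inductionOn f fun t => h t
  intro x y t
  induction t with
  | of s => exact of _ _ s
  | id x => exact id x
  | comp f g hf hg =>
    exact comp _ _ _ (f.toHom A) (g.toHom A) hf hg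
  | zero => exact zero _ _
  | add f g hf hg => exact add _ _ (f.toHom A) (g.toHom A) hf hg
  | smul a f hf => exact smul _ _ a (f.toHom A) hf

instance (p q : List S) : (whiskering A p q).Additive where
  map_add := by
    rintro x y ⟨f⟩ ⟨g⟩
    rfl

instance (p q : List S) : (whiskering A p q).Linear k where
  map_smul := by
    rintro x y ⟨f⟩ a
    rfl

/-- Horizontal composition with identity strands. -/
def wmap (p q : List S) {x y : List S} (f : (⟨x⟩ : STL A) ⟶ ⟨y⟩) :
    (⟨p ++ x ++ q⟩ : STL A) ⟶ ⟨p ++ y ++ q⟩ := (whiskering A p q).map f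

/-- Horizontal composition with identity strands, with prescribed source and target. -/
def whisk (p q : List S) {x y X Y : List S} (f : (⟨x⟩ : STL A) ⟶ ⟨y⟩)
    (hX : X = p ++ x ++ q) (hY : Y = p ++ y ++ q) : (⟨X⟩ : STL A) ⟶ ⟨Y⟩ :=
  eqToHom (congrArg STL.mk hX) ≫ wmap p q f ≫ eqToHom (congrArg STL.mk hY.symm)

section

variable (p q : List S) {x y z X Y Z : List S}
  (hX : X = p ++ x ++ q) (hY : Y = p ++ y ++ q) (hZ : Z = p ++ z ++ q)

theorem whisk_rfl (f : (⟨x⟩ : STL A) ⟶ ⟨y⟩) : whisk p q f rfl rfl = wmap p q f := by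
  simp [whisk]

theorem wmap_comp (f : (⟨x⟩ : STL A) ⟶ ⟨y⟩) (g : (⟨y⟩ : STL A) ⟶ ⟨z⟩) :
    wmap p q (f ≫ g) = wmap p q f ≫ wmap p q g := (whiskering A p q).map_comp f g

theorem whisk_of (s : Step x y) : whisk p q (s.hom A) hX hY = (s.whisker p q hX hY).hom A := by
  subst hX hY
  rw [whisk_rfl]
  rfl

theorem whisk_id (hX' : X = p ++ x ++ q) : whisk p q (𝟙 (⟨x⟩ : STL A)) hX hX' = 𝟙 _ := by
  subst hX
  rw [whisk_rfl]
  rfl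

theorem whisk_comp (f : (⟨x⟩ : STL A) ⟶ ⟨y⟩) (g : (⟨y⟩ : STL A) ⟶ ⟨z⟩) :
    whisk p q (f ≫ g) hX hZ = whisk p q f hX hY ≫ whisk p q g hY hZ := by
  subst hX hY hZ
  simp only [whisk_rfl, wmap_comp]

theorem whisk_zero : whisk p q (0 : (⟨x⟩ : STL A) ⟶ ⟨y⟩) hX hY = 0 := by
  subst hX hY
  rw [whisk_rfl]
  rfl

theorem whisk_add (f g : (⟨x⟩ : STL A) ⟶ ⟨y⟩) :
    whisk p q (f + g) hX hY = whisk p q f hX hY + whisk p q g hX hY := by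
  subst hX hY
  simp only [whisk_rfl]
  exact (whiskering A p q).map_add

theorem whisk_smul (a : k) (f : (⟨x⟩ : STL A) ⟶ ⟨y⟩) :
    whisk p q (a • f) hX hY = a • whisk p q f hX hY := by
  subst hX hY
  simp only [whisk_rfl]
  exact Functor.Linear.map_smul (F := whiskering A p q) f a

theorem whisk_sub (f g : (⟨x⟩ : STL A) ⟶ ⟨y⟩) :
    whisk p q (f - g) hX hY = whisk p q f hX hY - whisk p q g hX hY := by
  subst hX hY
  simp only [whisk_rfl]
  exact (whiskering A p q).map_sub

/-- Since `x ++ []` is not definitionally `x`, this is checked on generators and extended by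
induction. -/
theorem whisk_nil (f : (⟨x⟩ : STL A) ⟶ ⟨y⟩) (hX : x = [] ++ x ++ []) (hY : y = [] ++ y ++ []) :
    whisk [] [] f hX hY = f := by
  refine hom_induction (P := fun x y f => ∀ (hX : x = [] ++ x ++ []) (hY : y = [] ++ y ++ []),
    whisk [] [] f hX hY = f) ?_ ?_ ?_ ?_ ?_ ?_ f hX hY
  · intro x y s hX hY
    rw [whisk_of]
    congr 1
    cases s <;> simp [Step.whisker]
  · intro x hX hY
    rw [whisk_id]
  · intro x y z f g hf hg hX hY
    rw [whisk_comp [] [] hX (Y := y) (by simp) hY, hf, hg]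
  · intro x y hX hY
    rw [whisk_zero]
  · intro x y f g hf hg hX hY
    rw [whisk_add, hf, hg]
  · intro x y a f hf hX hY
    rw [whisk_smul, hf]

theorem whisk_whisk (p' q' : List S) {X' Y' : List S} (hX' : X' = p' ++ X ++ q')
    (hY' : Y' = p' ++ Y ++ q') (f : (⟨x⟩ : STL A) ⟶ ⟨y⟩) :
    whisk p' q' (whisk p q f hX hY) hX' hY'
      = whisk (p' ++ p) (q ++ q') f (by simp [hX', hX]) (by simp [hY', hY]) := by
  refine hom_induction (P := fun x y f => ∀ (X Y X' Y' : List S)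
    (hX : X = p ++ x ++ q) (hY : Y = p ++ y ++ q) (hX' : X' = p' ++ X ++ q')
    (hY' : Y' = p' ++ Y ++ q'), whisk p' q' (whisk p q f hX hY) hX' hY'
      = whisk (p' ++ p) (q ++ q') f (by simp [hX', hX]) (by simp [hY', hY]))
      ?_ ?_ ?_ ?_ ?_ ?_ f _ _ _ _ hX hY hX' hY'
  · intro x y s X Y X' Y' hX hY hX' hY'
    rw [whisk_of, whisk_of, whisk_of, Step.whisker_whisker]
  · intro x X Y X' Y' hX hY hX' hY'
    subst hX hY hX' hY'
    rw [whisk_id, whisk_id, whisk_id]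
  · intro x y z f g hf hg X Y X' Y' hX hY hX' hY'
    rw [whisk_comp p q hX rfl hY, whisk_comp p' q' hX' rfl hY',
      hf X _ X' _ hX rfl hX' rfl, hg _ Y _ Y' rfl hY rfl hY', ← whisk_comp]
  · intros
    simp only [whisk_zero]
  · intro x y f g hf hg X Y X' Y' hX hY hX' hY'
    rw [whisk_add, whisk_add, whisk_add, hf, hg]
  · intro x y a f hf X Y X' Y' hX hY hX' hY'
    rw [whisk_smul, whisk_smul, whisk_smul, hf]

end

/-- Generators preserve the outer colours. This keeps the gluing colour `d` in place at all
intermediate sequences when the interchange law is extended to composites. -/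
theorem Step.getLast_eq {x y : List S} (s : Step x y) (p : List S) (d : S) (hx : x = p ++ [d]) :
    ∃ p', y = p' ++ [d] := by
  cases s with
  | cup l b c r hbc h h' =>
    rcases List.eq_nil_or_concat r with rfl | ⟨r', e, rfl⟩
    · rw [hx] at h
      have := List.append_inj' h rfl
      simp at this
      exact ⟨l ++ [b, c], by simp [h', this.2]⟩
    · rw [hx] at h
      have h2 : p ++ [d] = (l ++ b :: r') ++ [e] := by simpa using h
      have := List.append_inj' h2 rfl
      simp at this
      exact ⟨l ++ b :: c :: b :: r', by simp [h', this.2]⟩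
  | cap l b c r hbc h h' =>
    rcases List.eq_nil_or_concat r with rfl | ⟨r', e, rfl⟩
    · rw [hx] at h
      have h2 : p ++ [d] = (l ++ [b, c]) ++ [b] := by simpa using h
      have := List.append_inj' h2 rfl
      simp at this
      exact ⟨l, by simp [h', this.2]⟩
    · rw [hx] at h
      have h2 : p ++ [d] = (l ++ b :: c :: b :: r') ++ [e] := by simpa using h
      have := List.append_inj' h2 rfl
      simp at this
      exact ⟨l ++ b :: r', by simp [h', this.2]⟩

theorem Step.head_eq {x y : List S} (s : Step x y) (q : List S) (d : S) (hx : x = d :: q) :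
    ∃ q', y = d :: q' := by
  cases s with
  | cup l b c r hbc h h' =>
    cases l with
    | nil => rw [hx] at h; simp at h; exact ⟨_, by rw [h', h.1]; rfl⟩
    | cons e l => rw [hx] at h; simp at h; exact ⟨_, by rw [h', h.1]; rfl⟩
  | cap l b c r hbc h h' =>
    cases l with
    | nil => rw [hx] at h; simp at h; exact ⟨_, by rw [h', h.1]; rfl⟩
    | cons e l => rw [hx] at h; simp at h; exact ⟨_, by rw [h', h.1]; rfl⟩

/-- The composites of generators. -/
inductive StepWord : ∀ {x y : List S}, ((⟨x⟩ : STL A) ⟶ ⟨y⟩) → Prop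
  | id (x : List S) : StepWord (𝟙 (⟨x⟩ : STL A))
  | snoc {x y z : List S} {f : (⟨x⟩ : STL A) ⟶ ⟨y⟩} (hf : StepWord f) (s : Step y z) :
      StepWord (f ≫ s.hom A)

theorem StepWord.comp {x y z : List S} {f : (⟨x⟩ : STL A) ⟶ ⟨y⟩} {g : (⟨y⟩ : STL A) ⟶ ⟨z⟩}
    (hf : StepWord f) (hg : StepWord g) : StepWord (f ≫ g) := by
  induction hg with
  | id => rwa [Category.comp_id]
  | snoc _ s ih =>
    rw [← Category.assoc]
    exact .snoc ih s

theorem Step.stepWord {x y : List S} (s : Step x y) : StepWord (s.hom A) := by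
  rw [← Category.id_comp (s.hom A)]
  exact .snoc (.id x) s

/-- If composites of elements of `P` and `Q` lie in `M`, so do those of their spans. -/
theorem comp_mem_of_span {x y z : STL A} {P : Set (x ⟶ y)} {Q : Set (y ⟶ z)}
    {M : Submodule k (x ⟶ z)} (h : ∀ f ∈ P, ∀ g ∈ Q, f ≫ g ∈ M) {f : x ⟶ y} {g : y ⟶ z}
    (hf : f ∈ Submodule.span k P) (hg : g ∈ Submodule.span k Q) : f ≫ g ∈ M := by
  induction hf using Submodule.span_induction with
  | mem f hf =>
    induction hg using Submodule.span_induction with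
    | mem g hg => exact h f hf g hg
    | zero => simp
    | add g g' _ _ h1 h2 => rw [Preadditive.comp_add]; exact M.add_mem h1 h2
    | smul a g _ h1 => rw [Linear.comp_smul]; exact M.smul_mem a h1
  | zero => simp
  | add f f' _ _ h1 h2 => rw [Preadditive.add_comp]; exact M.add_mem h1 h2
  | smul a f _ h1 => rw [Linear.smul_comp]; exact M.smul_mem a h1

theorem mem_span_stepWord {x y : List S} (f : (⟨x⟩ : STL A) ⟶ ⟨y⟩) :
    f ∈ Submodule.span k {g : (⟨x⟩ : STL A) ⟶ ⟨y⟩ | StepWord g} := by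
  refine hom_induction (P := fun x y f => f ∈ Submodule.span k {g | StepWord g})
    ?_ ?_ ?_ ?_ ?_ ?_ f
  · exact fun _ _ s => Submodule.subset_span s.stepWord
  · exact fun x => Submodule.subset_span (.id x)
  · exact fun _ _ _ f g hf hg => comp_mem_of_span
      (fun f hf g hg => Submodule.subset_span (StepWord.comp hf hg)) hf hg
  · exact fun _ _ => Submodule.zero_mem _
  · exact fun _ _ f g hf hg => Submodule.add_mem _ hf hg
  · exact fun _ _ a f hf => Submodule.smul_mem _ a hf

theorem interchange_step {X Y Y' Z : List S} (p p' : List S) (d : S) (q q' : List S)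
    (f : Step (p ++ [d]) (p' ++ [d])) (g : Step (d :: q) (d :: q'))
    (hX : X = p ++ d :: q) (hY : Y = p' ++ d :: q) (hY' : Y' = p ++ d :: q')
    (hZ : Z = p' ++ d :: q') :
    whisk (X := X) (Y := Y) [] q (f.hom A) (by simp [hX]) (by simp [hY]) ≫
        whisk (Y := Z) p' [] (g.hom A) (by simp [hY]) (by simp [hZ])
      = whisk (X := X) (Y := Y') p [] (g.hom A) (by simp [hX]) (by simp [hY']) ≫
        whisk (Y := Z) [] q' (f.hom A) (by simp [hY']) (by simp [hZ]) := by
  simp only [whisk_of]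
  exact Term.toHom_eq_of_rel (Rel.interchange p p' d q q' f g hX hY hY' hZ)

/-- The generator `g` slides past the factors of `f` one at a time. -/
theorem interchange_word_step {x y : List S} {f : (⟨x⟩ : STL A) ⟶ ⟨y⟩} (hf : StepWord f) :
    ∀ {X Y Y' Z : List S} (p p' : List S) (d : S) (q q' : List S) (hx : x = p ++ [d])
    (hy : y = p' ++ [d]) (g : Step (d :: q) (d :: q'))
    (hX : X = p ++ d :: q) (hY : Y = p' ++ d :: q) (hY' : Y' = p ++ d :: q')
    (hZ : Z = p' ++ d :: q'),
    whisk (X := X) (Y := Y) [] q f (by simp [hX, hx]) (by simp [hY, hy]) ≫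
        whisk (Y := Z) p' [] (g.hom A) (by simp [hY]) (by simp [hZ])
      = whisk (X := X) (Y := Y') p [] (g.hom A) (by simp [hX]) (by simp [hY']) ≫
        whisk (Y := Z) [] q' f (by simp [hY', hx]) (by simp [hZ, hy]) := by
  induction hf with
  | id =>
    intro X Y Y' Z p p' d q q' hx hy g hX hY hY' hZ
    subst hx
    obtain rfl : p = p' := by simpa using hy
    subst hX hY hY' hZ
    simp [whisk_id]
  | @snoc y z f hf s ih =>
    intro X Y Y' Z p p' d q q' hx hz g hX hY hY' hZ
    have hlast : ∃ p'', y = p'' ++ [d] := by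
      clear ih hz s
      induction hf with
      | id => exact ⟨p, hx⟩
      | snoc _ s ih =>
        obtain ⟨p1, h1⟩ := ih
        exact s.getLast_eq p1 d h1
    obtain ⟨p'', rfl⟩ := hlast
    subst hz
    rw [whisk_comp [] q (Y := p'' ++ d :: q) _ (by simp) _, Category.assoc,
      interchange_step p'' p' d q q' s g (Y' := p'' ++ d :: q') rfl hY rfl hZ,
      ← Category.assoc, ih p p'' d q q' hx rfl g hX rfl hY' rfl, Category.assoc,
      ← whisk_comp]

theorem interchange_word {x y : List S} {g : (⟨x⟩ : STL A) ⟶ ⟨y⟩} (hg : StepWord g) :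
    ∀ {X Y Y' Z : List S} (p p' : List S) (d : S) (q q' : List S) (hx : x = d :: q)
    (hy : y = d :: q') (f : (⟨p ++ [d]⟩ : STL A) ⟶ ⟨p' ++ [d]⟩) (_ : StepWord f)
    (hX : X = p ++ d :: q) (hY : Y = p' ++ d :: q) (hY' : Y' = p ++ d :: q')
    (hZ : Z = p' ++ d :: q'),
    whisk (X := X) (Y := Y) [] q f (by simp [hX]) (by simp [hY]) ≫
        whisk (Y := Z) p' [] g (by simp [hY, hx]) (by simp [hZ, hy])
      = whisk (X := X) (Y := Y') p [] g (by simp [hX, hx]) (by simp [hY', hy]) ≫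
        whisk (Y := Z) [] q' f (by simp [hY']) (by simp [hZ]) := by
  induction hg with
  | id =>
    intro X Y Y' Z p p' d q q' hx hy f hf hX hY hY' hZ
    subst hx
    obtain rfl : q = q' := by simpa using hy
    subst hX hY hY' hZ
    simp [whisk_id]
  | @snoc y z g hg s ih =>
    intro X Y Y' Z p p' d q q' hx hz f hf hX hY hY' hZ
    have hhead : ∃ q'', y = d :: q'' := by
      clear ih hz s
      induction hg with
      | id => exact ⟨q, hx⟩
      | snoc _ s ih =>
        obtain ⟨q1, h1⟩ := ih
        exact s.head_eq q1 d h1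
    obtain ⟨q'', rfl⟩ := hhead
    subst hz
    rw [whisk_comp p' [] (Y := p' ++ d :: q'') _ (by simp) _, ← Category.assoc,
      ih p p' d q q'' hx rfl f hf (Y' := p ++ d :: q'') hX hY rfl rfl, Category.assoc,
      interchange_word_step hf p p' d q'' q' rfl rfl s rfl rfl hY' hZ, ← Category.assoc,
      ← whisk_comp]

/-- The interchange law. -/
theorem interchange {X Y Y' Z : List S} (p p' : List S) (d : S) (q q' : List S)
    (f : (⟨p ++ [d]⟩ : STL A) ⟶ ⟨p' ++ [d]⟩) (g : (⟨d :: q⟩ : STL A) ⟶ ⟨d :: q'⟩)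
    (hX : X = p ++ d :: q) (hY : Y = p' ++ d :: q) (hY' : Y' = p ++ d :: q')
    (hZ : Z = p' ++ d :: q') :
    whisk (X := X) (Y := Y) [] q f (by simp [hX]) (by simp [hY]) ≫
        whisk (Y := Z) p' [] g (by simp [hY]) (by simp [hZ])
      = whisk (X := X) (Y := Y') p [] g (by simp [hX]) (by simp [hY']) ≫
        whisk (Y := Z) [] q' f (by simp [hY']) (by simp [hZ]) := by
  have hf := mem_span_stepWord f
  have hg := mem_span_stepWord g
  induction hf using Submodule.span_induction with
  | mem f hf =>
    induction hg using Submodule.span_induction with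
    | mem g hg => exact interchange_word hg p p' d q q' rfl rfl f hf hX hY hY' hZ
    | zero => simp [whisk_zero]
    | add g g' _ _ h1 h2 =>
      simp only [whisk_add, Preadditive.comp_add, Preadditive.add_comp, h1, h2]
    | smul a g _ h1 => simp only [whisk_smul, Linear.comp_smul, Linear.smul_comp, h1]
  | zero => simp [whisk_zero]
  | add f f' _ _ h1 h2 =>
    simp only [whisk_add, Preadditive.comp_add, Preadditive.add_comp, h1, h2]
  | smul a f _ h1 => simp only [whisk_smul, Linear.comp_smul, Linear.smul_comp, h1]

end Homs
end ColoredTL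

namespace ColoredTL

open CategoryTheory

/-! ### Reflection in a horizontal line. -/

section Flip

variable {S : Type u} {k : Type v} [CommRing k] {A : Matrix S S k}

/-- Reflection of a generator in a horizontal line. -/
def Step.flip {x y : List S} : Step x y → Step y x
  | .cup l b c r hbc hx hy => .cap l b c r hbc hy hx
  | .cap l b c r hbc hx hy => .cup l b c r hbc hy hx

theorem Step.flip_whisker {x y X Y : List S} (s : Step x y) (p q : List S)
    (hX : X = p ++ x ++ q) (hY : Y = p ++ y ++ q) :
    (s.whisker p q hX hY).flip = s.flip.whisker p q hY hX := by
  cases s <;> rfl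

/-- Reflection of formal combinations. -/
def Term.flip : ∀ {x y : List S}, Term k x y → Term k y x
  | _, _, .of s => .of s.flip
  | _, _, .id x => .id x
  | _, _, .comp f g => g.flip.comp f.flip
  | _, _, .zero => .zero
  | _, _, .add f g => f.flip.add g.flip
  | _, _, .smul a f => f.flip.smul a

theorem Rel.flip {x y : List S} {f g : Term k x y} (h : Rel A f g) :
    Rel A f.flip g.flip := by
  induction h with
  | refl f => exact .refl _
  | symm _ ih => exact .symm ih
  | trans _ _ ih ih' => exact .trans ih ih'
  | comp_congr _ _ ih ih' => exact .comp_congr ih' ih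
  | add_congr _ _ ih ih' => exact .add_congr ih ih'
  | smul_congr a _ ih => exact .smul_congr a ih
  | id_comp f => exact .comp_id _
  | comp_id f => exact .id_comp _
  | assoc f g h => exact (Rel.assoc _ _ _).symm
  | add_assoc f g h => exact .add_assoc _ _ _
  | add_comm f g => exact .add_comm _ _
  | zero_add f => exact .zero_add _
  | zero_smul f => exact .zero_smul _
  | one_smul f => exact .one_smul _
  | mul_smul a b f => exact .mul_smul _ _ _
  | add_smul a b f => exact .add_smul _ _ _
  | smul_add a f g => exact .smul_add _ _ _
  | add_comp f f' g => exact .comp_add _ _ _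
  | comp_add f g g' => exact .add_comp _ _ _
  | smul_comp a f g => exact .comp_smul _ _ _
  | comp_smul a f g => exact .smul_comp _ _ _
  | interchange u u' d w w' f g hX hY hY' hZ =>
    simp only [Term.flip, Step.flip_whisker]
    -- Reflection exchanges source and target, so the relation is needed for the reflected
    -- generators, with the two sides exchanged.
    exact (Rel.interchange (A := A) u' u d w' w f.flip g.flip hZ hY' hY hX).symm
  | zigzag_left l b c r hbc hx hy => exact Rel.zigzag_right l b c r hbc hx hy
  | zigzag_right l b c r hbc hx hy => exact Rel.zigzag_left l b c r hbc hx hy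
  | circle l b c r hbc hx hy => exact Rel.circle l b c r hbc hx hy

/-- Reflection of morphisms in a horizontal line. -/
def flip {x y : List S} (f : (⟨x⟩ : STL A) ⟶ ⟨y⟩) : (⟨y⟩ : STL A) ⟶ ⟨x⟩ :=
  Quotient.map (sa := homSetoid A x y) (sb := homSetoid A y x) Term.flip
    (fun _ _ h => Rel.flip h) f

theorem flip_step {x y : List S} (s : Step x y) : flip (s.hom A) = s.flip.hom A := rfl

theorem flip_id (x : List S) : flip (𝟙 (⟨x⟩ : STL A)) = 𝟙 _ := rfl

theorem flip_comp {x y z : List S} (f : (⟨x⟩ : STL A) ⟶ ⟨y⟩) (g : (⟨y⟩ : STL A) ⟶ ⟨z⟩) :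
    flip (f ≫ g) = flip g ≫ flip f :=
  Quotient.inductionOn₂ f g fun _ _ => rfl

theorem flip_zero (x y : List S) : flip (0 : (⟨x⟩ : STL A) ⟶ ⟨y⟩) = 0 := rfl

theorem flip_add {x y : List S} (f g : (⟨x⟩ : STL A) ⟶ ⟨y⟩) :
    flip (f + g) = flip f + flip g :=
  Quotient.inductionOn₂ f g fun _ _ => rfl

theorem flip_smul {x y : List S} (a : k) (f : (⟨x⟩ : STL A) ⟶ ⟨y⟩) :
    flip (a • f) = a • flip f :=
  Quotient.inductionOn f fun _ => rfl

theorem flip_sub {x y : List S} (f g : (⟨x⟩ : STL A) ⟶ ⟨y⟩) :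
    flip (f - g) = flip f - flip g := by
  have h : f - g = f + (-1 : k) • g := by rw [neg_one_smul, sub_eq_add_neg]
  rw [h, flip_add, flip_smul, neg_one_smul, ← sub_eq_add_neg]

theorem flip_whisk (p q : List S) {x y X Y : List S} (hX : X = p ++ x ++ q)
    (hY : Y = p ++ y ++ q) (f : (⟨x⟩ : STL A) ⟶ ⟨y⟩) :
    flip (whisk p q f hX hY) = whisk p q (flip f) hY hX := by
  subst hX hY
  rw [whisk_rfl, whisk_rfl]
  refine hom_induction (P := fun x y f => flip (wmap p q f) = wmap p q (flip f))
    ?_ ?_ ?_ ?_ ?_ ?_ f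
  · intro x y s
    rw [← whisk_rfl, whisk_of, flip_step, flip_step, Step.flip_whisker, ← whisk_of, whisk_rfl]
  · intros; rfl
  · intro x y z f g hf hg
    rw [wmap_comp, flip_comp, hf, hg, ← wmap_comp, flip_comp]
  · intros; rfl
  · intro x y f g hf hg
    simp only [← whisk_rfl] at *
    simp only [whisk_add, flip_add, hf, hg]
  · intro x y a f hf
    simp only [← whisk_rfl] at *
    simp only [whisk_smul, flip_smul, hf]

theorem flip_flip {x y : List S} (f : (⟨x⟩ : STL A) ⟶ ⟨y⟩) : flip (flip f) = f := by
  refine hom_induction (P := fun x y f => flip (flip f) = f) ?_ ?_ ?_ ?_ ?_ ?_ f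
  · intro x y s
    rw [flip_step, flip_step]
    cases s <;> rfl
  · intros; rfl
  · intro x y z f g hf hg
    rw [flip_comp, flip_comp, hf, hg]
  · intros; rfl
  · intro x y f g hf hg
    rw [flip_add, flip_add, hf, hg]
  · intro x y a f hf
    rw [flip_smul, flip_smul, hf]

end Flip

/-! ### Change of scalars. -/

section BaseChange

variable {S : Type u} {R : Type*} {k : Type*} [CommRing R] [CommRing k]

/-- Change of scalars in formal combinations. -/
def Term.baseChange (φ : R →+* k) : ∀ {x y : List S}, Term R x y → Term k x y
  | _, _, .of s => .of s
  | _, _, .id x => .id x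
  | _, _, .comp f g => (f.baseChange φ).comp (g.baseChange φ)
  | _, _, .zero => .zero
  | _, _, .add f g => (f.baseChange φ).add (g.baseChange φ)
  | _, _, .smul a f => (f.baseChange φ).smul (φ a)

theorem Rel.baseChange {B : Matrix S S R} {A : Matrix S S k} (φ : R →+* k)
    (hA : ∀ b c, A b c = φ (B b c)) {x y : List S} {f g : Term R x y} (h : Rel B f g) :
    Rel A (f.baseChange φ) (g.baseChange φ) := by
  induction h with
  | refl f => exact .refl _
  | symm _ ih => exact .symm ih
  | trans _ _ ih ih' => exact .trans ih ih'
  | comp_congr _ _ ih ih' => exact .comp_congr ih ih'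
  | add_congr _ _ ih ih' => exact .add_congr ih ih'
  | smul_congr a _ ih => exact .smul_congr _ ih
  | id_comp f => exact .id_comp _
  | comp_id f => exact .comp_id _
  | assoc f g h => exact .assoc _ _ _
  | add_assoc f g h => exact .add_assoc _ _ _
  | add_comm f g => exact .add_comm _ _
  | zero_add f => exact .zero_add _
  | zero_smul f => simp only [Term.baseChange, map_zero]; exact .zero_smul _
  | one_smul f => simp only [Term.baseChange, map_one]; exact .one_smul _
  | mul_smul a b f => simp only [Term.baseChange, map_mul]; exact .mul_smul _ _ _
  | add_smul a b f => simp only [Term.baseChange, map_add]; exact .add_smul _ _ _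
  | smul_add a f g => exact .smul_add _ _ _
  | add_comp f f' g => exact .add_comp _ _ _
  | comp_add f g g' => exact .comp_add _ _ _
  | smul_comp a f g => exact .smul_comp _ _ _
  | comp_smul a f g => exact .comp_smul _ _ _
  | interchange u u' d w w' f g hX hY hY' hZ =>
    exact Rel.interchange (A := A) u u' d w w' f g hX hY hY' hZ
  | zigzag_left l b c r hbc hx hy => exact Rel.zigzag_left l b c r hbc hx hy
  | zigzag_right l b c r hbc hx hy => exact Rel.zigzag_right l b c r hbc hx hy
  | circle l b c r hbc hx hy =>
    simp only [Term.baseChange, ← hA]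
    exact Rel.circle l b c r hbc hx hy

variable {B : Matrix S S R} {A : Matrix S S k} (φ : R →+* k) (hA : ∀ b c, A b c = φ (B b c))

/-- Change of scalars. -/
def baseChange {x y : List S} (f : (⟨x⟩ : STL B) ⟶ ⟨y⟩) : (⟨x⟩ : STL A) ⟶ ⟨y⟩ :=
  Quotient.map (sa := homSetoid B x y) (sb := homSetoid A x y) (Term.baseChange φ)
    (fun _ _ h => Rel.baseChange φ hA h) f

theorem baseChange_step {x y : List S} (s : Step x y) :
    baseChange φ hA (s.hom B) = s.hom A := rfl

theorem baseChange_id (x : List S) : baseChange φ hA (𝟙 (⟨x⟩ : STL B)) = 𝟙 _ := rfl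

theorem baseChange_comp {x y z : List S} (f : (⟨x⟩ : STL B) ⟶ ⟨y⟩)
    (g : (⟨y⟩ : STL B) ⟶ ⟨z⟩) :
    baseChange φ hA (f ≫ g) = baseChange φ hA f ≫ baseChange φ hA g :=
  Quotient.inductionOn₂ f g fun _ _ => rfl

theorem baseChange_zero (x y : List S) :
    baseChange φ hA (0 : (⟨x⟩ : STL B) ⟶ ⟨y⟩) = 0 := rfl

theorem baseChange_add {x y : List S} (f g : (⟨x⟩ : STL B) ⟶ ⟨y⟩) :
    baseChange φ hA (f + g) = baseChange φ hA f + baseChange φ hA g :=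
  Quotient.inductionOn₂ f g fun _ _ => rfl

theorem baseChange_smul {x y : List S} (a : R) (f : (⟨x⟩ : STL B) ⟶ ⟨y⟩) :
    baseChange φ hA (a • f) = φ a • baseChange φ hA f :=
  Quotient.inductionOn f fun _ => rfl

end BaseChange

/-! ### Normal form of diagrams and uniqueness of the top idempotent. -/

section NormalForm

variable {S : Type u} {k : Type v} [CommRing k] {A : Matrix S S k}

/-- The generator is a cup. -/
def Step.IsCup {x y : List S} : Step x y → Prop
  | .cup .. => True
  | .cap .. => False

/-- The generator is a cap. -/
def Step.IsCap {x y : List S} : Step x y → Prop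
  | .cup .. => False
  | .cap .. => True

/-- Composites of cups. -/
inductive CupWord : ∀ {x y : List S}, ((⟨x⟩ : STL A) ⟶ ⟨y⟩) → Prop
  | id (x : List S) : CupWord (𝟙 (⟨x⟩ : STL A))
  | snoc {x y z : List S} {f : (⟨x⟩ : STL A) ⟶ ⟨y⟩} (hf : CupWord f) (s : Step y z)
      (hs : s.IsCup) : CupWord (f ≫ s.hom A)

/-- Composites of caps. -/
inductive CapWord : ∀ {x y : List S}, ((⟨x⟩ : STL A) ⟶ ⟨y⟩) → Prop
  | id (x : List S) : CapWord (𝟙 (⟨x⟩ : STL A))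
  | cons {x y z : List S} {f : (⟨y⟩ : STL A) ⟶ ⟨z⟩} (s : Step x y)
      (hs : s.IsCap) (hf : CapWord f) : CapWord (s.hom A ≫ f)

/-- The possible results of simplifying a cup followed by a cap. -/
inductive Straightened : ∀ {x y : List S}, ((⟨x⟩ : STL A) ⟶ ⟨y⟩) → Prop
  | scalar (x : List S) (a : k) : Straightened (a • 𝟙 (⟨x⟩ : STL A))
  | swap {x y z : List S} (t : Step x y) (s : Step y z) (ht : t.IsCap) (hs : s.IsCup) :
      Straightened (t.hom A ≫ s.hom A)

theorem hom_circle {x y : List S} (l : List S) (b c : S) (r : List S) (hbc : b ≠ c)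
    (hx : x = l ++ b :: r) (hy : y = l ++ b :: c :: b :: r) :
    (Step.cup l b c r hbc hx hy).hom A ≫ (Step.cap l b c r hbc hy hx).hom A = A b c • 𝟙 _ :=
  Term.toHom_eq_of_rel (Rel.circle l b c r hbc hx hy)

theorem hom_zigzag_left {x y : List S} (l : List S) (b c : S) (r : List S) (hbc : b ≠ c)
    (hcb : c ≠ b) (hx : x = l ++ b :: c :: r) (hy : y = l ++ b :: c :: b :: c :: r)
    (hx' : x = l ++ [b] ++ c :: r) (hy' : y = l ++ [b] ++ c :: b :: c :: r) :
    (Step.cup l b c (c :: r) hbc hx hy).hom A ≫ (Step.cap (l ++ [b]) c b r hcb hy' hx').hom A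
      = 𝟙 _ :=
  Term.toHom_eq_of_rel (Rel.zigzag_left l b c r hbc hx hy)

theorem hom_zigzag_right {x y : List S} (l : List S) (b c : S) (r : List S) (hbc : b ≠ c)
    (hcb : c ≠ b) (hx : x = l ++ b :: c :: r) (hy : y = l ++ b :: c :: b :: c :: r)
    (hx' : x = l ++ [b] ++ c :: r) (hy' : y = l ++ [b] ++ c :: b :: c :: r) :
    (Step.cup (l ++ [b]) c b r hcb hx' hy').hom A ≫ (Step.cap l b c (c :: r) hbc hy hx).hom A
      = 𝟙 _ :=
  Term.toHom_eq_of_rel (Rel.zigzag_right l b c r hbc hx hy)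

/-- The position of the cap relative to the cup decides: the same place gives a circle, a shift by
one colour gives a zigzag, and otherwise the two are disjoint and interchange. -/
theorem straightened_cup_cap {x y z : List S} (s : Step x y) (t : Step y z) (hs : s.IsCup)
    (ht : t.IsCap) : Straightened (s.hom A ≫ t.hom A) := by
  cases s with
  | cap => exact hs.elim
  | cup l b c r hbc hx hy =>
  cases t with
  | cup => exact ht.elim
  | cap l' b' c' r' hbc' hy' hz =>
  have h := hy.symm.trans hy'
  rcases List.append_eq_append_iff.1 h with ⟨a, hl, ha⟩ | ⟨a, hl, ha⟩
  · rcases a with _ | ⟨e, _ | ⟨e', a⟩⟩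
    · simp only [List.nil_append, List.cons.injEq] at ha
      obtain ⟨rfl, rfl, -, rfl⟩ := ha
      obtain rfl : l' = l := by simpa using hl
      obtain rfl : z = x := by simp [hz, hx]
      rw [hom_circle]
      exact .scalar z _
    · simp only [List.cons_append, List.nil_append, List.cons.injEq] at ha
      obtain ⟨rfl, rfl, rfl, rfl⟩ := ha
      subst hl
      obtain rfl : z = x := by simp [hz, hx]
      rw [hom_zigzag_left, ← _root_.one_smul k (𝟙 _)]
      exact .scalar z _
    · simp only [List.cons_append, List.cons.injEq] at ha
      obtain ⟨rfl, rfl, ha⟩ := ha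
      subst hl
      -- The cap does not change the colour `b` of the region to the right of the cup, where the
      -- interchange law glues.
      obtain ⟨q', hq'⟩ : ∃ q', a ++ b' :: r' = b :: q' := by
        cases a with
        | nil => simp at ha; exact ⟨r', by simp [ha.1]⟩
        | cons e a => simp at ha; exact ⟨a ++ b' :: r', by simp [ha.1]⟩
      have key := interchange_step (A := A) (X := x) (Y := y) (Y' := l ++ b :: q') (Z := z)
        l (l ++ [b, c]) b r q' (.cup l b c [] hbc rfl (by simp))
        (.cap a b' c' r' hbc' ha hq'.symm) hx (by simp [hy]) rfl (by simp [hz, ← hq'])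
      simp only [whisk_of] at key
      have h2 := Straightened.swap (A := A) _ _ (by simp [Step.whisker, Step.IsCap])
        (by simp [Step.whisker, Step.IsCup]) |> key.symm.subst (motive := fun f => Straightened f)
      convert h2 using 3 <;> simp [Step.whisker]
  · rcases a with _ | ⟨e, _ | ⟨e', a⟩⟩
    · simp only [List.nil_append, List.cons.injEq] at ha
      obtain ⟨rfl, rfl, -, rfl⟩ := ha
      obtain rfl : l = l' := by simpa using hl
      obtain rfl : z = x := by simp [hz, hx]
      rw [hom_circle]
      exact .scalar z _
    · simp only [List.cons_append, List.nil_append, List.cons.injEq] at ha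
      obtain ⟨rfl, rfl, rfl, rfl⟩ := ha
      subst hl
      obtain rfl : z = x := by simp [hz, hx]
      rw [hom_zigzag_right, ← _root_.one_smul k (𝟙 _)]
      exact .scalar z _
    · simp only [List.cons_append, List.cons.injEq] at ha
      obtain ⟨rfl, rfl, ha⟩ := ha
      subst hl
      obtain ⟨q, hq⟩ : ∃ q, a ++ b :: r = b' :: q := by
        cases a with
        | nil => simp at ha; exact ⟨r, by simp [ha.1]⟩
        | cons e a => simp at ha; exact ⟨a ++ b :: r, by simp [ha.1]⟩
      have key := interchange_step (A := A) (X := x) (Y := l' ++ b' :: q) (Y' := y) (Z := z)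
        (l' ++ [b', c']) l' b' q r' (.cap l' b' c' [] hbc' (by simp) rfl)
        (.cup a b c r hbc hq.symm ha) (by simp [hx, hq]) rfl (by simp [hy']) hz
      simp only [whisk_of] at key
      have h2 := Straightened.swap (A := A) _ _ (by simp [Step.whisker, Step.IsCap])
        (by simp [Step.whisker, Step.IsCup]) |> key.subst (motive := fun f => Straightened f)
      convert h2 using 3 <;> simp [Step.whisker]

/-- The diagrams in normal form: caps followed by cups. -/
def normalForms (A : Matrix S S k) (x z : List S) : Set ((⟨x⟩ : STL A) ⟶ ⟨z⟩) :=
  {f | ∃ (y : List S) (g : (⟨x⟩ : STL A) ⟶ ⟨y⟩) (h : (⟨y⟩ : STL A) ⟶ ⟨z⟩),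
    CapWord g ∧ CupWord h ∧ f = g ≫ h}

theorem CapWord.comp {x y z : List S} {f : (⟨x⟩ : STL A) ⟶ ⟨y⟩} {g : (⟨y⟩ : STL A) ⟶ ⟨z⟩}
    (hf : CapWord f) (hg : CapWord g) : CapWord (f ≫ g) := by
  induction hf with
  | id => rwa [Category.id_comp]
  | cons s hs _ ih =>
    rw [Category.assoc]
    exact .cons s hs (ih hg)

theorem Step.capWord {x y : List S} (s : Step x y) (hs : s.IsCap) : CapWord (s.hom A) := by
  rw [← Category.comp_id (s.hom A)]
  exact .cons s hs (.id y)

theorem comp_cup_mem {x y z : List S} (s : Step y z) (hs : s.IsCup)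
    {f : (⟨x⟩ : STL A) ⟶ ⟨y⟩} (hf : f ∈ Submodule.span k (normalForms A x y)) :
    f ≫ s.hom A ∈ Submodule.span k (normalForms A x z) := by
  refine comp_mem_of_span (Q := {s.hom A}) ?_ hf (Submodule.subset_span rfl)
  rintro _ ⟨y, g, h, hg, hh, rfl⟩ _ rfl
  exact Submodule.subset_span ⟨y, g, h ≫ s.hom A, hg, .snoc hh s hs, by simp⟩

/-- The cap travels down through the cups. At each one it either cancels against it, up to a scalar,
or moves past it and meets a shorter composite of cups. -/
theorem CupWord.comp_cap_mem {x y z : List S} {h : (⟨x⟩ : STL A) ⟶ ⟨y⟩} (hh : CupWord h)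
    (t : Step y z) (ht : t.IsCap) :
    h ≫ t.hom A ∈ Submodule.span k (normalForms A x z) := by
  induction hh generalizing z with
  | id =>
    exact Submodule.subset_span ⟨_, t.hom A, 𝟙 _, t.capWord ht, .id _, by simp⟩
  | snoc hf s hs ih =>
    rw [Category.assoc]
    have hst := straightened_cup_cap (A := A) s t hs ht
    revert hst
    generalize s.hom A ≫ t.hom A = e
    intro hst
    cases hst with
    | scalar a =>
      rw [Linear.comp_smul, Category.comp_id]
      exact Submodule.smul_mem _ a
        (Submodule.subset_span ⟨_, 𝟙 _, _, .id _, hf, (Category.id_comp _).symm⟩)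
    | swap t' s' ht' hs' =>
      rw [← Category.assoc]
      exact comp_cup_mem s' hs' (ih t' ht')

/-- Every morphism is a linear combination of diagrams in normal form. -/
theorem mem_span_normalForms {x y : List S} (f : (⟨x⟩ : STL A) ⟶ ⟨y⟩) :
    f ∈ Submodule.span k (normalForms A x y) := by
  refine (Submodule.span_le (p := Submodule.span k (normalForms A x y))).2 ?_
    (mem_span_stepWord f)
  clear f
  intro f hf
  induction hf with
  | id => exact Submodule.subset_span ⟨_, 𝟙 _, 𝟙 _, .id _, .id _, by simp⟩
  | @snoc y z f hf s ih =>
    by_cases hs : s.IsCup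
    · exact comp_cup_mem s hs ih
    · have hs' : s.IsCap := by
        cases s
        · exact (hs trivial).elim
        · trivial
      refine comp_mem_of_span (Q := {s.hom A}) ?_ ih (Submodule.subset_span rfl)
      rintro _ ⟨y', g, h, hg, hh, rfl⟩ _ rfl
      rw [Category.assoc]
      refine comp_mem_of_span (P := {g}) ?_ (Submodule.subset_span rfl)
        (hh.comp_cap_mem s hs')
      rintro _ rfl _ ⟨w, g', h', hg', hh', rfl⟩
      exact Submodule.subset_span ⟨w, _, h', hg.comp hg', hh', (Category.assoc _ _ _).symm⟩

theorem CapWord.length_le {x y : List S} {f : (⟨x⟩ : STL A) ⟶ ⟨y⟩} (hf : CapWord f) :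
    y.length ≤ x.length := by
  induction hf with
  | id => exact le_rfl
  | cons s hs _ ih =>
    cases s with
    | cup => exact hs.elim
    | cap l b c r hbc hx hy =>
      simp only [hx, hy, List.length_append, List.length_cons] at ih ⊢
      omega

/-- Morphisms into `x` that end with a cup. -/
def cupEnding (A : Matrix S S k) (y x : List S) : Submodule k ((⟨y⟩ : STL A) ⟶ ⟨x⟩) :=
  Submodule.span k {f | ∃ (l : List S) (b c : S) (r : List S) (hbc : b ≠ c)
    (hx : x = l ++ b :: c :: b :: r) (g : (⟨y⟩ : STL A) ⟶ ⟨l ++ b :: r⟩),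
    f = g ≫ cupInto A x l b c r hbc hx}

theorem comp_cup_mem_cupEnding {w y x : List S} (s : Step y x) (hs : s.IsCup)
    (g : (⟨w⟩ : STL A) ⟶ ⟨y⟩) : g ≫ s.hom A ∈ cupEnding A w x := by
  match s, hs with
  | .cup l b c r hbc hx hy, _ =>
    revert g
    subst hx
    exact fun g => Submodule.subset_span ⟨l, b, c, r, hbc, hy, g, rfl⟩

/-- In a normal form the caps do not increase the length, so at least one cup is needed to reach the
longer sequence `x`. -/
theorem mem_cupEnding {x y : List S} (h : y.length < x.length) (f : (⟨y⟩ : STL A) ⟶ ⟨x⟩) :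
    f ∈ cupEnding A y x := by
  refine (Submodule.span_le (p := cupEnding A y x)).2 ?_ (mem_span_normalForms f)
  rintro _ ⟨z, g, h', hg, hh, rfl⟩
  have hz := hg.length_le
  cases hh with
  | id => omega
  | snoc hf s hs =>
    rw [← Category.assoc]
    exact comp_cup_mem_cupEnding s hs _

theorem comp_perp_eq_zero {x y : List S} (h : y.length < x.length) (g : (⟨y⟩ : STL A) ⟶ ⟨x⟩)
    {f : (⟨x⟩ : STL A) ⟶ ⟨x⟩} (hf : f ∈ perp A x) : g ≫ f = 0 := by
  have := comp_mem_of_span (M := ⊥) (Q := {f}) ?_ (mem_cupEnding h g) (Submodule.subset_span rfl)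
  · simpa using this
  · rintro _ ⟨l, b, c, r, hbc, hx, g, rfl⟩ _ rfl
    rw [Category.assoc, hf l b c r hbc hx, Limits.comp_zero]
    exact Submodule.zero_mem _

theorem lower_comp_perp {x : List S} {g f : (⟨x⟩ : STL A) ⟶ ⟨x⟩} (hg : g ∈ lowerIdeal A x)
    (hf : f ∈ perp A x) : g ≫ f = 0 := by
  have := comp_mem_of_span (M := ⊥) (Q := {f}) ?_ hg (Submodule.subset_span rfl)
  · simpa using this
  · rintro _ ⟨y, g, h, hy, rfl⟩ _ rfl
    rw [Category.assoc, comp_perp_eq_zero hy h hf, Limits.comp_zero]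
    exact Submodule.zero_mem _

theorem comp_perp_of_coeff {x : List S} {g f : (⟨x⟩ : STL A) ⟶ ⟨x⟩} {a : k}
    (hg : HasIdentityCoeff A x g a) (hf : f ∈ perp A x) : g ≫ f = a • f := by
  have := lower_comp_perp hg hf
  rw [Preadditive.sub_comp, Linear.smul_comp, Category.id_comp, sub_eq_zero] at this
  exact this

theorem flip_mem_lowerIdeal {x : List S} {g : (⟨x⟩ : STL A) ⟶ ⟨x⟩} (hg : g ∈ lowerIdeal A x) :
    flip g ∈ lowerIdeal A x := by
  induction hg using Submodule.span_induction with
  | mem g hg =>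
    obtain ⟨y, g, h, hy, rfl⟩ := hg
    exact Submodule.subset_span ⟨y, flip h, flip g, hy, flip_comp g h⟩
  | zero => exact Submodule.zero_mem _
  | add g g' _ _ h1 h2 => rw [flip_add]; exact Submodule.add_mem _ h1 h2
  | smul a g _ h1 => rw [flip_smul]; exact Submodule.smul_mem _ a h1

theorem HasIdentityCoeff.flip {x : List S} {g : (⟨x⟩ : STL A) ⟶ ⟨x⟩} {a : k}
    (hg : HasIdentityCoeff A x g a) : HasIdentityCoeff A x (flip g) a := by
  have := flip_mem_lowerIdeal hg
  rwa [flip_sub, flip_smul, flip_id] at this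

/-- An element of `B(x)` with identity coefficient `1` is the only one. -/
theorem perp_unique {x : List S} {f g : (⟨x⟩ : STL A) ⟶ ⟨x⟩} (hf : f ∈ perp A x)
    (hf1 : HasIdentityCoeff A x f 1) (hg : g ∈ perp A x) (hg1 : HasIdentityCoeff A x g 1) :
    f = g := by
  -- The product `flip f ≫ h` equals `h`, because `flip f` is the identity modulo terms that `h`
  -- kills, and by reflection it also equals `flip f`.
  have key : ∀ h ∈ perp A x, HasIdentityCoeff A x h 1 → h = ColoredTL.flip f := by
    intro h hh hh1
    have h1 : ColoredTL.flip f ≫ h = h := by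
      rw [comp_perp_of_coeff hf1.flip hh, _root_.one_smul]
    have h2 := congrArg ColoredTL.flip (comp_perp_of_coeff hh1.flip hf)
    rw [flip_comp, flip_flip, _root_.one_smul] at h2
    exact h1.symm.trans h2
  exact (key f hf hf1).trans (key g hg hg1).symm

theorem isTopIdempotent_of {x : List S} {f : (⟨x⟩ : STL A) ⟶ ⟨x⟩} (hf : f ∈ perp A x)
    (hf1 : HasIdentityCoeff A x f 1) : IsTopIdempotent A x f :=
  ⟨hf, by rw [comp_perp_of_coeff hf1 hf, _root_.one_smul], hf1⟩

theorem isTopIdempotent_JW {x : List S} {f : (⟨x⟩ : STL A) ⟶ ⟨x⟩} (hf : f ∈ perp A x)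
    (hf1 : HasIdentityCoeff A x f 1) : IsTopIdempotent A x (JW A x) := by
  have h : ∃ f, IsTopIdempotent A x f := ⟨f, isTopIdempotent_of hf hf1⟩
  rw [JW, dif_pos h]
  exact h.choose_spec

theorem exists_coeff_one {x : List S} (h : TopIdempotentExists A x) :
    ∃ f ∈ perp A x, HasIdentityCoeff A x f 1 := by
  obtain ⟨f, hf, a, ha, hfa⟩ := h
  obtain ⟨b, hb⟩ := ha.exists_left_inv
  refine ⟨b • f, Submodule.smul_mem _ b hf, ?_⟩
  have := Submodule.smul_mem _ b hfa
  rwa [smul_sub, smul_smul, hb] at this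

end NormalForm
end ColoredTL

namespace ColoredTL

open CategoryTheory

/-! ### Path representations -/

section PathOperators

variable {L : Type*} [Field L]

/-- Families of operators on functions of paths, indexed by the height of the starting point. A
path is the list of its steps; `true` is a step up. -/
abbrev PathOp (L : Type*) [Field L] : Type _ := ℤ → Module.End L (List Bool → L)

/-- The change of height in a step. -/
def sgn : Bool → ℤ
  | true => 1
  | false => -1

/-- Let an operator act after the first step. -/
def consOp (O : PathOp L) : PathOp L := fun h =>
  { toFun := fun ψ σ => match σ with
      | [] => 0
      | ε :: σ => O (h + sgn ε) (fun τ => ψ (ε :: τ)) σ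
    map_add' := by
      intro ψ ψ'
      funext σ
      cases σ with
      | nil => simp
      | cons ε σ =>
        exact congrFun ((O (h + sgn ε)).map_add (fun τ => ψ (ε :: τ)) (fun τ => ψ' (ε :: τ))) σ
    map_smul' := by
      intro a ψ
      funext σ
      cases σ with
      | nil => simp
      | cons ε σ =>
        exact congrFun ((O (h + sgn ε)).map_smul a (fun τ => ψ (ε :: τ))) σ }

@[simp] theorem consOp_cons (O : PathOp L) (h : ℤ) (ψ : List Bool → L) (ε : Bool)
    (σ : List Bool) :
    consOp O h ψ (ε :: σ) = O (h + sgn ε) (fun τ => ψ (ε :: τ)) σ := rfl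

theorem consOp_mul (O O' : PathOp L) : consOp (O * O') = consOp O * consOp O' := by
  funext h
  refine LinearMap.ext fun ψ => funext fun σ => ?_
  cases σ <;> rfl

/-- Let an operator act after the first `n` steps. -/
def shiftOp (n : ℕ) (O : PathOp L) : PathOp L := consOp^[n] O

@[simp] theorem shiftOp_zero (O : PathOp L) : shiftOp 0 O = O := rfl

theorem shiftOp_succ (n : ℕ) (O : PathOp L) : shiftOp (n + 1) O = consOp (shiftOp n O) :=
  Function.iterate_succ_apply' _ _ _

theorem shiftOp_add (n m : ℕ) (O : PathOp L) : shiftOp (n + m) O = shiftOp n (shiftOp m O) :=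
  Function.iterate_add_apply _ _ _ _

theorem shiftOp_mul (n : ℕ) (O O' : PathOp L) :
    shiftOp n (O * O') = shiftOp n O * shiftOp n O' := by
  induction n with
  | zero => rfl
  | succ n ih => rw [shiftOp_succ, ih, consOp_mul, ← shiftOp_succ, ← shiftOp_succ]

/-- The height difference of the end points of a path. -/
def height (σ : List Bool) : ℤ := (σ.map sgn).sum

@[simp] theorem height_nil : height [] = 0 := rfl
@[simp] theorem height_cons (ε : Bool) (σ : List Bool) : height (ε :: σ) = sgn ε + height σ := by
  simp [height]
@[simp] theorem height_append (σ τ : List Bool) : height (σ ++ τ) = height σ + height τ := by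
  simp [height]

theorem shiftOp_append (O : PathOp L) (h : ℤ) (ψ : List Bool → L) (σ τ : List Bool) :
    shiftOp σ.length O h ψ (σ ++ τ) = O (h + height σ) (fun μ => ψ (σ ++ μ)) τ := by
  induction σ generalizing h ψ with
  | nil => simp
  | cons ε σ ih =>
    rw [List.length_cons, shiftOp_succ, List.cons_append, consOp_cons, ih, height_cons, add_assoc]
    rfl

/-- The operator of a cup at the left end: it inserts a peak with weight `ρ h`, or a valley. -/
def cupOp (ρ : ℤ → L) : PathOp L := fun h =>
  { toFun := fun ψ σ => ρ h * ψ (true :: false :: σ) + ψ (false :: true :: σ)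
    map_add' := by
      intro ψ ψ'
      funext σ
      simp only [Pi.add_apply]
      ring
    map_smul' := by
      intro a ψ
      funext σ
      simp only [Pi.smul_apply, smul_eq_mul, RingHom.id_apply]
      ring }

/-- The operator of a cap at the left end: it removes a peak, or a valley with weight
`(ρ (h - 1))⁻¹`. -/
def capOp (ρ : ℤ → L) : PathOp L := fun h =>
  { toFun := fun ψ σ => match σ with
      | true :: false :: σ => ψ σ
      | false :: true :: σ => (ρ (h - 1))⁻¹ * ψ σ
      | _ => 0
    map_add' := by
      intro ψ ψ'
      funext σ
      rcases σ with _ | ⟨_ | _, _ | ⟨_ | _, σ⟩⟩ <;> simp [mul_add]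
    map_smul' := by
      intro a ψ
      funext σ
      rcases σ with _ | ⟨_ | _, _ | ⟨_ | _, σ⟩⟩ <;> simp [mul_left_comm] }

theorem cupOp_apply (ρ : ℤ → L) (h : ℤ) (ψ : List Bool → L) (σ : List Bool) :
    cupOp ρ h ψ σ = ρ h * ψ (true :: false :: σ) + ψ (false :: true :: σ) := rfl

section
variable (ρ : ℤ → L) (h : ℤ) (ψ : List Bool → L) (σ : List Bool)
@[simp] theorem capOp_nil : capOp ρ h ψ [] = 0 := rfl
@[simp] theorem capOp_single (ε : Bool) : capOp ρ h ψ [ε] = 0 := by cases ε <;> rfl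
@[simp] theorem capOp_up_down : capOp ρ h ψ (true :: false :: σ) = ψ σ := rfl
@[simp] theorem capOp_down_up :
    capOp ρ h ψ (false :: true :: σ) = (ρ (h - 1))⁻¹ * ψ σ := rfl
@[simp] theorem capOp_up_up : capOp ρ h ψ (true :: true :: σ) = 0 := rfl
@[simp] theorem capOp_down_down : capOp ρ h ψ (false :: false :: σ) = 0 := rfl
end

/-- A peak or a valley returns to its initial height, so an operator further right acts at the same
height; only its position moves by two steps. -/
theorem cupOp_mul_shiftOp (ρ : ℤ → L) (n j : ℕ) (O : PathOp L) :
    shiftOp n (cupOp ρ) * shiftOp (n + j + 2) O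
      = shiftOp (n + j) O * shiftOp n (cupOp ρ) := by
  rw [add_assoc, shiftOp_add, shiftOp_add n j, ← shiftOp_mul, ← shiftOp_mul]
  congr 1
  funext h
  refine LinearMap.ext fun ψ => funext fun σ => ?_
  have e : cupOp ρ h ψ = ρ h • (fun σ => ψ (true :: false :: σ))
      + fun σ => ψ (false :: true :: σ) := rfl
  simp only [Pi.mul_apply, Module.End.mul_apply]
  rw [cupOp_apply, e, map_add, map_smul, shiftOp_succ, shiftOp_succ]
  simp [sgn]

theorem capOp_mul_shiftOp (ρ : ℤ → L) (n j : ℕ) (O : PathOp L) :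
    shiftOp n (capOp ρ) * shiftOp (n + j) O
      = shiftOp (n + j + 2) O * shiftOp n (capOp ρ) := by
  rw [add_assoc, shiftOp_add, shiftOp_add n (j + 2), ← shiftOp_mul, ← shiftOp_mul]
  congr 1
  funext h
  refine LinearMap.ext fun ψ => funext fun σ => ?_
  simp only [Pi.mul_apply, Module.End.mul_apply]
  rw [shiftOp_succ, shiftOp_succ]
  rcases σ with _ | ⟨_ | _, _ | ⟨_ | _, σ⟩⟩
  · rfl
  · rfl
  · simp [sgn]
    exact (congrFun (LinearMap.map_zero (shiftOp j O _)) σ).symm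
  · have e : (fun τ => (ρ (h - 1))⁻¹ * ψ τ) = (ρ (h - 1))⁻¹ • ψ := rfl
    simp [sgn, e]
  · rfl
  · simp [sgn]
  · simp [sgn]
    exact (congrFun (LinearMap.map_zero (shiftOp j O _)) σ).symm

/-- Restriction to the paths through words with `n` letters. -/
def truncOp (L : Type*) [Field L] (n : ℕ) : PathOp L := fun _ =>
  { toFun := fun ψ σ => if σ.length + 1 = n then ψ σ else 0
    map_add' := by
      intro ψ ψ'
      funext σ
      by_cases h : σ.length + 1 = n <;> simp [h]
    map_smul' := by
      intro a ψ
      funext σ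
      by_cases h : σ.length + 1 = n <;> simp [h] }

theorem truncOp_apply (n : ℕ) (h : ℤ) (ψ : List Bool → L) (σ : List Bool) :
    truncOp L n h ψ σ = if σ.length + 1 = n then ψ σ else 0 := rfl

theorem truncOp_mul_self (n : ℕ) : truncOp L n * truncOp L n = truncOp L n := by
  funext h
  refine LinearMap.ext fun ψ => funext fun σ => ?_
  simp only [Pi.mul_apply, Module.End.mul_apply, truncOp_apply]
  split_ifs <;> rfl

theorem truncOp_mul_congr {n : ℕ} {O O' : PathOp L}
    (H : ∀ h ψ σ, σ.length + 1 = n → O h ψ σ = O' h ψ σ) :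
    truncOp L n * O = truncOp L n * O' := by
  funext h
  refine LinearMap.ext fun ψ => funext fun σ => ?_
  simp only [Pi.mul_apply, Module.End.mul_apply, truncOp_apply]
  split_ifs with hσ
  · exact H h ψ σ hσ
  · rfl

theorem shiftOp_cupOp_length (ρ : ℤ → L) (n N : ℕ) (hn : n < N) :
    truncOp L N * shiftOp n (cupOp ρ) = truncOp L N * shiftOp n (cupOp ρ) * truncOp L (N + 2) := by
  rw [mul_assoc]
  refine truncOp_mul_congr fun h ψ σ hσ => ?_
  obtain ⟨σ, τ, rfl, rfl⟩ : ∃ σ₁ σ₂, σ = σ₁ ++ σ₂ ∧ n = σ₁.length :=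
    ⟨σ.take n, σ.drop n, by simp, by simp; omega⟩
  simp only [Pi.mul_apply, Module.End.mul_apply]
  rw [shiftOp_append, shiftOp_append, cupOp_apply, cupOp_apply]
  simp only [truncOp_apply]
  simp at hσ
  rw [if_pos (by simp; omega), if_pos (by simp; omega)]

theorem shiftOp_capOp_length (ρ : ℤ → L) (n N : ℕ) (hn : n < N) :
    truncOp L (N + 2) * shiftOp n (capOp ρ)
      = truncOp L (N + 2) * shiftOp n (capOp ρ) * truncOp L N := by
  rw [mul_assoc]
  refine truncOp_mul_congr fun h ψ σ hσ => ?_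
  obtain ⟨σ, τ, rfl, rfl⟩ : ∃ σ₁ σ₂, σ = σ₁ ++ σ₂ ∧ n = σ₁.length :=
    ⟨σ.take n, σ.drop n, by simp, by simp; omega⟩
  simp only [Pi.mul_apply, Module.End.mul_apply]
  rw [shiftOp_append, shiftOp_append]
  simp at hσ
  rcases τ with _ | ⟨_ | _, _ | ⟨_ | _, τ⟩⟩ <;> simp [truncOp_apply]
  all_goals intro h; simp at hσ; omega

end PathOperators

/-! ### The representation of the 2-category on functions of paths. -/

section Representation

variable {S : Type u} {k : Type*} [CommRing k] {L : Type*} [Field L]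

/-- Weights for a path representation of the coloured Temperley-Lieb 2-category of `A`. -/
structure PathWeights (A : Matrix S S k) (φ : k →+* L) where
  /-- The weight of a peak that starts in a region of colour `b` at the given height. -/
  r : S → S → ℤ → L
  ne_zero : ∀ b c h, r b c h ≠ 0
  circle : ∀ b c, b ≠ c → ∀ h, r b c h + (r c b (h - 1))⁻¹ = φ (A b c)

variable {A : Matrix S S k} {φ : k →+* L} (W : PathWeights A φ)

/-- The operator of a generator. -/
def Step.op {x y : List S} : Step x y → PathOp L
  | .cup l b c _ _ _ _ => shiftOp l.length (cupOp (W.r b c))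
  | .cap l b c _ _ _ _ => shiftOp l.length (capOp (W.r c b))

theorem Step.op_whisker {x y X Y : List S} (s : Step x y) (p q : List S)
    (hX : X = p ++ x ++ q) (hY : Y = p ++ y ++ q) :
    (s.whisker p q hX hY).op W = shiftOp p.length (s.op W) := by
  cases s <;> simp [Step.whisker, Step.op, shiftOp_add]

theorem Step.op_length {x y : List S} (s : Step x y) :
    truncOp L x.length * s.op W = truncOp L x.length * s.op W * truncOp L y.length := by
  cases s with
  | cup l b c r hbc hx hy =>
    have e : y.length = x.length + 2 := by simp [hx, hy]; omega
    rw [e]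
    exact shiftOp_cupOp_length _ _ _ (by simp [hx])
  | cap l b c r hbc hx hy =>
    have e : x.length = y.length + 2 := by simp [hx, hy]; omega
    rw [e]
    exact shiftOp_capOp_length _ _ _ (by simp [hy])

/-- The operator of a formal combination. -/
def Term.op : ∀ {x y : List S}, Term k x y → PathOp L
  | _, _, .of s => s.op W
  | _, _, .id _ => 1
  | _, _, .comp f g => f.op * g.op
  | _, _, .zero => 0
  | _, _, .add f g => f.op + g.op
  | _, _, .smul a f => φ a • f.op

theorem Term.op_length {x y : List S} (f : Term k x y) :
    truncOp L x.length * f.op W = truncOp L x.length * f.op W * truncOp L y.length := by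
  induction f with
  | of s => exact s.op_length W
  | id x => simp [Term.op, truncOp_mul_self]
  | comp f g hf hg =>
    simp only [Term.op]
    rw [← mul_assoc, hf, mul_assoc (_ * _) (truncOp L _) (Term.op W g), hg]
    simp only [mul_assoc, truncOp_mul_self]
  | zero => simp [Term.op]
  | add f g hf hg => simp only [Term.op, mul_add, add_mul]; rw [← hf, ← hg]
  | smul a f hf => simp only [Term.op, mul_smul_comm, smul_mul_assoc]; rw [← hf]

/-- The restriction to paths of the right length is essential: the zigzag relations fail on paths
that end before the strand to be straightened. -/
theorem Rel.op {x y : List S} {f g : Term k x y} (h : Rel A f g) :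
    truncOp L x.length * f.op W = truncOp L x.length * g.op W := by
  induction h with
  | refl f => rfl
  | symm _ ih => exact ih.symm
  | trans _ _ ih ih' => exact ih.trans ih'
  | @comp_congr x y z f f' g g' _ _ ih ih' =>
    simp only [Term.op]
    rw [← mul_assoc, Term.op_length, mul_assoc, ih', ← mul_assoc, ← Term.op_length, ih, mul_assoc]
  | add_congr _ _ ih ih' => simp only [Term.op, mul_add, ih, ih']
  | smul_congr a _ ih => simp only [Term.op, mul_smul_comm, ih]
  | id_comp f => simp [Term.op]
  | comp_id f => simp [Term.op]
  | assoc f g h => simp [Term.op, mul_assoc]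
  | add_assoc f g h => simp only [Term.op, _root_.add_assoc]
  | add_comm f g => simp only [Term.op, _root_.add_comm]
  | zero_add f => simp only [Term.op, _root_.zero_add]
  | zero_smul f => simp [Term.op]
  | one_smul f => simp [Term.op]
  | mul_smul a b f => simp only [Term.op, map_mul, SemigroupAction.mul_smul]
  | add_smul a b f => simp only [Term.op, map_add, _root_.add_smul]
  | smul_add a f g => simp only [Term.op, _root_.smul_add]
  | add_comp f f' g => simp only [Term.op, add_mul]
  | comp_add f g g' => simp only [Term.op, mul_add]
  | smul_comp a f g => simp only [Term.op, smul_mul_assoc]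
  | comp_smul a f g => simp only [Term.op, mul_smul_comm]
  | interchange u u' d w w' f g hX hY hY' hZ =>
    simp only [Term.op, Step.op_whisker]
    congr 1
    generalize g.op W = O
    simp only [List.length_nil, shiftOp_zero]
    generalize hp : u ++ [d] = p at f
    generalize hp' : u' ++ [d] = p' at f
    have hl := congrArg List.length hp
    have hl' := congrArg List.length hp'
    simp only [List.length_append, List.length_cons, List.length_nil] at hl hl'
    cases f with
    | cup l b c r hbc hx hy =>
      simp only [hx, hy, List.length_append, List.length_cons] at hl hl'
      obtain ⟨j, hj⟩ : ∃ j, u.length = l.length + j := ⟨r.length, by omega⟩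
      have hj' : u'.length = l.length + j + 2 := by omega
      rw [hj, hj']
      exact cupOp_mul_shiftOp _ _ _ _
    | cap l b c r hbc hx hy =>
      simp only [hx, hy, List.length_append, List.length_cons] at hl hl'
      obtain ⟨j, hj⟩ : ∃ j, u'.length = l.length + j := ⟨r.length, by omega⟩
      have hj' : u.length = l.length + j + 2 := by omega
      rw [hj, hj']
      exact capOp_mul_shiftOp _ _ _ _
  | zigzag_left l b c r hbc hx hy =>
    refine truncOp_mul_congr fun h ψ σ hσ => ?_
    simp only [Term.op, Step.op, List.length_append, List.length_cons, List.length_nil,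
      shiftOp_add, ← shiftOp_mul]
    obtain ⟨σ, τ, rfl, hl⟩ : ∃ σ₁ σ₂, σ = σ₁ ++ σ₂ ∧ l.length = σ₁.length :=
      ⟨σ.take l.length, σ.drop l.length, by simp, by simp [hx] at hσ ⊢; omega⟩
    rw [hl, shiftOp_append]
    simp only [Pi.mul_apply, Module.End.mul_apply, cupOp_apply, Pi.one_apply, Module.End.one_apply]
    have hτ : τ ≠ [] := by rintro rfl; simp [hx] at hσ; omega
    obtain ⟨ε, τ, rfl⟩ := List.exists_cons_of_ne_nil hτ
    simp only [shiftOp_succ, shiftOp_zero, consOp_cons]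
    -- The strand is the single step `ε`. If it goes up, the weight of the new peak cancels the
    -- inverse weight of the removed valley; if it goes down, both weights are 1.
    have := W.ne_zero b c (h + height σ)
    cases ε <;> simp [sgn, this]
  | zigzag_right l b c r hbc hx hy =>
    refine truncOp_mul_congr fun h ψ σ hσ => ?_
    simp only [Term.op, Step.op, List.length_append, List.length_cons, List.length_nil,
      shiftOp_add, ← shiftOp_mul]
    obtain ⟨σ, τ, rfl, hl⟩ : ∃ σ₁ σ₂, σ = σ₁ ++ σ₂ ∧ l.length = σ₁.length :=
      ⟨σ.take l.length, σ.drop l.length, by simp, by simp [hx] at hσ ⊢; omega⟩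
    rw [hl, shiftOp_append]
    simp only [Pi.mul_apply, Module.End.mul_apply, Pi.one_apply, Module.End.one_apply]
    have hτ : τ ≠ [] := by rintro rfl; simp [hx] at hσ; omega
    obtain ⟨ε, τ, rfl⟩ := List.exists_cons_of_ne_nil hτ
    simp only [shiftOp_succ, shiftOp_zero, consOp_cons, cupOp_apply]
    have := W.ne_zero c b (h + height σ - 1)
    cases ε <;> simp [sgn, ← sub_eq_add_neg, this]
  | circle l b c r hbc hx hy =>
    refine truncOp_mul_congr fun h ψ σ hσ => ?_
    simp only [Term.op, Step.op, ← shiftOp_mul]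
    obtain ⟨σ, τ, rfl, hl⟩ : ∃ σ₁ σ₂, σ = σ₁ ++ σ₂ ∧ l.length = σ₁.length :=
      ⟨σ.take l.length, σ.drop l.length, by simp, by simp [hx] at hσ ⊢; omega⟩
    rw [hl, shiftOp_append]
    simp only [Pi.mul_apply, Module.End.mul_apply, cupOp_apply, capOp_up_down, capOp_down_up,
      ← add_mul, W.circle b c hbc, Pi.smul_apply, LinearMap.smul_apply, smul_eq_mul,
      Pi.one_apply, Module.End.one_apply]

/-- The operator of a morphism. -/
def homOp {x y : List S} (f : (⟨x⟩ : STL A) ⟶ ⟨y⟩) : PathOp L :=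
  Quotient.lift (s := homSetoid A x y) (fun f : Term k x y => truncOp L x.length * f.op W)
    (fun _ _ h => Rel.op W h) f

theorem homOp_step {x y : List S} (s : Step x y) :
    homOp W (s.hom A) = truncOp L x.length * s.op W := rfl

theorem homOp_id (x : List S) : homOp W (𝟙 (⟨x⟩ : STL A)) = truncOp L x.length :=
  mul_one (truncOp L x.length)

theorem homOp_comp {x y z : List S} (f : (⟨x⟩ : STL A) ⟶ ⟨y⟩) (g : (⟨y⟩ : STL A) ⟶ ⟨z⟩) :
    homOp W (f ≫ g) = homOp W f * homOp W g := by
  refine Quotient.inductionOn₂ f g fun f g => ?_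
  change truncOp L x.length * (f.op W * g.op W)
    = truncOp L x.length * f.op W * (truncOp L y.length * g.op W)
  rw [← mul_assoc, ← mul_assoc, ← Term.op_length]

theorem homOp_zero (x y : List S) : homOp W (0 : (⟨x⟩ : STL A) ⟶ ⟨y⟩) = 0 :=
  mul_zero (truncOp L x.length)

theorem homOp_add {x y : List S} (f g : (⟨x⟩ : STL A) ⟶ ⟨y⟩) :
    homOp W (f + g) = homOp W f + homOp W g :=
  Quotient.inductionOn₂ f g fun f g => mul_add (truncOp L x.length) (f.op W) (g.op W)

theorem homOp_smul {x y : List S} (a : k) (f : (⟨x⟩ : STL A) ⟶ ⟨y⟩) :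
    homOp W (a • f) = φ a • homOp W f :=
  Quotient.inductionOn f fun f => mul_smul_comm (φ a) (truncOp L x.length) (f.op W)

/-- A strand on the left consumes the first step of a path. This is what makes the matrices of half
diagrams computable by recursion. -/
theorem homOp_whisk_cons {x y X Y : List S} (e : S) (f : (⟨x⟩ : STL A) ⟶ ⟨y⟩)
    (hX : X = [e] ++ x ++ []) (hY : Y = [e] ++ y ++ []) (h : ℤ) (ψ : List Bool → L) (ε : Bool)
    (σ : List Bool) :
    homOp W (whisk [e] [] f hX hY) h ψ (ε :: σ)
      = homOp W f (h + sgn ε) (fun τ => ψ (ε :: τ)) σ := by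
  subst hX hY
  refine hom_induction (P := fun x y f => ∀ (h : ℤ) (ψ : List Bool → L) (σ : List Bool),
    homOp W (whisk [e] [] f rfl rfl) h ψ (ε :: σ)
      = homOp W f (h + sgn ε) (fun τ => ψ (ε :: τ)) σ) ?_ ?_ ?_ ?_ ?_ ?_ f h ψ σ
  · intro x y s h ψ σ
    rw [whisk_of, homOp_step, homOp_step, Step.op_whisker]
    simp [truncOp_apply, shiftOp_succ]
  · intro x h ψ σ
    rw [whisk_id, homOp_id, homOp_id]
    simp [truncOp_apply]
  · intro x y z f g hf hg h ψ σ
    rw [whisk_comp [e] [] rfl rfl rfl, homOp_comp, homOp_comp]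
    simp only [Pi.mul_apply, Module.End.mul_apply, hf, hg]
  · intro x y h ψ σ
    rw [whisk_zero, homOp_zero, homOp_zero]
    rfl
  · intro x y f g hf hg h ψ σ
    rw [whisk_add, homOp_add, homOp_add]
    simp [hf, hg]
  · intro x y a f hf h ψ σ
    rw [whisk_smul, homOp_smul, homOp_smul]
    simp [hf]

end Representation
end ColoredTL

namespace ColoredTL

/-! ### Quantum binomial coefficients -/

section QuantumBinomials

theorem map_rnum {R R' : Type*} [CommRing R] [CommRing R'] (f : R →+* R') (p : R) (n : ℕ) :
    f (rnum p n) = rnum (f p) n := by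
  induction n using Nat.strong_induction_on with
  | _ n ih =>
    match n, ih with
    | 0, _ => simp [rnum]
    | 1, _ => simp [rnum]
    | n + 2, ih =>
      rw [rnum, rnum, map_sub, map_mul, ih (n + 1) (by omega), ih n (by omega)]
      split_ifs <;> simp

theorem map_qnum₂ {R R' : Type*} [CommRing R] [CommRing R'] (f : R →+* R') (n : ℕ) (a b : R) :
    f (qnum₂ a b n) = qnum₂ (f a) (f b) n := by
  rw [qnum₂_eq_rnum, qnum₂_eq_rnum, map_mul, map_rnum, map_mul]
  split_ifs <;> simp

/-- At `[2]_{s,t} = [2]_{t,s} = 2` the quantum numbers are the integers, and `rnum` lacks the factor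
2 at even places. This evaluation shows that the generic numbers are non-zero and may be cancelled.
-/
theorem two_mul_rnum_four (n : ℕ) :
    2 * rnum (4 : ℤ) n = if Even n then (n : ℤ) else 2 * n := by
  induction n using Nat.strong_induction_on with
  | _ n ih =>
    match n, ih with
    | 0, _ => simp [rnum]
    | 1, _ => simp [rnum]
    | n + 2, ih =>
      have h1 := ih (n + 1) (by omega)
      have h0 := ih n (by omega)
      rw [rnum]
      by_cases h : Even n
      · simp [h, Nat.even_add_one] at *
        linarith
      · simp [h, Nat.even_add_one] at *
        linarith

theorem rnum_X_ne_zero (n : ℕ) : rnum (Polynomial.X : Polynomial ℤ) (n + 1) ≠ 0 := by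
  intro h
  have h1 := map_rnum (Polynomial.evalRingHom (4 : ℤ)) Polynomial.X (n + 1)
  rw [h] at h1
  simp only [map_zero, Polynomial.coe_evalRingHom, Polynomial.eval_X] at h1
  have h2 := two_mul_rnum_four (n + 1)
  rw [← h1] at h2
  split_ifs at h2 <;> push_cast at h2 <;> linarith

theorem qnum₂_two_two (n : ℕ) : qnum₂ (2 : ℤ) 2 n = n := by
  have h := two_mul_rnum_four n
  rw [qnum₂_eq_rnum]
  norm_num at h ⊢
  split_ifs at h ⊢ <;> linarith

/-- The product of the first `n` numbers `rnum`. -/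
def rfact {R : Type*} [CommRing R] (p : R) (n : ℕ) : R := ∏ i ∈ Finset.range n, rnum p (i + 1)

theorem rfact_succ {R : Type*} [CommRing R] (p : R) (n : ℕ) :
    rfact p (n + 1) = rfact p n * rnum p (n + 1) := Finset.prod_range_succ _ _

theorem map_rfact {R R' : Type*} [CommRing R] [CommRing R'] (f : R →+* R') (p : R) (n : ℕ) :
    f (rfact p n) = rfact (f p) n := by
  simp [rfact, map_prod, map_rnum]

theorem rfact_X_ne_zero (n : ℕ) : rfact (Polynomial.X : Polynomial ℤ) n ≠ 0 :=
  Finset.prod_ne_zero_iff.2 fun i _ => rnum_X_ne_zero i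

/-- The quotients of the products `rfact`. -/
noncomputable def rbinomPoly (p m : ℕ) : Polynomial ℤ :=
  (rfact_dvd (Polynomial.X : Polynomial ℤ) (p + m) m p (add_comm m p)).choose

theorem rbinomPoly_spec (p m : ℕ) :
    rfact (Polynomial.X : Polynomial ℤ) (p + m)
      = rfact Polynomial.X m * rfact Polynomial.X p * rbinomPoly p m :=
  (rfact_dvd (Polynomial.X : Polynomial ℤ) (p + m) m p (add_comm m p)).choose_spec

theorem rbinomPoly_zero_right (p : ℕ) : rbinomPoly p 0 = 1 := by
  have h := rbinomPoly_spec p 0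
  have h0 : rfact (Polynomial.X : Polynomial ℤ) 0 = 1 := rfl
  rw [h0, one_mul, add_zero] at h
  exact (mul_eq_left₀ (rfact_X_ne_zero p)).1 h.symm

theorem rbinomPoly_zero_left (m : ℕ) : rbinomPoly 0 m = 1 := by
  have h := rbinomPoly_spec 0 m
  have h0 : rfact (Polynomial.X : Polynomial ℤ) 0 = 1 := rfl
  rw [h0, mul_one, zero_add] at h
  exact (mul_eq_left₀ (rfact_X_ne_zero m)).1 h.symm

theorem rbinomPoly_left (p m : ℕ) :
    rfact (Polynomial.X : Polynomial ℤ) (m + 1) * rfact Polynomial.X (p + 1) * rbinomPoly p (m + 1)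
      = rfact Polynomial.X (p + m + 1) * rnum Polynomial.X (p + 1) := by
  rw [rfact_succ _ p, show p + m + 1 = p + (m + 1) from rfl, rbinomPoly_spec p (m + 1)]
  ring

theorem rbinomPoly_right (p m : ℕ) :
    rfact (Polynomial.X : Polynomial ℤ) (m + 1) * rfact Polynomial.X (p + 1) * rbinomPoly (p + 1) m
      = rfact Polynomial.X (p + m + 1) * rnum Polynomial.X (m + 1) := by
  rw [rfact_succ _ m, show p + m + 1 = (p + 1) + m by ring, rbinomPoly_spec (p + 1) m]
  ring

/-- This is the addition formula `rnum_add` after cancelling factorials in the domain `ℤ[X]`. -/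
theorem rbinomPoly_pascal (p m : ℕ) :
    rbinomPoly (p + 1) (m + 1)
      = (if Even m ∧ ¬ Even p then Polynomial.X else 1) * rnum Polynomial.X (m + 2)
          * rbinomPoly p (m + 1)
        - (if ¬ Even m ∧ Even p then Polynomial.X else 1) * rnum Polynomial.X p
          * rbinomPoly (p + 1) m := by
  have h := rnum_add (Polynomial.X : Polynomial ℤ) m p
  apply mul_left_cancel₀ (mul_ne_zero (rfact_X_ne_zero (m + 1)) (rfact_X_ne_zero (p + 1)))
  rw [← rbinomPoly_spec, show p + 1 + (m + 1) = p + m + 1 + 1 by ring, rfact_succ,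
    show p + m + 1 + 1 = m + p + 2 by ring, ← h]
  linear_combination
    -(if Even m ∧ ¬ Even p then Polynomial.X else 1) * rnum Polynomial.X (m + 2)
      * rbinomPoly_left p m
    + (if ¬ Even m ∧ Even p then Polynomial.X else 1) * rnum Polynomial.X p
      * rbinomPoly_right p m

theorem rbinomPoly_absorb (p m : ℕ) :
    rnum Polynomial.X (p + 1) * rbinomPoly (p + 1) m
      = rnum Polynomial.X (m + 1) * rbinomPoly p (m + 1) := by
  apply mul_left_cancel₀ (mul_ne_zero (rfact_X_ne_zero (m + 1)) (rfact_X_ne_zero (p + 1)))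
  linear_combination rnum Polynomial.X (p + 1) * rbinomPoly_right p m
    - rnum Polynomial.X (m + 1) * rbinomPoly_left p m

theorem rnum_mvPolynomial_ne_zero (n : ℕ) :
    rnum (MvPolynomial.X 0 * MvPolynomial.X 1 : MvPolynomial (Fin 2) ℤ) (n + 1) ≠ 0 := by
  intro h
  have h1 := map_rnum (MvPolynomial.eval (fun _ => (2 : ℤ)))
    (MvPolynomial.X 0 * MvPolynomial.X 1 : MvPolynomial (Fin 2) ℤ) (n + 1)
  rw [h] at h1
  norm_num at h1
  have h2 := two_mul_rnum_four (n + 1)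
  rw [← h1] at h2
  split_ifs at h2 <;> push_cast at h2 <;> linarith

/-- Apart from powers of `[2]_{s,t}`, the factorials depend only on the product of the two
parameters. Binomial identities thus reduce to one variable. -/
theorem qbinomPoly₂_eq (p m : ℕ) :
    qbinomPoly₂ (p + m) m = MvPolynomial.X 0 ^ ((p + m) / 2 - m / 2 - p / 2)
      * Polynomial.aeval (MvPolynomial.X 0 * MvPolynomial.X 1 : MvPolynomial (Fin 2) ℤ)
          (rbinomPoly p m) := by
  have h := qbinomPoly₂_spec (show m ≤ p + m by omega)
  rw [Nat.add_sub_cancel] at h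
  have hX : (MvPolynomial.X 0 : MvPolynomial (Fin 2) ℤ) ≠ 0 := MvPolynomial.X_ne_zero 0
  have hf : ∀ n, qfact₂ (MvPolynomial.X 0 : MvPolynomial (Fin 2) ℤ) (MvPolynomial.X 1) n ≠ 0 := by
    intro n
    rw [qfact₂_eq]
    exact mul_ne_zero (pow_ne_zero _ hX)
      (Finset.prod_ne_zero_iff.2 fun i _ => rnum_mvPolynomial_ne_zero i)
  apply mul_left_cancel₀ (mul_ne_zero (hf m) (hf p))
  rw [← h]
  have hs := congrArg (Polynomial.aeval
    (MvPolynomial.X 0 * MvPolynomial.X 1 : MvPolynomial (Fin 2) ℤ)).toRingHom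
    (rbinomPoly_spec p m)
  simp only [map_mul, map_rfact] at hs
  simp only [AlgHom.toRingHom_eq_coe, RingHom.coe_coe, Polynomial.aeval_X] at hs
  simp only [qfact₂_eq]
  simp only [rfact] at hs
  rw [hs]
  have e : (p + m) / 2 = m / 2 + p / 2 + ((p + m) / 2 - m / 2 - p / 2) := by omega
  nth_rw 1 [e]
  rw [pow_add, pow_add]
  ring

theorem qbinom₂_eq {R : Type*} [CommRing R] (a b : R) (p m : ℕ) :
    qbinom₂ a b (p + m) m = a ^ ((p + m) / 2 - m / 2 - p / 2)
      * Polynomial.aeval (a * b) (rbinomPoly p m) := by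
  rw [qbinom₂, qbinomPoly₂_eq, map_mul, map_pow, ← Polynomial.aeval_algHom_apply]
  simp

theorem map_qbinom₂ {R R' : Type*} [CommRing R] [CommRing R'] (f : R →+* R') (a b : R)
    (n m : ℕ) : f (qbinom₂ a b n m) = qbinom₂ (f a) (f b) n m := by
  rw [qbinom₂, qbinom₂, MvPolynomial.aeval_def, MvPolynomial.aeval_def, MvPolynomial.hom_eval₂]
  congr 1
  · exact RingHom.ext_int _ _
  · funext i
    fin_cases i <;> rfl

theorem qbinom₂_zero_right {R : Type*} [CommRing R] (a b : R) (n : ℕ) : qbinom₂ a b n 0 = 1 := by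
  have := qbinom₂_eq a b n 0
  simpa [rbinomPoly_zero_right] using this

theorem qbinom₂_self {R : Type*} [CommRing R] (a b : R) (n : ℕ) : qbinom₂ a b n n = 1 := by
  have := qbinom₂_eq a b 0 n
  simpa [rbinomPoly_zero_left] using this

/-- For an odd upper entry the two-coloured binomials are symmetric in the colours. -/
theorem qbinom₂_swap {R : Type*} [CommRing R] (a b : R) (p m : ℕ) (h : ¬ Even (p + m)) :
    qbinom₂ a b (p + m) m = qbinom₂ b a (p + m) m := by
  rw [qbinom₂_eq, qbinom₂_eq, mul_comm a b]
  have e : (p + m) / 2 - m / 2 - p / 2 = 0 := by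
    rw [Nat.not_even_iff_odd] at h
    obtain ⟨r, hr⟩ := h
    omega
  rw [e, pow_zero, pow_zero]

/-- This is the exponent of `[2]_{s,t}` in the binomial: rounding loses a unit only if both parts
are odd. -/
theorem half_sub_half (p m : ℕ) :
    (p + m) / 2 - m / 2 - p / 2 = if ¬ Even p ∧ ¬ Even m then 1 else 0 := by
  simp only [Nat.not_even_iff_odd]
  split_ifs with h
  · obtain ⟨⟨a, rfl⟩, b, rfl⟩ := h
    omega
  · rw [not_and_or, Nat.not_odd_iff_even, Nat.not_odd_iff_even] at h
    rcases h with ⟨a, rfl⟩ | ⟨b, rfl⟩ <;> omega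

theorem qbinom₂_pascal {R : Type*} [CommRing R] (a b : R) (p m : ℕ) :
    qbinom₂ a b (p + 1 + (m + 1)) (m + 1)
      = qnum₂ a b (m + 2) * qbinom₂ b a (p + (m + 1)) (m + 1)
        - qnum₂ a b p * qbinom₂ b a (p + 1 + m) m := by
  have h := congrArg (Polynomial.aeval (a * b)) (rbinomPoly_pascal p m)
  rw [map_sub, map_mul, map_mul, map_mul, map_mul] at h
  have hr : ∀ n, Polynomial.aeval (a * b) (rnum (Polynomial.X : Polynomial ℤ) n)
      = rnum (a * b) n := fun n => by
    have := map_rnum (Polynomial.aeval (R := ℤ) (a * b)).toRingHom Polynomial.X n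
    simpa using this
  have hX : ∀ P : Prop, ∀ [Decidable P],
      Polynomial.aeval (a * b) (if P then (Polynomial.X : Polynomial ℤ) else 1)
        = if P then a * b else 1 := by
    intro P _
    split_ifs <;> simp
  rw [hr, hr, hX, hX] at h
  simp only [qbinom₂_eq, half_sub_half, qnum₂_eq_rnum, h, mul_comm b a]
  by_cases hp : Even p <;> by_cases hm : Even m <;>
    simp [hp, hm, Nat.even_add_one] <;> ring

theorem qbinom₂_absorb {R : Type*} [CommRing R] (a b : R) (p m : ℕ) :
    qnum₂ b a (p + 1) * qbinom₂ b a (p + 1 + m) m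
      = qnum₂ b a (m + 1) * qbinom₂ b a (p + (m + 1)) (m + 1) := by
  have h := congrArg (Polynomial.aeval (b * a)) (rbinomPoly_absorb p m)
  rw [map_mul, map_mul] at h
  have hr : ∀ n, Polynomial.aeval (b * a) (rnum (Polynomial.X : Polynomial ℤ) n)
      = rnum (b * a) n := fun n => by
    have := map_rnum (Polynomial.aeval (R := ℤ) (b * a)).toRingHom Polynomial.X n
    simpa using this
  rw [hr, hr] at h
  simp only [qbinom₂_eq, half_sub_half, qnum₂_eq_rnum]
  by_cases hp : Even p <;> by_cases hm : Even m <;>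
    simp [hp, hm, Nat.even_add_one] <;> first | linear_combination h | linear_combination b * h

/-- Generic factorials are non-zero, so the binomial in `ℤ[X]` is determined by its defining
equation, which the two-coloured one satisfies when both variables become `X`. -/
theorem qbinom_eq_qbinom₂ {R : Type*} [CommRing R] (d : R) {n m : ℕ} (h : m ≤ n) :
    qbinom d n m = qbinom₂ d d n m := by
  have hq : ∀ i, qfact (Polynomial.X : Polynomial ℤ) i ≠ 0 := by
    intro i
    refine Finset.prod_ne_zero_iff.2 fun j _ h0 => ?_
    have h1 := map_qnum₂ (Polynomial.evalRingHom (2 : ℤ)) (j + 1) Polynomial.X Polynomial.X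
    rw [qnum₂_self, h0] at h1
    simp only [map_zero, Polynomial.coe_evalRingHom, Polynomial.eval_X, qnum₂_two_two] at h1
    push_cast at h1
    omega
  have hm : ∀ i, MvPolynomial.aeval ![(Polynomial.X : Polynomial ℤ), Polynomial.X]
      (qfact₂ (MvPolynomial.X 0 : MvPolynomial (Fin 2) ℤ) (MvPolynomial.X 1) i)
      = qfact Polynomial.X i := by
    intro i
    rw [qfact₂, qfact, map_prod]
    refine Finset.prod_congr rfl fun j _ => ?_
    have := map_qnum₂ (MvPolynomial.aeval (R := ℤ)
      ![(Polynomial.X : Polynomial ℤ), Polynomial.X]).toRingHom (j + 1)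
      (MvPolynomial.X 0) (MvPolynomial.X 1)
    simpa [qnum₂_self] using this
  have key : qbinomPoly n m = MvPolynomial.aeval ![(Polynomial.X : Polynomial ℤ), Polynomial.X]
      (qbinomPoly₂ n m) := by
    apply mul_left_cancel₀ (mul_ne_zero (hq m) (hq (n - m)))
    rw [← qbinomPoly_spec h, ← hm n, qbinomPoly₂_spec h, map_mul, map_mul, hm, hm]
  rw [qbinom, key, qbinom₂]
  have e : (Polynomial.aeval d).comp (MvPolynomial.aeval (R := ℤ)
      ![(Polynomial.X : Polynomial ℤ), Polynomial.X]) = MvPolynomial.aeval ![d, d] := by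
    apply MvPolynomial.algHom_ext
    intro i
    fin_cases i <;> simp
  exact DFunLike.congr_fun e _

/-- The recursion of the two-coloured quantum numbers on the other side. -/
theorem qnum₂_succ_succ {R : Type*} [CommRing R] (a b : R) (n : ℕ) :
    qnum₂ a b (n + 2) = (if Even n then a else b) * qnum₂ a b (n + 1) - qnum₂ a b n := by
  rw [qnum₂_eq_rnum, qnum₂_eq_rnum, qnum₂_eq_rnum, rnum]
  by_cases h : Even n <;> simp [h, Nat.even_add_one] <;> ring

end QuantumBinomials

/-! ### Weighted path sums -/

section PathSums

variable {L : Type*} [Field L]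

/-- The sum over all paths of length `n`. -/
def pathSum : ℕ → (List Bool → L) → L
  | 0, F => F []
  | n + 1, F => pathSum n (fun σ => F (true :: σ)) + pathSum n (fun σ => F (false :: σ))

theorem pathSum_congr {n : ℕ} {F F' : List Bool → L} (h : ∀ σ, σ.length = n → F σ = F' σ) :
    pathSum n F = pathSum n F' := by
  induction n generalizing F F' with
  | zero => exact h [] rfl
  | succ n ih =>
    simp only [pathSum]
    rw [ih fun σ hσ => h (true :: σ) (by simp [hσ]), ih fun σ hσ => h (false :: σ) (by simp [hσ])]

theorem pathSum_add (n : ℕ) (F F' : List Bool → L) :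
    pathSum n (fun σ => F σ + F' σ) = pathSum n F + pathSum n F' := by
  induction n generalizing F F' with
  | zero => rfl
  | succ n ih =>
    simp only [pathSum]
    rw [ih, ih]
    ring

theorem pathSum_mul (n : ℕ) (a : L) (F : List Bool → L) :
    pathSum n (fun σ => a * F σ) = a * pathSum n F := by
  induction n generalizing F with
  | zero => rfl
  | succ n ih =>
    simp only [pathSum]
    rw [ih, ih]
    ring

theorem pathSum_zero (n : ℕ) : pathSum n (fun _ => (0 : L)) = 0 := by
  induction n with
  | zero => rfl
  | succ n ih => simp only [pathSum, ih, add_zero]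

theorem pathSum_append (n m : ℕ) (F : List Bool → L) :
    pathSum (n + m) F = pathSum n fun σ => pathSum m fun τ => F (σ ++ τ) := by
  induction n generalizing F with
  | zero => simp [pathSum]
  | succ n ih =>
    rw [Nat.succ_add, pathSum, ih, ih]
    rfl

/-- The sum of a function supported at one path. -/
theorem pathSum_single {n : ℕ} (F : List Bool → L) (τ : List Bool) (hτ : τ.length = n)
    (h : ∀ σ, σ.length = n → σ ≠ τ → F σ = 0) : pathSum n F = F τ := by
  induction n generalizing F τ with
  | zero => rw [List.length_eq_zero_iff.1 hτ]; rfl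
  | succ n ih =>
    obtain ⟨ε, τ, rfl⟩ := List.exists_cons_of_length_eq_add_one hτ
    simp only [List.length_cons, Nat.add_right_cancel_iff] at hτ
    have hz : ∀ ε', ε' ≠ ε → pathSum n (fun σ => F (ε' :: σ)) = 0 := by
      intro ε' hε
      rw [pathSum_congr (F' := fun _ => 0) fun σ hσ => h _ (by simp [hσ]) (by simp [hε]),
        pathSum_zero]
    have hs := ih (fun σ => F (ε :: σ)) τ hτ fun σ hσ hne => h _ (by simp [hσ]) (by simp [hne])
    rw [pathSum]
    cases ε
    · rw [hz true (by simp), zero_add]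
      exact hs
    · rw [hz false (by simp), add_zero]
      exact hs

/-- The weight of a path with `p` steps up and `m` steps down (and `0` for other paths): the
product of the weights `g` of the boxes below the path that goes up `p` times first. -/
def boxWeight (g : ℤ → L) : ℕ → ℕ → ℤ → List Bool → L
  | p, m, _, [] => if p = 0 ∧ m = 0 then 1 else 0
  | 0, _, _, true :: _ => 0
  | p + 1, m, h, true :: σ => boxWeight g p m (h + 1) σ
  | _, 0, _, false :: _ => 0
  | p, m + 1, h, false :: σ =>
    (∏ j ∈ Finset.range p, g (h + j)) * boxWeight g p m (h - 1) σ

section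
variable (g : ℤ → L) (p m : ℕ) (h : ℤ) (σ : List Bool)
@[simp] theorem boxWeight_zero_true : boxWeight g 0 m h (true :: σ) = 0 := by
  cases m <;> rfl
@[simp] theorem boxWeight_succ_true :
    boxWeight g (p + 1) m h (true :: σ) = boxWeight g p m (h + 1) σ := by
  cases m <;> rfl
@[simp] theorem boxWeight_zero_false : boxWeight g p 0 h (false :: σ) = 0 := by
  cases p <;> rfl
@[simp] theorem boxWeight_succ_false : boxWeight g p (m + 1) h (false :: σ)
    = (∏ j ∈ Finset.range p, g (h + j)) * boxWeight g p m (h - 1) σ := by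
  cases p <;> rfl
end

theorem boxWeight_mul (g g' : ℤ → L) (σ : List Bool) : ∀ (p m : ℕ) (h : ℤ),
    boxWeight (fun h => g h * g' h) p m h σ = boxWeight g p m h σ * boxWeight g' p m h σ := by
  induction σ with
  | nil =>
    intro p m h
    by_cases hpm : p = 0 ∧ m = 0 <;> simp [boxWeight, hpm]
  | cons ε σ ih =>
    intro p m h
    cases ε
    · cases m with
      | zero => simp
      | succ m =>
        simp only [boxWeight_succ_false, ih, Finset.prod_mul_distrib]
        ring
    · cases p with
      | zero => simp
      | succ p => simp only [boxWeight_succ_true, ih]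

/-- Replacing a peak at height `h` by a valley multiplies the weight by `g h`. -/
theorem boxWeight_swap (g : ℤ → L) (σ μ : List Bool) : ∀ (p m : ℕ) (h : ℤ),
    boxWeight g p m h (σ ++ false :: true :: μ)
      = g (h + height σ) * boxWeight g p m h (σ ++ true :: false :: μ) := by
  induction σ with
  | nil =>
    intro p m h
    rcases p with _ | p <;> rcases m with _ | m <;> simp
    rw [Finset.prod_range_succ']
    have e : ∀ j : ℕ, h + ((j + 1 : ℕ) : ℤ) = h + 1 + j := by intro j; push_cast; ring
    simp only [e]
    simp
    ring
  | cons ε σ ih =>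
    intro p m h
    cases ε
    · cases m with
      | zero => simp
      | succ m =>
        simp only [List.cons_append, boxWeight_succ_false, ih, height_cons, sgn]
        rw [← add_assoc, ← sub_eq_add_neg]
        ring
    · cases p with
      | zero => simp
      | succ p =>
        simp only [List.cons_append, boxWeight_succ_true, ih, height_cons, sgn]
        rw [← add_assoc]

/-- The number of steps up and down of a path. -/
theorem boxWeight_ne_zero (g : ℤ → L) (hg : ∀ h, g h ≠ 0) (σ : List Bool) : ∀ (h : ℤ),
    boxWeight g (σ.count true) (σ.count false) h σ ≠ 0 := by
  induction σ with
  | nil => simp [boxWeight]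
  | cons ε σ ih =>
    intro h
    cases ε
    · simp [ih, Finset.prod_ne_zero_iff, hg]
    · simp [ih]

theorem boxWeight_eq_zero (g : ℤ → L) (σ : List Bool) : ∀ (p m : ℕ) (h : ℤ),
    ¬ (σ.count true = p ∧ σ.count false = m) → boxWeight g p m h σ = 0 := by
  induction σ with
  | nil =>
    intro p m h hne
    rw [boxWeight, if_neg]
    simpa [eq_comm] using hne
  | cons ε σ ih =>
    intro p m h hne
    cases ε
    · cases m with
      | zero => simp
      | succ m =>
        rw [boxWeight_succ_false, ih, mul_zero]
        simpa using hne
    · cases p with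
      | zero => simp
      | succ p =>
        rw [boxWeight_succ_true, ih]
        simpa using hne

/-- A function of paths that is multiplied by `g h` when a peak at height `h` is replaced by a
valley is given by the weights `boxWeight`. -/
theorem eq_boxWeight_mul (g : ℤ → L) (σ : List Bool) : ∀ (p m : ℕ) (h : ℤ) (F : List Bool → L),
    (∀ σ' μ, σ'.length + μ.length + 2 = σ.length →
      F (σ' ++ false :: true :: μ) = g (h + height σ') * F (σ' ++ true :: false :: μ)) →
    σ.count true = p → σ.count false = m →
    F σ = boxWeight g p m h σ * F (List.replicate p true ++ List.replicate m false) := by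
  induction σ with
  | nil =>
    rintro p m h F hF rfl rfl
    simp [boxWeight]
  | cons ε σ ih =>
    rintro p m h F hF rfl rfl
    have hF' : ∀ σ' μ, σ'.length + μ.length + 2 = σ.length →
        F (ε :: (σ' ++ false :: true :: μ))
          = g (h + sgn ε + height σ') * F (ε :: (σ' ++ true :: false :: μ)) := by
      intro σ' μ hl
      have := hF (ε :: σ') μ (by simp; omega)
      rwa [height_cons, ← add_assoc] at this
    have key := ih _ _ (h + sgn ε) (fun τ => F (ε :: τ)) hF' rfl rfl
    rw [key]
    cases ε
    -- An initial step down is moved past `q` steps up; it crosses the boxes at heights `h, …, h + q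
    -- - 1`.
    · have move : ∀ (q : ℕ) (h : ℤ) (F : List Bool → L),
          (∀ σ' μ, σ'.length + μ.length + 2 = q + σ.count false + 1 →
            F (σ' ++ false :: true :: μ) = g (h + height σ') * F (σ' ++ true :: false :: μ)) →
          F (false :: (List.replicate q true ++ List.replicate (σ.count false) false))
            = (∏ j ∈ Finset.range q, g (h + j)) *
              F (List.replicate q true ++ List.replicate (σ.count false + 1) false) := by
        intro q
        induction q with
        | zero => intro h F _; simp [List.replicate_succ]
        | succ q ihq =>
          intro h F hF
          have h1 := hF [] (List.replicate q true ++ List.replicate (σ.count false) false)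
            (by simp; omega)
          have h2 := ihq (h + 1) (fun τ => F (true :: τ)) (by
            intro σ' μ hl
            have := hF (true :: σ') μ (by simp; omega)
            rwa [height_cons, ← add_assoc] at this)
          simp only [List.replicate_succ, List.cons_append, List.nil_append, height_nil,
            add_zero] at h1 h2 ⊢
          rw [h1, h2, Finset.prod_range_succ']
          have e : ∀ j : ℕ, h + ((j + 1 : ℕ) : ℤ) = h + 1 + j := by intro j; push_cast; ring
          simp only [e]
          simp
          ring
      have hm := move (σ.count true) h F (by
        intro σ' μ hl
        refine hF σ' μ ?_
        have := List.count_true_add_count_false σ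
        simp
        omega)
      rw [hm]
      simp [sgn, sub_eq_add_neg]
      ring
    · simp [sgn, List.replicate_succ]

/-- A solution of the recursion of the quantum numbers. -/
structure QuantumSequence (δ N : ℤ → L) : Prop where
  period : ∀ h, δ (h + 2) = δ h
  ne_zero : ∀ h, N h ≠ 0
  step : ∀ h, N (h + 1) + N (h - 1) = δ h * N h

variable {δ N : ℤ → L} (H : QuantumSequence δ N)
include H

theorem QuantumSequence.period_nat (h : ℤ) (m : ℕ) :
    δ (h + m) = if Even m then δ h else δ (h + 1) := by
  induction m using Nat.strong_induction_on with
  | _ m ih =>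
    match m, ih with
    | 0, _ => simp
    | 1, _ => simp
    | m + 2, ih =>
      have e : h + ((m + 2 : ℕ) : ℤ) = h + m + 2 := by push_cast; ring
      rw [e, H.period, ih m (by omega)]
      simp [Nat.even_add]

theorem QuantumSequence.period_sub_one (h : ℤ) : δ (h - 1) = δ (h + 1) := by
  rw [← H.period (h - 1)]
  congr 1
  ring

theorem QuantumSequence.period_sub_nat (h : ℤ) (m : ℕ) :
    δ (h - m) = if Even m then δ h else δ (h + 1) := by
  have h1 := H.period_nat (h - m) m
  have h2 := H.period_nat (h - m) (m + 1)
  rw [sub_add_cancel] at h1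
  rw [show h - m + ((m + 1 : ℕ) : ℤ) = h + 1 by push_cast; ring] at h2
  by_cases hm : Even m
  · rw [if_pos hm] at h1 ⊢
    exact h1.symm
  · rw [if_pos (by simpa [Nat.even_add_one] using hm)] at h2
    rw [if_neg hm]
    exact h2.symm

/-- Two consecutive values determine a solution of the recursion, with quantum numbers as
coefficients. -/
theorem QuantumSequence.sub_nat (h : ℤ) (m : ℕ) :
    N (h - m) = qnum₂ (δ h) (δ (h + 1)) (m + 1) * N h - qnum₂ (δ (h + 1)) (δ h) m * N (h + 1) := by
  induction m using Nat.strong_induction_on with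
  | _ m ih =>
    match m, ih with
    | 0, _ => simp [qnum₂]
    | 1, _ =>
      have := H.step h
      simp [qnum₂]
      linear_combination this
    | m + 2, ih =>
      have h0 := ih m (by omega)
      have h1 := ih (m + 1) (by omega)
      have hs := H.step (h - (m + 1 : ℕ))
      rw [H.period_sub_nat h (m + 1)] at hs
      have e1 : h - ((m + 1 : ℕ) : ℤ) + 1 = h - m := by push_cast; ring
      have e2 : h - ((m + 1 : ℕ) : ℤ) - 1 = h - (m + 2 : ℕ) := by push_cast; ring
      rw [e1, e2] at hs
      rw [qnum₂_succ_succ (δ h) (δ (h + 1)) (m + 1), qnum₂_succ_succ (δ (h + 1)) (δ h) m]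
      by_cases hm : Even m
      · simp only [Nat.even_add_one, hm, not_true, if_false, if_true] at hs ⊢
        linear_combination hs - h0 + δ (h + 1) * h1
      · simp only [Nat.even_add_one, hm, not_false_iff, if_false, if_true] at hs ⊢
        linear_combination hs - h0 + δ h * h1

theorem QuantumSequence.add_nat (h : ℤ) (p : ℕ) :
    N (h + p + 1) = qnum₂ (δ (h + 1)) (δ h) (p + 1) * N (h + 1)
      - qnum₂ (δ h) (δ (h + 1)) p * N h := by
  induction p using Nat.strong_induction_on with
  | _ p ih =>
    match p, ih with
    | 0, _ => simp [qnum₂]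
    | 1, _ =>
      have := H.step (h + 1)
      rw [add_sub_cancel_right] at this
      simp [qnum₂]
      linear_combination this
    | p + 2, ih =>
      have h0 := ih p (by omega)
      have h1 := ih (p + 1) (by omega)
      have hs := H.step (h + (p + 2 : ℕ))
      rw [H.period_nat h (p + 2)] at hs
      have e1 : h + ((p + 2 : ℕ) : ℤ) - 1 = h + p + 1 := by push_cast; ring
      have e2 : h + ((p + 2 : ℕ) : ℤ) = h + (p + 1 : ℕ) + 1 := by push_cast; ring
      rw [e1] at hs
      rw [qnum₂_succ_succ (δ (h + 1)) (δ h) (p + 1), qnum₂_succ_succ (δ h) (δ (h + 1)) p]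
      rw [e2] at hs ⊢
      by_cases hm : Even p
      · simp only [Nat.even_add_one, hm, not_true, not_false_iff, if_false, if_true] at hs ⊢
        linear_combination hs - h0 + δ h * h1
      · simp only [Nat.even_add_one, hm, not_false_iff, not_true, if_false, if_true] at hs ⊢
        linear_combination hs - h0 + δ (h + 1) * h1

/-- Expand the outer values in terms of `N h` and `N (h + 1)`: the coefficients of `N h` agree by
`qbinom₂_pascal`, and those of `N (h + 1)` cancel by `qbinom₂_absorb`. -/
theorem QuantumSequence.pascal (h : ℤ) (p m : ℕ) :
    qbinom₂ (δ h) (δ (h + 1)) (p + 1 + (m + 1)) (m + 1) * N h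
      = qbinom₂ (δ (h + 1)) (δ h) (p + (m + 1)) (m + 1) * N (h - 1 - m)
        + qbinom₂ (δ (h + 1)) (δ h) (p + 1 + m) m * N (h + p + 1) := by
  have h1 := H.sub_nat h (m + 1)
  rw [show h - ((m + 1 : ℕ) : ℤ) = h - 1 - m by push_cast; ring] at h1
  rw [h1, H.add_nat h p, qbinom₂_pascal]
  linear_combination -N (h + 1) * qbinom₂_absorb (δ h) (δ (h + 1)) p m

theorem QuantumSequence.prod_ratio (h : ℤ) (p : ℕ) :
    (∏ j ∈ Finset.range p, N (h + j + 1) * (N (h + j - 1))⁻¹) * (N h * N (h - 1))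
      = N (h + p) * N (h + p - 1) := by
  induction p with
  | zero => simp
  | succ p ih =>
    rw [Finset.prod_range_succ, mul_right_comm, ih]
    have := H.ne_zero (h + p - 1)
    have e : h + ((p + 1 : ℕ) : ℤ) = h + p + 1 := by push_cast; ring
    rw [e, add_sub_cancel_right]
    field_simp

/-- The sum of the box weights of all paths with `p` steps up and `m` steps down is a quantum
binomial coefficient up to invertible factors. -/
theorem QuantumSequence.pathSum_boxWeight (n : ℕ) : ∀ (p m : ℕ) (h : ℤ), p + m = n →
    pathSum n (boxWeight (fun h => N (h + 1) * (N (h - 1))⁻¹) p m h)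
        * ∏ i ∈ Finset.range m, N (h - 1 - i)
      = qbinom₂ (δ h) (δ (h + 1)) (p + m) m * ∏ i ∈ Finset.range m, N (h + p - 1 - i) := by
  induction n with
  | zero =>
    rintro p m h hn
    obtain ⟨rfl, rfl⟩ : p = 0 ∧ m = 0 := by omega
    simp [pathSum, boxWeight, qbinom₂_self]
  | succ n ih =>
    rintro p m h hn
    rcases p with _ | p <;> rcases m with _ | m
    · omega
    · obtain rfl : m = n := by omega
      have := ih 0 m (h - 1) (by omega)
      simp only [pathSum, boxWeight_zero_true, boxWeight_succ_false, pathSum_zero,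
        Finset.range_zero, Finset.prod_empty, one_mul, zero_add, qbinom₂_self, Nat.cast_zero,
        add_zero] at this ⊢
      have hne : ∏ i ∈ Finset.range m, N (h - 1 - 1 - i) ≠ 0 :=
        Finset.prod_ne_zero_iff.2 fun i _ => H.ne_zero _
      rw [mul_eq_right₀ hne] at this
      rw [this, one_mul]
    · obtain rfl : p = n := by omega
      have := ih p 0 (h + 1) (by omega)
      simpa [pathSum, pathSum_zero, qbinom₂_zero_right] using this
    -- The sum is split by the first step of the path; a first step down carries the weight `κ` of
    -- the `p + 1` boxes it crosses, which telescopes by `prod_ratio`.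
    · have i1 := ih p (m + 1) (h + 1) (by omega)
      have i2 := ih (p + 1) m (h - 1) (by omega)
      have e2 : h + 1 + 1 = h + 2 := by ring
      rw [e2, H.period] at i1
      rw [H.period_sub_one, sub_add_cancel] at i2
      have hP := H.pascal h p m
      have hR := H.prod_ratio h (p + 1)
      generalize hg : (fun h => N (h + 1) * (N (h - 1))⁻¹) = g at i1 i2 ⊢
      have hκ : ∏ j ∈ Finset.range (p + 1), N (h + j + 1) * (N (h + j - 1))⁻¹
          = ∏ j ∈ Finset.range (p + 1), g (h + j) := by rw [← hg]
      rw [hκ] at hR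
      simp only [pathSum, boxWeight_succ_true, boxWeight_succ_false, pathSum_mul]
      generalize pathSum n (boxWeight g p (m + 1) (h + 1)) = a at i1 ⊢
      generalize pathSum n (boxWeight g (p + 1) m (h - 1)) = c at i2 ⊢
      generalize (∏ j ∈ Finset.range (p + 1), g (h + j)) = κ at hR ⊢
      have f1 : ∏ i ∈ Finset.range (m + 1), N (h + 1 - 1 - i)
          = (∏ i ∈ Finset.range m, N (h - 1 - i)) * N h := by
        rw [Finset.prod_range_succ']
        congr 1
        · refine Finset.prod_congr rfl fun i _ => ?_
          congr 1; push_cast; ring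
        · simp
      have f2 : ∏ i ∈ Finset.range (m + 1), N (h - 1 - i)
          = (∏ i ∈ Finset.range m, N (h - 1 - 1 - i)) * N (h - 1) := by
        rw [Finset.prod_range_succ']
        congr 1
        · refine Finset.prod_congr rfl fun i _ => ?_
          congr 1; push_cast; ring
        · simp
      have f3 : ∏ i ∈ Finset.range (m + 1), N (h + (p + 1 : ℕ) - 1 - i)
          = (∏ i ∈ Finset.range m, N (h + p - 1 - i)) * N (h + p) := by
        rw [Finset.prod_range_succ']
        congr 1
        · refine Finset.prod_congr rfl fun i _ => ?_
          congr 1; push_cast; ring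
        · congr 1; push_cast; ring
      have f4 : ∏ i ∈ Finset.range (m + 1), N (h + 1 + p - 1 - i)
          = ∏ i ∈ Finset.range (m + 1), N (h + (p + 1 : ℕ) - 1 - i) := by
        refine Finset.prod_congr rfl fun i _ => ?_
        congr 1; push_cast; ring
      have f5 : ∏ i ∈ Finset.range m, N (h - 1 + (p + 1 : ℕ) - 1 - i)
          = ∏ i ∈ Finset.range m, N (h + p - 1 - i) := by
        refine Finset.prod_congr rfl fun i _ => ?_
        congr 1; push_cast; ring
      have f6 := Finset.prod_range_succ (fun i : ℕ => N (h - 1 - i)) m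
      rw [f1, f4, f3] at i1
      rw [f5] at i2
      rw [f3]
      rw [show h + ((p + 1 : ℕ) : ℤ) = h + p + 1 by push_cast; ring, add_sub_cancel_right] at hR
      apply mul_right_cancel₀ (H.ne_zero h)
      rw [add_mul, add_mul]
      have t1 : a * (∏ i ∈ Finset.range (m + 1), N (h - 1 - i)) * N h
          = qbinom₂ (δ (h + 1)) (δ h) (p + (m + 1)) (m + 1)
            * ((∏ i ∈ Finset.range m, N (h + p - 1 - i)) * N (h + p)) * N (h - 1 - m) := by
        rw [f6]
        linear_combination N (h - 1 - m) * i1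
      have t2 : κ * c * (∏ i ∈ Finset.range (m + 1), N (h - 1 - i)) * N h
          = qbinom₂ (δ (h + 1)) (δ h) (p + 1 + m) m
            * ((∏ i ∈ Finset.range m, N (h + p - 1 - i)) * N (h + p)) * N (h + p + 1) := by
        rw [f2]
        linear_combination κ * N h * N (h - 1) * i2
          + qbinom₂ (δ (h + 1)) (δ h) (p + 1 + m) m
            * (∏ i ∈ Finset.range m, N (h + p - 1 - i)) * hR
      rw [t1, t2]
      linear_combination
        -((∏ i ∈ Finset.range m, N (h + p - 1 - i)) * N (h + p)) * hP

end PathSums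
end ColoredTL

namespace ColoredTL

open CategoryTheory

/-! ### Construction of path representations -/

section Sequences

theorem exists_recursive_sequence {D : Type*} [CommRing D] (δ : ℤ → D) (x₀ x₁ : D) :
    ∃ N : ℤ → D, N 0 = x₀ ∧ N 1 = x₁ ∧ ∀ h, N (h + 1) + N (h - 1) = δ h * N h := by
  have aux : ∀ (δ : ℕ → D) (x₀ x₁ : D), ∃ P : ℕ → D, P 0 = x₀ ∧ P 1 = x₁ ∧
      ∀ n, P (n + 2) = δ (n + 1) * P (n + 1) - P n := by
    intro δ x₀ x₁
    let Q : ℕ → D × D := Nat.rec (x₀, x₁) fun n q => (q.2, δ (n + 1) * q.2 - q.1)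
    exact ⟨fun n => (Q n).1, rfl, rfl, fun n => rfl⟩
  obtain ⟨P, hP0, hP1, hP⟩ := aux (fun n => δ n) x₀ x₁
  obtain ⟨Q, hQ0, hQ1, hQ⟩ := aux (fun n => δ (-n)) x₀ (δ 0 * x₀ - x₁)
  let N : ℤ → D := fun h => if 0 ≤ h then P h.toNat else Q (-h).toNat
  have hNP : ∀ n : ℕ, N n = P n := fun n => by simp [N]
  have hNQ : ∀ n : ℕ, N (-n) = Q n := by
    intro n
    rcases n with _ | n
    · simp [N, hP0, hQ0]
    · simp only [N]
      rw [if_neg (by push_cast; omega)]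
      simp
  refine ⟨N, ?_, ?_, ?_⟩
  · simpa [hP0] using hNP 0
  · simpa [hP1] using hNP 1
  · intro h
    obtain ⟨n, rfl | rfl⟩ := h.eq_nat_or_neg
    · rcases n with _ | n
      · have h1 := hNP 1
        have h0 := hNP 0
        have h2 := hNQ 1
        simp only [Nat.cast_zero, Nat.cast_one, zero_add, zero_sub] at *
        rw [h1, h0, h2, hP1, hP0, hQ1]
        ring
      · have e1 : ((n + 1 : ℕ) : ℤ) + 1 = ((n + 2 : ℕ) : ℤ) := by push_cast; ring
        have e2 : ((n + 1 : ℕ) : ℤ) - 1 = (n : ℤ) := by push_cast; ring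
        rw [e1, e2, hNP, hNP, hNP, hP]
        push_cast
        ring
    · rcases n with _ | n
      · have h1 := hNP 1
        have h0 := hNP 0
        have h2 := hNQ 1
        simp only [Nat.cast_zero, Nat.cast_one, zero_add, zero_sub, neg_zero] at *
        rw [h1, h0, h2, hP1, hP0, hQ1]
        ring
      · have e1 : -((n + 1 : ℕ) : ℤ) + 1 = -(n : ℤ) := by push_cast; ring
        have e2 : -((n + 1 : ℕ) : ℤ) - 1 = -((n + 2 : ℕ) : ℤ) := by push_cast; ring
        rw [e1, e2, hNQ, hNQ, hNQ, hQ]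
        push_cast
        ring

open Polynomial in
/-- There are solutions of the recursion among the linear polynomials with coprime
coefficients. -/
theorem exists_linear_sequence {D : Type*} [CommRing D] (δ : ℤ → D) :
    ∃ U V : ℤ → D, (∀ h, IsCoprime (U h) (V h)) ∧
      ∀ h, (C (U (h + 1)) + C (V (h + 1)) * X) + (C (U (h - 1)) + C (V (h - 1)) * X)
        = C (δ h) * (C (U h) + C (V h) * X) := by
  obtain ⟨U, hU0, hU1, hU⟩ := exists_recursive_sequence δ 1 0
  obtain ⟨V, hV0, hV1, hV⟩ := exists_recursive_sequence δ 0 1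
  -- The determinant of two solutions is constant. This makes `U h` and `V h` coprime over any
  -- commutative ring.
  have hdet : ∀ h, U h * V (h + 1) - U (h + 1) * V h = 1 := by
    intro h
    induction h with
    | zero => simp [hU0, hU1, hV0, hV1]
    | succ n ih =>
      have h1 := hU (n + 1)
      have h2 := hV (n + 1)
      rw [add_sub_cancel_right] at h1 h2
      linear_combination ih + U (n + 1) * h2 - V (n + 1) * h1
    | pred n ih =>
      have h1 := hU (-n)
      have h2 := hV (-n)
      rw [sub_add_cancel]
      linear_combination ih - U (-n) * h2 + V (-n) * h1
  refine ⟨U, V, fun h => ⟨V (h + 1), -U (h + 1), by linear_combination hdet h⟩, fun h => ?_⟩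
  have h1 := congrArg C (hU h)
  have h2 := congrArg C (hV h)
  simp only [map_add, map_mul] at h1 h2
  linear_combination h1 + X * h2

/-- The parameters of the two colours `b`, `c` along the heights. -/
def twoPeriodic {L : Type*} (d d' : L) (h : ℤ) : L := if Even h then d else d'

/-- Path weights from solutions of the recursion of the quantum numbers. -/
def PathWeights.ofSequences {S : Type u} {k : Type*} [CommRing k] {L : Type*} [Field L]
    {A : Matrix S S k} {φ : k →+* L} (N : S → S → ℤ → L)
    (H : ∀ b c, QuantumSequence (twoPeriodic (φ (-A b c)) (φ (-A c b))) (N b c)) :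
    PathWeights A φ where
  -- With this choice `r b c` at even and `r c b` at odd heights use the same sequence `N b c`, as
  -- needed along a sequence alternating between `b` and `c`.
  r b c h := -((if Even h then N b c else N c b) (h + 1) *
    ((if Even h then N b c else N c b) h)⁻¹)
  ne_zero b c h := by
    have h1 := (H b c).ne_zero
    have h2 := (H c b).ne_zero
    split_ifs <;> simp [h1, h2]
  circle b c _ h := by
    by_cases hh : Even h
    · have h1 := (H b c).ne_zero h
      have h2 := (H b c).ne_zero (h - 1)
      have h3 := (H b c).step h
      have hh' : ¬ Even (h - 1) := by simpa [Int.even_sub_one] using hh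
      simp only [hh, hh', if_true, if_false, sub_add_cancel]
      rw [twoPeriodic, if_pos hh, map_neg] at h3
      field_simp
      linear_combination -h3
    · have h1 := (H c b).ne_zero h
      have h2 := (H c b).ne_zero (h - 1)
      have h3 := (H c b).step h
      have hh' : Even (h - 1) := by simpa [Int.even_sub_one] using hh
      simp only [hh, hh', if_true, if_false, sub_add_cancel]
      rw [twoPeriodic, if_neg hh, map_neg] at h3
      field_simp
      linear_combination -h3

end Sequences

/-! ### Endomorphisms that kill cups, in a path representation -/

section Alternate

variable {S : Type u}

/-- The alternating sequence of length `n` that begins with `b`, then `c`. -/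
def altFrom (b c : S) : ℕ → List S
  | 0 => []
  | n + 1 => b :: altFrom c b n

@[simp] theorem length_altFrom (b c : S) (n : ℕ) : (altFrom b c n).length = n := by
  induction n generalizing b c with
  | zero => rfl
  | succ n ih => simp [altFrom, ih]

theorem getElem?_altFrom (n j : ℕ) (hj : j < n) : ∀ b c : S,
    (altFrom b c n)[j]? = some (if Even j then b else c) := by
  induction j generalizing n with
  | zero =>
    obtain ⟨n, rfl⟩ := Nat.exists_eq_add_one.2 hj
    simp [altFrom]
  | succ j ih =>
    obtain ⟨n, rfl⟩ := Nat.exists_eq_add_one.2 (Nat.zero_lt_of_lt hj)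
    intro b c
    rw [altFrom, List.getElem?_cons_succ, ih n (by omega)]
    by_cases h : Even j <;> simp [h, Nat.even_add_one]

theorem altFrom_add (a n : ℕ) : ∀ b c : S,
    altFrom b c (a + n) = altFrom b c a
      ++ altFrom (if Even a then b else c) (if Even a then c else b) n := by
  induction a with
  | zero => simp [altFrom]
  | succ a ih =>
    intro b c
    rw [Nat.succ_add, altFrom, altFrom, ih]
    by_cases h : Even a <;> simp [h, Nat.even_add_one]

theorem even_height (σ : List Bool) : Even (height σ) ↔ Even σ.length := by
  induction σ with
  | nil => simp
  | cons ε σ ih => cases ε <;> simp [sgn, Int.even_add, Nat.even_add_one, ih]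

end Alternate

/-! ### Elements of `B(x)` as rank-one operators. -/

section Rank

variable {S : Type u} {k : Type*} [CommRing k] {L : Type*} [Field L] {A : Matrix S S k}
  {φ : k →+* L} (W : PathWeights A φ)

/-- The weights of peaks of paths in a word alternating between `b` (at even heights) and `c`. -/
def PathWeights.alt (b c : S) (h : ℤ) : L := if Even h then W.r b c h else W.r c b h

theorem PathWeights.alt_ne_zero (b c : S) (h : ℤ) : W.alt b c h ≠ 0 := by
  unfold PathWeights.alt
  split_ifs <;> exact W.ne_zero _ _ _

/-- Factors by which peaks and valleys differ in functionals that are killed by caps. -/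
def PathWeights.capFactor (b c : S) (h : ℤ) : L := -W.alt b c (h - 1)

/-- Factors by which peaks and valleys differ in functions that are killed by cups. -/
def PathWeights.cupFactor (b c : S) (h : ℤ) : L := -W.alt b c h

/-- A path that goes up outside of a subsequence. -/
def extendPath (i j : ℕ) (σ : List Bool) : List Bool :=
  List.replicate i true ++ (σ ++ List.replicate j true)

theorem length_extendPath (i j : ℕ) (σ : List Bool) :
    (extendPath i j σ).length = i + σ.length + j := by
  simp [extendPath]
  omega

theorem PathWeights.ofSequences_alt (N : S → S → ℤ → L)
    (H : ∀ b c, QuantumSequence (twoPeriodic (φ (-A b c)) (φ (-A c b))) (N b c)) (b c : S)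
    (h : ℤ) : (PathWeights.ofSequences N H).alt b c h = -(N b c (h + 1) * (N b c h)⁻¹) := by
  by_cases hh : Even h <;> simp only [PathWeights.alt, PathWeights.ofSequences, hh, if_true,
    if_false]

/-- The middle value `N b c h` cancels; what remains is the box weight summed in
`QuantumSequence.pathSum_boxWeight`. -/
theorem PathWeights.ofSequences_cupFactor_mul (N : S → S → ℤ → L)
    (H : ∀ b c, QuantumSequence (twoPeriodic (φ (-A b c)) (φ (-A c b))) (N b c)) (b c : S)
    (h : ℤ) :
    (PathWeights.ofSequences N H).cupFactor b c h * (PathWeights.ofSequences N H).capFactor b c h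
      = N b c (h + 1) * (N b c (h - 1))⁻¹ := by
  have h0 := (H b c).ne_zero h
  rw [PathWeights.cupFactor, PathWeights.capFactor, PathWeights.ofSequences_alt,
    PathWeights.ofSequences_alt, sub_add_cancel]
  field_simp

/-- The functional on functions of paths that is killed by all caps. -/
def capFunctional (b c : S) (i j p m n : ℕ) (ψ : List Bool → L) : L :=
  pathSum n fun σ => boxWeight (W.capFactor b c) p m 0 σ * ψ (extendPath i j σ)

/-- A word that consists of an alternating subsequence that no cap straddles. -/
structure IsolatedAlt (x : List S) (b c : S) (i j n : ℕ) : Prop where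
  ne : b ≠ c
  split : ∃ pre post, pre.length = i ∧ post.length = j ∧ x = pre ++ altFrom b c (n + 1) ++ post
  cap : ∀ l d e r, x = l ++ d :: e :: d :: r → l.length + 1 ≠ i ∧ l.length + 1 ≠ i + n

variable {W} {x : List S} {b c : S} {i j n : ℕ}

theorem IsolatedAlt.length (I : IsolatedAlt x b c i j n) : x.length = i + n + 1 + j := by
  obtain ⟨pre, post, rfl, rfl, rfl⟩ := I.split
  simp
  omega

theorem IsolatedAlt.getElem? (I : IsolatedAlt x b c i j n) (a : ℕ) (ha : a ≤ n) :
    x[i + a]? = some (if Even a then b else c) := by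
  obtain ⟨pre, post, rfl, rfl, rfl⟩ := I.split
  rw [List.append_assoc, List.getElem?_append_right (by omega), Nat.add_sub_cancel_left,
    List.getElem?_append_left (by simp; omega), getElem?_altFrom _ _ (by omega)]

theorem shiftOp_at (O : PathOp L) (h : ℤ) (ψ : List Bool → L) (σ τ : List Bool) (q : ℕ)
    (hq : q = σ.length) :
    shiftOp q O h ψ (σ ++ τ) = O (h + height σ) (fun μ => ψ (σ ++ μ)) τ := by
  subst hq
  exact shiftOp_append O h ψ σ τ

theorem height_replicate (i : ℕ) : height (List.replicate i true) = i := by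
  simp [height, sgn]

/-- A cap outside the subsequence meets two steps up and gives 0. For a cap inside, `capFactor` is
chosen so that peaks and valleys cancel. The start at height `-i` puts the subsequence at height 0.
-/
theorem capFunctional_cap (I : IsolatedAlt x b c i j n) (p m : ℕ) {z : List S} (s : Step x z)
    (hs : s.IsCap) (ψ : List Bool → L) :
    capFunctional W b c i j p m n (s.op W (-i) ψ) = 0 := by
  cases s with
  | cup => exact hs.elim
  | cap l d e r hde hx hz =>
  obtain ⟨hc1, hc2⟩ := I.cap l d e r hx
  have hlen := I.length
  have hlen' := congrArg List.length hx
  simp only [List.length_append, List.length_cons] at hlen'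
  simp only [capFunctional, Step.op]
  by_cases h1 : l.length + 2 ≤ i
  · rw [pathSum_congr (F' := fun _ => 0), pathSum_zero]
    intro σ hσ
    obtain ⟨i', rfl⟩ : ∃ i', i = l.length + (2 + i') := ⟨i - l.length - 2, by omega⟩
    have e : extendPath (l.length + (2 + i')) j σ = List.replicate l.length true ++
        true :: true :: extendPath i' j σ := by
      rw [extendPath, List.replicate_add, List.replicate_add]
      simp [extendPath, List.replicate_succ]
    rw [e, shiftOp_at _ _ _ _ _ _ (by simp)]
    simp
  by_cases h2 : i + n ≤ l.length
  · rw [pathSum_congr (F' := fun _ => 0), pathSum_zero]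
    intro σ hσ
    obtain ⟨j', j'', rfl, hj⟩ : ∃ j' j'', j = j' + (2 + j'') ∧ l.length = i + n + j' :=
      ⟨l.length - i - n, j - (l.length - i - n) - 2, by omega, by omega⟩
    have e : extendPath i (j' + (2 + j'')) σ = extendPath i j' σ ++
        true :: true :: List.replicate j'' true := by
      rw [extendPath, List.replicate_add, List.replicate_add]
      simp [extendPath, List.replicate_succ]
    rw [e, shiftOp_at _ _ _ _ _ _ (by rw [length_extendPath]; omega)]
    simp
  obtain ⟨a, n', rfl, ha⟩ : ∃ a n', n = a + (n' + 2) ∧ l.length = i + a :=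
    ⟨l.length - i, n - (l.length - i) - 2, by omega, by omega⟩
  have hd := I.getElem? a (by omega)
  have he := I.getElem? (a + 1) (by omega)
  rw [hx, ← ha, List.getElem?_append_right (le_refl _), Nat.sub_self] at hd
  rw [hx, ← add_assoc, ← ha, List.getElem?_append_right (by omega), Nat.add_sub_cancel_left] at he
  simp only [List.getElem?_cons_zero, List.getElem?_cons_succ, Option.some.injEq] at hd he
  rw [pathSum_append, pathSum_congr (F' := fun _ => 0), pathSum_zero]
  intro σ hσ
  simp only [pathSum, ← pathSum_add]
  rw [pathSum_congr (F' := fun _ => 0), pathSum_zero]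
  intro τ hτ
  have hE : ∀ μ, extendPath i j (σ ++ μ) = (List.replicate i true ++ σ) ++
      (μ ++ List.replicate j true) := by
    intro μ
    simp [extendPath]
  simp only [hE, List.cons_append]
  rw [shiftOp_at _ _ _ _ _ _ (by simp; omega), shiftOp_at _ _ _ _ _ _ (by simp; omega),
    shiftOp_at _ _ _ _ _ _ (by simp; omega), shiftOp_at _ _ _ _ _ _ (by simp; omega)]
  simp only [capOp_up_up, capOp_up_down, capOp_down_up, capOp_down_down, height_append,
    height_replicate, neg_add_cancel_left, mul_zero, zero_add, add_zero, boxWeight_swap]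
  -- Height and position have the same parity, so the height determines the colour of the region.
  have key : W.capFactor b c (height σ) = -W.r e d (height σ - 1) := by
    have hpar := even_height σ
    rw [hσ] at hpar
    rw [PathWeights.capFactor, PathWeights.alt, hd, he]
    by_cases hp : Even a
    · have h1 : ¬ Even (height σ - 1) := by simpa [Int.even_sub_one] using hpar.2 hp
      rw [if_neg h1, if_pos hp, if_neg (by simpa [Nat.even_add_one] using hp)]
    · have h1 : Even (height σ - 1) := by
        simpa [Int.even_sub_one] using fun h => hp (hpar.1 h)
      rw [if_pos h1, if_neg hp, if_pos (by simpa [Nat.even_add_one] using hp)]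
  rw [key]
  have := W.ne_zero e d (height σ - 1)
  field_simp
  ring

theorem capFunctional_add (p m : ℕ) (ψ ψ' : List Bool → L) :
    capFunctional W b c i j p m n (ψ + ψ')
      = capFunctional W b c i j p m n ψ + capFunctional W b c i j p m n ψ' := by
  rw [capFunctional, capFunctional, capFunctional, ← pathSum_add]
  simp only [Pi.add_apply, mul_add]

theorem capFunctional_smul (p m : ℕ) (a : L) (ψ : List Bool → L) :
    capFunctional W b c i j p m n (a • ψ) = a * capFunctional W b c i j p m n ψ := by
  rw [capFunctional, capFunctional, ← pathSum_mul]
  simp only [Pi.smul_apply, smul_eq_mul, mul_left_comm]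

theorem capFunctional_trunc (I : IsolatedAlt x b c i j n) (p m : ℕ) (O : PathOp L)
    (h : ℤ) (ψ : List Bool → L) :
    capFunctional W b c i j p m n ((truncOp L x.length * O) h ψ)
      = capFunctional W b c i j p m n (O h ψ) := by
  refine pathSum_congr fun σ hσ => ?_
  simp only [Pi.mul_apply, Module.End.mul_apply, truncOp_apply]
  rw [if_pos (by rw [length_extendPath, I.length]; omega)]

/-- The reflection of `mem_cupEnding`: a morphism to a shorter sequence is a combination of
morphisms that begin with a cap. -/
theorem capFunctional_shorter (I : IsolatedAlt x b c i j n) (p m : ℕ) {z : List S}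
    (g : (⟨x⟩ : STL A) ⟶ ⟨z⟩) (hz : z.length < x.length) (ψ : List Bool → L) :
    capFunctional W b c i j p m n (homOp W g (-i) ψ) = 0 := by
  have hg := mem_cupEnding hz (flip g)
  rw [← flip_flip g]
  generalize flip g = g' at hg
  induction hg using Submodule.span_induction with
  | mem g' hg' =>
    obtain ⟨l, d, e, r, hde, hx, g, rfl⟩ := hg'
    rw [flip_comp]
    change capFunctional W b c i j p m n
      (homOp W ((Step.cap l d e r hde hx rfl).hom A ≫ flip g) (-i) ψ) = 0
    rw [homOp_comp, homOp_step, mul_assoc, capFunctional_trunc I]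
    exact capFunctional_cap I p m (Step.cap l d e r hde hx rfl) trivial _
  | zero => simp [flip_zero, homOp_zero, capFunctional, pathSum_zero]
  | add g g' _ _ h1 h2 =>
    rw [flip_add, homOp_add, Pi.add_apply, LinearMap.add_apply, capFunctional_add, h1, h2,
      add_zero]
  | smul a g _ h1 =>
    rw [flip_smul, homOp_smul, Pi.smul_apply, LinearMap.smul_apply, capFunctional_smul, h1,
      mul_zero]

theorem capFunctional_of_coeff (I : IsolatedAlt x b c i j n) (p m : ℕ)
    {f : (⟨x⟩ : STL A) ⟶ ⟨x⟩} {d : k} (hf : HasIdentityCoeff A x f d) (ψ : List Bool → L) :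
    capFunctional W b c i j p m n (homOp W f (-i) ψ)
      = φ d * capFunctional W b c i j p m n ψ := by
  obtain ⟨g, rfl⟩ : ∃ g, f = d • 𝟙 _ + g := ⟨f - d • 𝟙 _, by abel⟩
  rw [HasIdentityCoeff, add_sub_cancel_left] at hf
  have hg : capFunctional W b c i j p m n (homOp W g (-i) ψ) = 0 := by
    induction hf using Submodule.span_induction with
    | mem g hg =>
      obtain ⟨y, g, h, hy, rfl⟩ := hg
      rw [homOp_comp]
      exact capFunctional_shorter I p m g hy _
    | zero => simp [homOp_zero, capFunctional, pathSum_zero]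
    | add g g' _ _ h1 h2 =>
      rw [homOp_add, Pi.add_apply, LinearMap.add_apply, capFunctional_add, h1, h2, add_zero]
    | smul a g _ h1 =>
      rw [homOp_smul, Pi.smul_apply, LinearMap.smul_apply, capFunctional_smul, h1, mul_zero]
  rw [homOp_add, Pi.add_apply, LinearMap.add_apply, capFunctional_add, hg, add_zero, homOp_smul,
    Pi.smul_apply, LinearMap.smul_apply, capFunctional_smul, homOp_id]
  have := capFunctional_trunc (W := W) I p m 1 (-i) ψ
  rw [mul_one] at this
  rw [this]
  rfl

/-- The equation `c ≫ f = 0`, read at a path, relates the values of `f` at a peak and at the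
corresponding valley. -/
theorem homOp_perp_swap (I : IsolatedAlt x b c i j n) {f : (⟨x⟩ : STL A) ⟶ ⟨x⟩}
    (hf : f ∈ perp A x) (ψ : List Bool → L) (σ μ : List Bool)
    (hl : σ.length + μ.length + 2 = n) :
    homOp W f (-i) ψ (extendPath i j (σ ++ false :: true :: μ))
      = W.cupFactor b c (0 + height σ)
        * homOp W f (-i) ψ (extendPath i j (σ ++ true :: false :: μ)) := by
  obtain ⟨pre, post, hpre, hpost, hx⟩ := I.split
  have hn : n + 1 = σ.length + (3 + μ.length) := by omega
  rw [hn, altFrom_add] at hx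
  rw [show 3 + μ.length = μ.length + 1 + 1 + 1 by omega, altFrom, altFrom, altFrom] at hx
  set d := if Even σ.length then b else c with hd
  set e := if Even σ.length then c else b with he
  have hde : d ≠ e := by
    have := I.ne
    rw [hd, he]
    split_ifs
    · exact this
    · exact this.symm
  have hx' : x = (pre ++ altFrom b c σ.length) ++ d :: e :: d :: (altFrom e d μ.length ++ post) := by
    rw [hx]
    simp
  have h0 := congrArg (fun g => homOp W g (-i) ψ (extendPath i j (σ ++ μ)))
    (hf _ d e _ hde hx')
  simp only [homOp_comp, homOp_zero, cupInto] at h0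
  change (homOp W (Step.hom A (Step.cup (pre ++ altFrom b c σ.length) d e
    (altFrom e d μ.length ++ post) hde rfl hx')) * homOp W f) (-i) ψ _ = 0 at h0
  rw [homOp_step] at h0
  simp only [Pi.mul_apply, Module.End.mul_apply, truncOp_apply] at h0
  rw [if_pos (by rw [length_extendPath]; simp; omega)] at h0
  have e' : ∀ μ, extendPath i j (σ ++ μ) = (List.replicate i true ++ σ) ++
      (μ ++ List.replicate j true) := by
    intro μ
    simp [extendPath]
  rw [e', Step.op, shiftOp_at _ _ _ _ _ _ (by simp; omega), cupOp_apply] at h0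
  simp only [height_append, height_replicate, neg_add_cancel_left] at h0
  simp only [e', List.cons_append]
  have key : W.cupFactor b c (0 + height σ) = -W.r d e (height σ) := by
    have hpar := even_height σ
    rw [zero_add, PathWeights.cupFactor, PathWeights.alt, hd, he]
    by_cases hp : Even σ.length
    · simp [hp, hpar.2 hp]
    · have h1 : ¬ Even (height σ) := fun h => hp (hpar.1 h)
      rw [if_neg h1, if_neg hp, if_neg hp]
  rw [key]
  linear_combination h0

/-- The operator of an endomorphism that kills cups has rank one for each number of steps up. -/
theorem homOp_perp_mul (I : IsolatedAlt x b c i j n) {f : (⟨x⟩ : STL A) ⟶ ⟨x⟩}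
    (hf : f ∈ perp A x) {d : k} (hfd : HasIdentityCoeff A x f d) (p m : ℕ)
    (ψ : List Bool → L) (σ : List Bool) (hσ : σ.length = n) (hp : σ.count true = p)
    (hm : σ.count false = m) :
    homOp W f (-i) ψ (extendPath i j σ)
        * pathSum n (boxWeight (fun h => W.cupFactor b c h * W.capFactor b c h) p m 0)
      = φ d * boxWeight (W.cupFactor b c) p m 0 σ * capFunctional W b c i j p m n ψ := by
  -- Killing cups determines all values from the one at the path that first goes up `p` times.
  have hF : ∀ τ : List Bool, τ.length = n → τ.count true = p → τ.count false = m →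
      homOp W f (-i) ψ (extendPath i j τ) = boxWeight (W.cupFactor b c) p m 0 τ *
        homOp W f (-i) ψ (extendPath i j (List.replicate p true ++ List.replicate m false)) := by
    intro τ hτ h1 h2
    exact eq_boxWeight_mul (W.cupFactor b c) τ p m 0
      (fun τ => homOp W f (-i) ψ (extendPath i j τ))
      (fun σ' μ hl => homOp_perp_swap I hf ψ σ' μ (by omega)) h1 h2
  -- The functional that kills caps is evaluated in terms of that single value; by
  -- `capFunctional_of_coeff` it is also known from the identity coefficient.
  have hsum : capFunctional W b c i j p m n (homOp W f (-i) ψ)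
      = homOp W f (-i) ψ (extendPath i j (List.replicate p true ++ List.replicate m false))
        * pathSum n (boxWeight (fun h => W.cupFactor b c h * W.capFactor b c h) p m 0) := by
    rw [capFunctional, ← pathSum_mul]
    refine pathSum_congr fun τ hτ => ?_
    rw [boxWeight_mul]
    by_cases h : τ.count true = p ∧ τ.count false = m
    · rw [hF τ hτ h.1 h.2]
      ring
    · rw [boxWeight_eq_zero _ τ p m 0 h, boxWeight_eq_zero _ τ p m 0 h]
      ring
  rw [capFunctional_of_coeff I p m hfd] at hsum
  rw [hF σ hσ hp hm]
  linear_combination -boxWeight (W.cupFactor b c) p m 0 σ * hsum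

/-- The functional `capFunctional` at a function supported at one path. -/
theorem capFunctional_single (i j p m n : ℕ) (b c : S) (τ : List Bool) (hτ : τ.length = n) :
    capFunctional W b c i j p m n (Pi.single (extendPath i j τ) 1)
      = boxWeight (W.capFactor b c) p m 0 τ := by
  rw [capFunctional, pathSum_single _ τ hτ]
  · simp
  · intro σ hσ hne
    rw [Pi.single_eq_of_ne, mul_zero]
    intro h
    rw [extendPath, extendPath, List.append_cancel_left_eq] at h
    exact hne (List.append_inj_left' h rfl)

end Rank

/-! ### Non-invertible binomials exclude a top idempotent. -/

section NonExistence

variable {S : Type u}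

-- Modulo a maximal ideal containing the binomial, the sum over paths in `homOp_perp_mul` vanishes.
-- For an element of identity coefficient 1 the formula then equates 0 with a product of non-zero
-- weights.
open Polynomial in
theorem not_topIdempotentExists_of_isolatedAlt {k : Type v} [CommRing k] (A : Matrix S S k)
    {x : List S} {b c : S} {i j n : ℕ} (I : IsolatedAlt x b c i j n) (m : ℕ) (hm : m ≤ n)
    (hq : ¬ IsUnit (qbinom₂ (-A b c) (-A c b) n m)) : ¬ TopIdempotentExists A x := by
  intro hex
  obtain ⟨f, hf, hf1⟩ := exists_coeff_one hex
  obtain ⟨𝔪, h𝔪, hq𝔪⟩ := exists_max_ideal_of_mem_nonunits hq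
  let : Field (k ⧸ 𝔪) := Ideal.Quotient.field 𝔪
  let π : k →+* k ⧸ 𝔪 := Ideal.Quotient.mk 𝔪
  let ι : k ⧸ 𝔪 →+* FractionRing (k ⧸ 𝔪)[X] := (algebraMap _ _).comp C
  let φ : k →+* FractionRing (k ⧸ 𝔪)[X] := ι.comp π
  -- The extra variable is needed because quantum numbers may vanish in the residue field; linear
  -- polynomials with coprime coefficients do not.
  have hex : ∀ b c : S, ∃ N : ℤ → FractionRing (k ⧸ 𝔪)[X],
      QuantumSequence (twoPeriodic (φ (-A b c)) (φ (-A c b))) N := by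
    intro b c
    obtain ⟨U, V, hUV, hrec⟩ := exists_linear_sequence (twoPeriodic (π (-A b c)) (π (-A c b)))
    refine ⟨fun h => algebraMap (k ⧸ 𝔪)[X] _ (C (U h) + C (V h) * X), ⟨?_, ?_, ?_⟩⟩
    · intro h
      simp [twoPeriodic]
    · intro h h0
      rw [map_eq_zero_iff _ (IsFractionRing.injective _ _)] at h0
      obtain ⟨a, a', ha⟩ := hUV h
      have h1 := congrArg (coeff · 0) h0
      have h2 := congrArg (coeff · 1) h0
      simp at h1 h2
      simp [h1, h2] at ha
    · intro h
      rw [← map_add, hrec, map_mul]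
      congr 1
      simp only [twoPeriodic]
      split_ifs <;> rfl
  choose N hN using hex
  let W : PathWeights A φ := PathWeights.ofSequences N hN
  have hfac := PathWeights.ofSequences_cupFactor_mul N hN b c
  obtain ⟨p, rfl⟩ : ∃ p, n = p + m := ⟨n - m, by omega⟩
  have hsum := (hN b c).pathSum_boxWeight (p + m) p m 0 rfl
  have h0 : φ (qbinom₂ (-A b c) (-A c b) (p + m) m) = 0 := by
    change ι (π _) = 0
    rw [Ideal.Quotient.eq_zero_iff_mem.2 hq𝔪, map_zero]
  rw [map_qbinom₂] at h0
  simp only [twoPeriodic, Even.zero, zero_add, if_true] at hsum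
  rw [if_neg (by decide), h0, zero_mul, mul_eq_zero_iff_right
    (Finset.prod_ne_zero_iff.2 fun i _ => (hN b c).ne_zero _)] at hsum
  simp only [← hfac] at hsum
  set σ := List.replicate p true ++ List.replicate m false with hσ
  have c1 : σ.count true = p := by simp [hσ, List.count_replicate]
  have c2 : σ.count false = m := by simp [hσ, List.count_replicate]
  -- The test function is supported at the path where the result is evaluated, so both box weights
  -- belong to `σ` and are non-zero.
  have key := homOp_perp_mul (W := W) I hf hf1 p m (Pi.single (extendPath i j σ) 1) σ
    (by simp [hσ]) c1 c2
  rw [capFunctional_single _ _ _ _ _ _ _ _ (by simp [hσ]), hsum, mul_zero, map_one, one_mul,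
    eq_comm, mul_eq_zero] at key
  have n1 := boxWeight_ne_zero (W.cupFactor b c) (fun h => neg_ne_zero.2 (W.alt_ne_zero _ _ _)) σ 0
  have n2 := boxWeight_ne_zero (W.capFactor b c) (fun h => neg_ne_zero.2 (W.alt_ne_zero _ _ _)) σ 0
  rw [c1, c2] at n1 n2
  exact key.elim n1 n2

end NonExistence
end ColoredTL

namespace ColoredTL

open CategoryTheory

/-! ### Half diagrams on alternating sequences -/

section AlternatingWords

variable {S : Type u} (s t : S)

/-- The colours of an alternating sequence, counted from its right end. -/
def color (n : ℕ) : S := if Even n then s else t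

/-- The alternating sequence with `n` strands that ends in `s`, built from the right. -/
def altUp : ℕ → List S
  | 0 => [s]
  | n + 1 => color s t (n + 1) :: altUp n

/-- The sequence `altUp s t n` without its first colour. -/
def altTail : ℕ → List S
  | 0 => []
  | n + 1 => altUp s t n

theorem altUp_eq (n : ℕ) : altUp s t n = color s t n :: altTail s t n := by
  cases n <;> simp [altUp, altTail, color]

@[simp] theorem length_altUp (n : ℕ) : (altUp s t n).length = n + 1 := by
  induction n with
  | zero => rfl
  | succ n ih => simp [altUp, ih]

theorem color_add_two (n : ℕ) : color s t (n + 2) = color s t n := by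
  simp [color, Nat.even_add]

theorem color_succ (n : ℕ) : color s t (n + 1) = color t s n := by
  by_cases h : Even n <;> simp [color, h, Nat.even_add_one]

variable {s t} in
theorem color_ne (hst : s ≠ t) (n : ℕ) : color s t n ≠ color s t (n + 1) := by
  by_cases h : Even n
  · simpa [color, h, Nat.even_add_one] using hst
  · simpa [color, h, Nat.even_add_one] using hst.symm

theorem altWord_succ_eq_altUp (n : ℕ) : altWord s t (n + 1) = altUp s t n := by
  have h : ∀ n, ∀ s t : S, altUp s t (n + 1) = altUp t s n ++ [s] := by
    intro n
    induction n with
    | zero => intro s t; simp [altUp, color]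
    | succ n ih =>
      intro s t
      rw [altUp, ih, altUp, List.cons_append, color_succ]
  induction n generalizing s t with
  | zero => rfl
  | succ n ih => rw [altWord, ih, ← h]

theorem altFrom_eq_altUp (n : ℕ) :
    altFrom (color s t n) (color s t (n + 1)) (n + 1) = altUp s t n := by
  induction n with
  | zero => simp [altFrom, altUp, color]
  | succ n ih => rw [altFrom, altUp, color_add_two, ih]

/-- Removing a cup from an alternating sequence leaves an alternating one, so composites of cups
into `altUp s t n` pass only through such sequences. -/
theorem altUp_split {n : ℕ} {l r : List S} {b c : S} (h : altUp s t n = l ++ b :: c :: b :: r) :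
    ∃ m, n = m + 2 ∧ l ++ b :: r = altUp s t m := by
  induction l generalizing n with
  | nil =>
    obtain _ | _ | n := n
    · simp [altUp] at h
    · simp [altUp] at h
    · refine ⟨n, rfl, ?_⟩
      simp only [altUp, List.nil_append, List.cons.injEq] at h
      exact h.2.2.symm
  | cons e l ih =>
    obtain _ | n := n
    · simp [altUp] at h
    · simp only [altUp, List.cons_append, List.cons.injEq] at h
      obtain ⟨m, rfl, hm⟩ := ih h.2
      refine ⟨m + 1, rfl, ?_⟩
      rw [List.cons_append, hm, altUp, ← h.1, color_add_two]

/-- The cup at the left end. -/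
def altCup {s t : S} (hst : s ≠ t) (n : ℕ) : Step (altUp s t n) (altUp s t (n + 2)) :=
  .cup [] (color s t n) (color s t (n + 1)) (altTail s t n) (color_ne hst n) (altUp_eq s t n)
    (by rw [altUp, altUp, color_add_two, altUp_eq s t n]; rfl)

end AlternatingWords

/-! ### Half diagrams and the spanning diagrams on alternating sequences. -/

section HalfDiagrams

/-- Crossingless matchings of `m` lower and `n` upper points without caps. They are built from
the right to the left. -/
inductive HalfDiagram : ℕ → ℕ → Type
  /-- The empty diagram. -/
  | nil : HalfDiagram 0 0
  /-- Add a through strand on the left. -/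
  | thr {m n : ℕ} (d : HalfDiagram m n) : HalfDiagram (m + 1) (n + 1)
  /-- Join a new point on the left to the first through strand. -/
  | arc {m n : ℕ} (d : HalfDiagram (m + 1) n) : HalfDiagram m (n + 1)

theorem HalfDiagram.even_iff {m n : ℕ} (d : HalfDiagram m n) : Even m ↔ Even n := by
  induction d with
  | nil => rfl
  | thr d ih => simp [Nat.even_add_one, ih]
  | arc d ih => simp [Nat.even_add_one, ← ih]

variable {S : Type u} {k : Type v} [CommRing k] (A : Matrix S S k) {s t : S} (hst : s ≠ t)

theorem HalfDiagram.altUp_cons {m n : ℕ} (d : HalfDiagram m n) :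
    altUp s t (m + 1) = [color s t (n + 1)] ++ altUp s t m ++ [] := by
  simp [altUp, color, Nat.even_add_one, d.even_iff]

theorem altUp_succ (n : ℕ) :
    altUp s t (n + 1) = [color s t (n + 1)] ++ altUp s t n ++ [] := by
  simp [altUp]

/-- The composite of cups given by a half diagram. -/
def cupHom : ∀ {m n : ℕ}, HalfDiagram m n → ((⟨altUp s t m⟩ : STL A) ⟶ ⟨altUp s t n⟩)
  | _, _, .nil => 𝟙 _
  | _, _, .thr (n := n) d => whisk [color s t (n + 1)] [] (cupHom d) d.altUp_cons (altUp_succ n)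
  | m, _, .arc (n := n) d =>
    (altCup hst m).hom A ≫ whisk [color s t (n + 1)] [] (cupHom d) d.altUp_cons (altUp_succ n)

variable {A}

/-- The interchange law for a cup at the left end, glued to `f` along the region of colour `b`. -/
theorem cup_comp_whisk {x y X Y : List S} (b c : S) (q q' : List S) (hbc : b ≠ c)
    (hx : x = b :: q) (hy : y = b :: q') (hX : X = b :: c :: b :: q) (hY : Y = b :: c :: b :: q')
    (f : (⟨x⟩ : STL A) ⟶ ⟨y⟩) :
    (Step.cup [] b c q hbc hx hX).hom A ≫
        whisk [b, c] [] f (by simp [hX, hx]) (by simp [hY, hy])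
      = f ≫ (Step.cup [] b c q' hbc hy hY).hom A := by
  subst hx hy hX hY
  have key := interchange (A := A) [] [b, c] b q q'
    ((Step.cup [] b c [] hbc rfl rfl).hom A) f rfl rfl rfl rfl
  rw [whisk_of, whisk_of] at key
  rw [whisk_nil] at key
  exact key

theorem altCup_comp_whisk {m n : ℕ} (f : (⟨altUp s t m⟩ : STL A) ⟶ ⟨altUp s t n⟩)
    {e e' : S} (hX : altUp s t (m + 1) = [e] ++ altUp s t m ++ [])
    (hY : altUp s t (n + 1) = [e] ++ altUp s t n ++ [])
    (hX' : altUp s t (m + 2) = [e'] ++ altUp s t (m + 1) ++ [])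
    (hY' : altUp s t (n + 2) = [e'] ++ altUp s t (n + 1) ++ []) :
    (altCup hst m).hom A ≫ whisk [e'] [] (whisk [e] [] f hX hY) hX' hY'
      = f ≫ (altCup hst n).hom A := by
  obtain rfl : color s t (m + 1) = e := by simpa [altUp] using hX
  obtain rfl : color s t (m + 2) = e' := by simpa [altUp] using hX'
  have h1 : color s t (n + 1) = color s t (m + 1) := by simpa [altUp] using hY
  have h2 : color s t (n + 2) = color s t (m + 2) := by simpa [altUp] using hY'
  rw [whisk_whisk]
  simp only [color_add_two, List.append_nil] at h2 ⊢
  have := cup_comp_whisk (A := A) (color s t m) (color s t (m + 1)) (altTail s t m) (altTail s t n)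
    (color_ne hst m) (altUp_eq s t m) (by rw [← h2, altUp_eq]) (X := altUp s t (m + 2))
    (Y := altUp s t (n + 2)) (by rw [altUp, altUp, color_add_two, altUp_eq s t m])
    (by rw [altUp, altUp, color_add_two, h1, h2, altUp_eq s t n, h2]) f
  refine this.trans ?_
  congr 2
  simp only [altCup, h1, h2]

/-- A cup at the left end follows a half diagram. -/
theorem cupHom_comp_cup_nil {m n : ℕ} (d : HalfDiagram m n) (b c : S) (r : List S) (hbc : b ≠ c)
    (hx : altUp s t n = [] ++ b :: r) (hy : altUp s t (n + 2) = [] ++ b :: c :: b :: r) :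
    cupHom A hst d ≫ (Step.cup [] b c r hbc hx hy).hom A = cupHom A hst (.arc (.thr d)) := by
  simp only [cupHom]
  rw [altCup_comp_whisk]
  congr 2
  have h1 := hy
  rw [altUp, altUp] at h1
  have h2 := hx
  rw [altUp_eq] at h2
  simp only [List.nil_append, List.cons.injEq] at h1 h2
  obtain ⟨rfl, h2⟩ := h2
  obtain ⟨-, rfl, h1⟩ := h1
  subst h2
  rfl

/-- A cup that does not touch the first region lies to the right of the leftmost strand and is
absorbed by the rest of the diagram. -/
theorem cupHom_comp_cup_cons {m n : ℕ} (d : HalfDiagram m n) (ih : ∀ (z : Step (altUp s t n)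
    (altUp s t (n + 2))), z.IsCup → ∃ d' : HalfDiagram m (n + 2),
      cupHom A hst d ≫ z.hom A = cupHom A hst d') (e : S) (l : List S) (b c : S) (r : List S)
    (hbc : b ≠ c) (hx : altUp s t (n + 1) = e :: l ++ b :: r)
    (hy : altUp s t (n + 1 + 2) = e :: l ++ b :: c :: b :: r) :
    ∃ d' : HalfDiagram m (n + 2),
      whisk [color s t (n + 1)] [] (cupHom A hst d) d.altUp_cons (altUp_succ n) ≫
        (Step.cup (e :: l) b c r hbc hx hy).hom A
      = whisk [color s t (n + 2 + 1)] [] (cupHom A hst d') d'.altUp_cons (altUp_succ _) := by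
  have hx' := hx
  have hy' := hy
  rw [altUp] at hx' hy'
  simp only [List.cons_append, List.cons.injEq] at hx' hy'
  obtain ⟨rfl, hx'⟩ := hx'
  obtain ⟨-, hy'⟩ := hy'
  obtain ⟨d', hd'⟩ := ih (.cup l b c r hbc hx' hy') trivial
  refine ⟨d', ?_⟩
  have e1 : (Step.cup (color s t (n + 1) :: l) b c r hbc hx hy).hom A
      = whisk [color s t (n + 1)] [] ((Step.cup l b c r hbc hx' hy').hom A) (altUp_succ n)
        (by rw [← color_add_two s t (n + 1)]; exact altUp_succ (n + 2)) := by
    rw [whisk_of]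
    simp [Step.whisker]
  rw [e1, ← whisk_comp, hd']
  congr 2
  exact (color_add_two s t (n + 1)).symm

/-- A half diagram followed by a cup is a half diagram. -/
theorem cupHom_comp_cup {m n : ℕ} (d : HalfDiagram m n) :
    ∀ (z : Step (altUp s t n) (altUp s t (n + 2))), z.IsCup →
    ∃ d' : HalfDiagram m (n + 2), cupHom A hst d ≫ z.hom A = cupHom A hst d' := by
  induction d with
  | nil =>
    rintro (⟨_ | ⟨e, l⟩, b, c, r, hbc, hx, hy⟩ | _) hz
    · exact ⟨_, cupHom_comp_cup_nil hst _ b c r hbc hx hy⟩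
    · simp [altUp] at hx
    · exact hz.elim
  | thr d ih =>
    rintro (⟨_ | ⟨e, l⟩, b, c, r, hbc, hx, hy⟩ | _) hz
    · exact ⟨_, cupHom_comp_cup_nil hst _ b c r hbc hx hy⟩
    · obtain ⟨d', hd'⟩ := cupHom_comp_cup_cons hst d ih e l b c r hbc hx hy
      exact ⟨.thr d', hd'⟩
    · exact hz.elim
  | arc d ih =>
    rintro (⟨_ | ⟨e, l⟩, b, c, r, hbc, hx, hy⟩ | _) hz
    · exact ⟨_, cupHom_comp_cup_nil hst _ b c r hbc hx hy⟩
    · obtain ⟨d', hd'⟩ := cupHom_comp_cup_cons hst d ih e l b c r hbc hx hy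
      refine ⟨.arc d', ?_⟩
      simp only [cupHom]
      rw [Category.assoc, hd']
    · exact hz.elim

/-- The identity diagram. -/
def HalfDiagram.one : ∀ n, HalfDiagram n n
  | 0 => .nil
  | n + 1 => .thr (one n)

theorem cupHom_one (n : ℕ) : cupHom A hst (.one n) = 𝟙 _ := by
  induction n with
  | zero => rfl
  | succ n ih => simp only [HalfDiagram.one, cupHom, ih, whisk_id]

theorem CupWord.eq_cupHom {x z : List S} {f : (⟨x⟩ : STL A) ⟶ ⟨z⟩} (hf : CupWord f) :
    ∀ n (hz : z = altUp s t n), ∃ (m : ℕ) (hx : x = altUp s t m) (d : HalfDiagram m n),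
      f = eqToHom (congrArg STL.mk hx) ≫ cupHom A hst d ≫ eqToHom (congrArg STL.mk hz.symm) := by
  induction hf with
  | id =>
    rintro n rfl
    exact ⟨n, rfl, .one n, by simp [cupHom_one]⟩
  | @snoc y z f hf u hu ih =>
    rintro n rfl
    cases u with
    | cap => exact hu.elim
    | cup l b c r hbc hx hy =>
      obtain ⟨n, rfl, h⟩ := altUp_split s t hy
      rw [h] at hx
      obtain ⟨m, rfl, d, hd⟩ := ih n hx
      subst hx
      obtain ⟨d', hd'⟩ := cupHom_comp_cup (A := A) hst d (.cup l b c r hbc h.symm hy) trivial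
      exact ⟨m, rfl, d', by simp [hd, ← hd']⟩

theorem CapWord.flip {x y : List S} {f : (⟨x⟩ : STL A) ⟶ ⟨y⟩} (hf : CapWord f) :
    CupWord (ColoredTL.flip f) := by
  induction hf with
  | id x => exact .id x
  | cons u hu _ ih =>
    rw [flip_comp, flip_step]
    refine .snoc ih _ ?_
    cases u with
    | cup => exact hu.elim
    | cap => trivial

variable (A) in
/-- The diagram with two given halves. -/
def diagram {m n : ℕ} (D : Σ j, HalfDiagram j m × HalfDiagram j n) :
    (⟨altUp s t m⟩ : STL A) ⟶ ⟨altUp s t n⟩ :=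
  flip (cupHom A hst D.2.1) ≫ cupHom A hst D.2.2

/-- The cup part of a normal form is a half diagram, and so is the reflection of its cap part. -/
theorem mem_span_diagram {m n : ℕ} (f : (⟨altUp s t m⟩ : STL A) ⟶ ⟨altUp s t n⟩) :
    f ∈ Submodule.span k (Set.range (diagram A hst (m := m) (n := n))) := by
  refine Submodule.span_mono ?_ (mem_span_normalForms f)
  rintro _ ⟨y, g, h, hg, hh, rfl⟩
  obtain ⟨j, rfl, d, rfl⟩ := hh.eq_cupHom hst n rfl
  obtain ⟨i, hi, d', hd'⟩ := hg.flip.eq_cupHom hst m rfl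
  obtain rfl : j = i := by simpa using congrArg List.length hi
  refine ⟨⟨j, d', d⟩, ?_⟩
  have hg' : g = ColoredTL.flip (cupHom A hst d') := by
    rw [← flip_flip g, hd']
    simp
  simp [diagram, hg']

end HalfDiagrams

/-! ### Diagrams and identity coefficients under change of scalars. -/

section BaseChangeDiagrams

variable {S : Type u} {R : Type*} {k : Type*} [CommRing R] [CommRing k] {B : Matrix S S R}
  {A : Matrix S S k} (φ : R →+* k) (hA : ∀ b c, A b c = φ (B b c))

theorem baseChange_whisk (p q : List S) {x y X Y : List S} (hX : X = p ++ x ++ q)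
    (hY : Y = p ++ y ++ q) (f : (⟨x⟩ : STL B) ⟶ ⟨y⟩) :
    baseChange φ hA (whisk p q f hX hY) = whisk p q (baseChange φ hA f) hX hY := by
  refine hom_induction (P := fun x y f => ∀ (X Y : List S) (hX : X = p ++ x ++ q)
    (hY : Y = p ++ y ++ q), baseChange φ hA (whisk p q f hX hY)
      = whisk p q (baseChange φ hA f) hX hY) ?_ ?_ ?_ ?_ ?_ ?_ f X Y hX hY
  · intro x y u X Y hX hY
    rw [whisk_of, baseChange_step, baseChange_step, whisk_of]
  · intro x X Y hX hY
    subst hX hY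
    rw [whisk_id, baseChange_id, baseChange_id, whisk_id]
  · intro x y z f g hf hg X Y hX hY
    rw [whisk_comp p q hX rfl hY, baseChange_comp, hf, hg, baseChange_comp,
      whisk_comp p q hX rfl hY]
  · intro x y X Y hX hY
    rw [whisk_zero, baseChange_zero, baseChange_zero, whisk_zero]
  · intro x y f g hf hg X Y hX hY
    rw [whisk_add, baseChange_add, hf, hg, baseChange_add, whisk_add]
  · intro x y a f hf X Y hX hY
    rw [whisk_smul, baseChange_smul, hf, baseChange_smul, whisk_smul]

theorem baseChange_flip {x y : List S} (f : (⟨x⟩ : STL B) ⟶ ⟨y⟩) :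
    baseChange φ hA (flip f) = flip (baseChange φ hA f) := by
  refine hom_induction (P := fun x y f => baseChange φ hA (flip f) = flip (baseChange φ hA f))
    ?_ ?_ ?_ ?_ ?_ ?_ f
  · intro x y u
    rfl
  · intro x
    rfl
  · intro x y z f g hf hg
    rw [flip_comp, baseChange_comp, hf, hg, baseChange_comp, flip_comp]
  · intro x y
    rfl
  · intro x y f g hf hg
    rw [flip_add, baseChange_add, hf, hg, baseChange_add, flip_add]
  · intro x y a f hf
    rw [flip_smul, baseChange_smul, hf, baseChange_smul, flip_smul]

variable {s t : S} (hst : s ≠ t)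

theorem baseChange_cupHom {m n : ℕ} (d : HalfDiagram m n) :
    baseChange φ hA (cupHom B hst d) = cupHom A hst d := by
  induction d with
  | nil => rfl
  | thr d ih => simp only [cupHom, baseChange_whisk, ih]
  | arc d ih => simp only [cupHom, baseChange_comp, baseChange_whisk, baseChange_step, ih]

theorem baseChange_diagram {m n : ℕ} (D : Σ j, HalfDiagram j m × HalfDiagram j n) :
    baseChange φ hA (diagram B hst D) = diagram A hst D := by
  simp only [diagram, baseChange_comp, baseChange_flip, baseChange_cupHom]

theorem baseChange_mem_lowerIdeal {x : List S} {f : (⟨x⟩ : STL B) ⟶ ⟨x⟩}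
    (hf : f ∈ lowerIdeal B x) : baseChange φ hA f ∈ lowerIdeal A x := by
  induction hf using Submodule.span_induction with
  | mem f hf =>
    obtain ⟨y, g, h, hy, rfl⟩ := hf
    exact Submodule.subset_span ⟨y, _, _, hy, baseChange_comp φ hA g h⟩
  | zero => exact Submodule.zero_mem _
  | add f g _ _ h1 h2 => rw [baseChange_add]; exact Submodule.add_mem _ h1 h2
  | smul a f _ h1 => rw [baseChange_smul]; exact Submodule.smul_mem _ _ h1

theorem HasIdentityCoeff.baseChange {x : List S} {f : (⟨x⟩ : STL B) ⟶ ⟨x⟩} {a : R}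
    (hf : HasIdentityCoeff B x f a) :
    HasIdentityCoeff A x (ColoredTL.baseChange φ hA f) (φ a) := by
  have h := baseChange_mem_lowerIdeal φ hA hf
  have e : f = (f - a • 𝟙 _) + a • 𝟙 _ := by abel
  rw [HasIdentityCoeff, e, baseChange_add, baseChange_smul, baseChange_id, add_sub_cancel_right]
  exact h

theorem baseChange_mem_perp {x : List S} {f : (⟨x⟩ : STL B) ⟶ ⟨x⟩} (hf : f ∈ perp B x) :
    baseChange φ hA f ∈ perp A x := by
  intro l b c r hbc hx
  have h := congrArg (ColoredTL.baseChange φ hA) (hf l b c r hbc hx)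
  rwa [baseChange_comp, baseChange_zero] at h

end BaseChangeDiagrams

/-! ### Existence of identity coefficients. -/

section IdentityCoeff

variable {S : Type u} {k : Type v} [CommRing k] {A : Matrix S S k}

theorem CupWord.length_le {x y : List S} {f : (⟨x⟩ : STL A) ⟶ ⟨y⟩} (hf : CupWord f) :
    x.length ≤ y.length := by
  induction hf with
  | id => exact le_rfl
  | snoc _ s hs ih =>
    cases s with
    | cap => exact hs.elim
    | cup l b c r hbc hx hy =>
      simp only [hx, hy, List.length_append, List.length_cons] at ih ⊢
      omega

/-- A normal form that does not pass through a shorter sequence contains no cap, hence for reasons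
of length no cup, and is the identity. -/
theorem exists_hasIdentityCoeff {x : List S} (f : (⟨x⟩ : STL A) ⟶ ⟨x⟩) :
    ∃ a, HasIdentityCoeff A x f a := by
  have hf := mem_span_normalForms f
  induction hf using Submodule.span_induction with
  | mem f hf =>
    obtain ⟨y, g, h, hg, hh, rfl⟩ := hf
    by_cases hy : y.length < x.length
    · exact ⟨0, by
        rw [HasIdentityCoeff, zero_smul, sub_zero]
        exact Submodule.subset_span ⟨y, g, h, hy, rfl⟩⟩
    · have h1 : ∃ e : x = y, g = eqToHom (congrArg STL.mk e) := by
        cases hg with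
        | id => exact ⟨rfl, rfl⟩
        | cons u hu hg =>
          have := hg.length_le
          cases u with
          | cup => exact hu.elim
          | cap l b c r hbc hx hz =>
            simp only [hx, hz, List.length_append, List.length_cons] at this hy
            omega
      obtain ⟨rfl, rfl⟩ := h1
      refine ⟨1, ?_⟩
      cases hh with
      | id => simp [HasIdentityCoeff]
      | snoc hh u hu =>
        have := hh.length_le
        cases u with
        | cap => exact hu.elim
        | cup l b c r hbc hx hz =>
          replace hx := congrArg List.length hx
          replace hz := congrArg List.length hz
          simp only [List.length_append, List.length_cons] at hx hz
          omega
  | zero => exact ⟨0, by simp [HasIdentityCoeff]⟩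
  | add f g _ _ h1 h2 =>
    obtain ⟨a, ha⟩ := h1
    obtain ⟨b, hb⟩ := h2
    refine ⟨a + b, ?_⟩
    have := Submodule.add_mem _ ha hb
    rwa [show f - a • 𝟙 _ + (g - b • 𝟙 _) = f + g - (a + b) • 𝟙 _ by
      rw [add_smul]; abel] at this
  | smul a f _ h1 =>
    obtain ⟨b, hb⟩ := h1
    refine ⟨a * b, ?_⟩
    have := Submodule.smul_mem _ a hb
    rwa [smul_sub, smul_smul] at this

end IdentityCoeff

end ColoredTL

namespace ColoredTL

open CategoryTheory

/-! ### Matrices of diagrams -/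

section Entries

variable {L : Type*} [Field L]

/-- The matrix of a half diagram in a path representation, where an arc with `m` through strands
on its right has weight `α m h` if it is a peak and `β m h` if it is a valley. -/
def HalfDiagram.entry (α β : ℕ → ℤ → L) :
    ∀ {m n : ℕ}, HalfDiagram m n → ℤ → List Bool → List Bool → L
  | _, _, .nil, _, _, _ => 1
  | _, _, .thr d, h, μ, τ =>
    match μ, τ with
    | ε :: μ, ε' :: τ => if ε = ε' then d.entry α β (h + sgn ε) μ τ else 0
    | _, _ => 0
  | m, _, .arc d, h, μ, τ =>
    match τ with
    | ε :: τ => (if ε then α m h else β m h) * d.entry α β (h + sgn ε) ((!ε) :: μ) τ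
    | [] => 0

/-- The path that goes up at the left ends of arcs, and down otherwise. -/
def HalfDiagram.lead : ∀ {m n : ℕ}, HalfDiagram m n → List Bool
  | _, _, .nil => []
  | _, _, .thr d => false :: d.lead
  | _, _, .arc d => true :: d.lead

/-- The sum of the heights of the end points of the final segments of a path. -/
def pathWeight : List Bool → ℤ
  | [] => 0
  | ε :: σ => pathWeight σ - height (ε :: σ)

variable {m n : ℕ}

theorem HalfDiagram.length_lead (d : HalfDiagram m n) : d.lead.length = n := by
  induction d <;> simp_all [lead]

theorem HalfDiagram.height_lead (d : HalfDiagram m n) : height d.lead = -m := by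
  induction d with
  | nil => simp [lead]
  | thr d ih => simp [lead, ih, sgn]
  | arc d ih => simp [lead, ih, sgn]

/-- The leading path records which constructor was used at each point, and so determines the
diagram. -/
theorem HalfDiagram.lead_injective (d : HalfDiagram m n) : ∀ {m' : ℕ} (d' : HalfDiagram m' n),
    d.lead = d'.lead → (⟨m, d⟩ : Σ m, HalfDiagram m n) = ⟨m', d'⟩ := by
  induction d with
  | nil => rintro _ ⟨⟩ _; rfl
  | thr d ih =>
    rintro _ (_ | d' | d') h
    · simp only [lead, List.cons.injEq, true_and] at h
      cases ih d' h
      rfl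
    · simp [lead] at h
  | arc d ih =>
    rintro _ (_ | d' | d') h
    · simp [lead] at h
    · simp only [lead, List.cons.injEq, true_and] at h
      cases ih d' h
      rfl

theorem neg_height_le (σ : List Bool) : -height σ ≤ σ.length := by
  induction σ with
  | nil => simp
  | cons ε σ ih => cases ε <;> simp [sgn] <;> omega

variable (α β : ℕ → ℤ → L)

/-- A final segment of `τ` belongs to a smaller half diagram and has the height of its lower path,
which is at least minus the number of its through strands. The leading path attains this bound for
every final segment, which happens only if all through strands go down. -/
theorem HalfDiagram.entry_ne_zero (d : HalfDiagram m n) : ∀ (h : ℤ) (μ τ : List Bool),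
    μ.length = m → τ.length = n → d.entry α β h μ τ ≠ 0 →
    height τ = height μ ∧ pathWeight τ ≤ pathWeight d.lead ∧
      (pathWeight τ = pathWeight d.lead → τ = d.lead ∧ μ = List.replicate m false) := by
  induction d with
  | nil =>
    intro h μ τ hμ hτ _
    simp only [List.length_eq_zero_iff] at hμ hτ
    simp [hμ, hτ, lead]
  | @thr m n d ih =>
    rintro h (_ | ⟨ε, μ⟩) (_ | ⟨ε', τ⟩) hμ hτ hne
    · simp at hμ
    · simp at hμ
    · simp at hτ
    · simp only [entry, ne_eq, ite_eq_right_iff, Classical.not_imp] at hne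
      obtain ⟨rfl, hne⟩ := hne
      simp only [List.length_cons, Nat.add_right_cancel_iff] at hμ hτ
      obtain ⟨h1, h2, h3⟩ := ih _ μ τ hμ hτ hne
      have h4 := neg_height_le (ε :: μ)
      have h5 := d.height_lead
      simp only [lead, pathWeight, height_cons, List.length_cons, hμ, h1, h5, sgn] at h4 ⊢
      push_cast at h4
      refine ⟨trivial, by omega, fun h6 => ?_⟩
      obtain ⟨rfl, rfl⟩ := h3 (by omega)
      cases ε
      · exact ⟨rfl, rfl⟩
      · simp only at h6
        omega
  | @arc m n d ih =>
    rintro h μ (_ | ⟨ε, τ⟩) hμ hτ hne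
    · simp at hτ
    · simp only [entry] at hne
      obtain ⟨h1, h2, h3⟩ := ih _ _ τ (by simp [hμ]) (by simpa using hτ) (right_ne_zero_of_mul hne)
      have h4 := neg_height_le μ
      have h5 := d.height_lead
      have h6 : height (ε :: τ) = height μ := by
        rw [height_cons, h1, height_cons]
        cases ε <;> simp [sgn]
      refine ⟨h6, ?_, fun h7 => ?_⟩
      · simp only [lead, pathWeight, h6]
        simp only [height_cons, h5, sgn]
        omega
      · simp only [lead, pathWeight, h6] at h7
        simp only [height_cons, h5, sgn] at h7
        obtain ⟨rfl, h8⟩ := h3 (by omega)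
        rw [List.replicate_succ, List.cons.injEq] at h8
        obtain ⟨h8, rfl⟩ := h8
        cases ε
        · simp at h8
        · exact ⟨rfl, rfl⟩

theorem HalfDiagram.entry_mem (L₀ : Subring L) (hα : ∀ m h, α m h ∈ L₀) (hβ : ∀ m h, β m h ∈ L₀)
    (d : HalfDiagram m n) : ∀ (h : ℤ) (μ τ : List Bool), d.entry α β h μ τ ∈ L₀ := by
  induction d with
  | nil => exact fun _ _ _ => L₀.one_mem
  | thr d ih =>
    rintro h (_ | ⟨ε, μ⟩) (_ | ⟨ε', τ⟩)
    · exact L₀.zero_mem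
    · exact L₀.zero_mem
    · exact L₀.zero_mem
    · simp only [entry]
      split_ifs
      · exact ih _ _ _
      · exact L₀.zero_mem
  | arc d ih =>
    rintro h μ (_ | ⟨ε, τ⟩)
    · exact L₀.zero_mem
    · refine L₀.mul_mem ?_ (ih _ _ _)
      split_ifs
      · exact hα _ _
      · exact hβ _ _

/-- At the leading path every arc is a peak, so the entry is a product of weights `α`. -/
theorem HalfDiagram.entry_lead (L₀ : Subring L) (hα : ∀ m h, ∃ u ∈ L₀, u * α m h = 1)
    (d : HalfDiagram m n) :
    ∀ h : ℤ, ∃ u ∈ L₀, u * d.entry α β h (List.replicate m false) d.lead = 1 := by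
  induction d with
  | nil => exact fun _ => ⟨1, L₀.one_mem, by simp [entry]⟩
  | thr d ih =>
    intro h
    obtain ⟨u, hu, hu1⟩ := ih (h + sgn false)
    exact ⟨u, hu, by simpa [entry, lead, List.replicate_succ] using hu1⟩
  | @arc m n d ih =>
    intro h
    obtain ⟨u, hu, hu1⟩ := ih (h + sgn true)
    obtain ⟨v, hv, hv1⟩ := hα m h
    refine ⟨u * v, L₀.mul_mem hu hv, ?_⟩
    rw [List.replicate_succ] at hu1
    simp only [entry, lead, if_true, Bool.not_true]
    linear_combination v * α m h * hu1 + hv1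

theorem pathSum_mem (L₀ : Subring L) {F : List Bool → L} :
    ∀ n : ℕ, (∀ σ, F σ ∈ L₀) → pathSum n F ∈ L₀ := by
  intro n
  induction n generalizing F with
  | zero => exact fun h => h _
  | succ n ih => exact fun h => L₀.add_mem (ih fun _ => h _) (ih fun _ => h _)

theorem exists_ne_zero_of_pathSum {F : List Bool → L} {n : ℕ} (h : pathSum n F ≠ 0) :
    ∃ σ, σ.length = n ∧ F σ ≠ 0 := by
  by_contra! h'
  exact h (by rw [pathSum_congr h', pathSum_zero])

/-- Coefficients of a triangular system of equations. -/
theorem coeff_mem_of_triangular {ι : Type*} (L₀ : Subring L) (N : AddSubgroup L)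
    (hN : ∀ a ∈ L₀, ∀ x ∈ N, a * x ∈ N) (c : ι →₀ L) (E : ι → ι → L) (w : ι → ℤ)
    (hE : ∀ i j, E i j ∈ L₀) (hd : ∀ i, ∃ u ∈ L₀, u * E i i = 1)
    (ht : ∀ i j, i ≠ j → E j i ≠ 0 → w i < w j)
    (h : ∀ i, c.sum (fun j a => a * E j i) ∈ N) (i : ι) : c i ∈ N := by
  classical
  by_contra hi
  -- Among the coefficients outside `N` take one of maximal weight. All other terms of the equation
  -- at `j` have larger weight, so their coefficients lie in `N`; dividing by the diagonal entry
  -- gives a contradiction.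
  obtain ⟨j, hj, hmax⟩ := (c.support.filter fun i => c i ∉ N).exists_max_image w
    ⟨i, by simpa [hi] using fun h0 : c i = 0 => hi (by rw [h0]; exact N.zero_mem)⟩
  simp only [Finset.mem_filter, Finsupp.mem_support_iff] at hj hmax
  have hsum := h j
  rw [Finsupp.sum, ← Finset.add_sum_erase _ _ (Finsupp.mem_support_iff.2 hj.1)] at hsum
  have hrest : ∑ i ∈ c.support.erase j, c i * E i j ∈ N := by
    refine N.sum_mem fun i hi => ?_
    simp only [Finset.mem_erase, Finsupp.mem_support_iff] at hi
    by_cases hz : E i j = 0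
    · rw [hz, mul_zero]
      exact N.zero_mem
    · have hlt := ht j i hi.1.symm hz
      rw [mul_comm]
      refine hN _ (hE _ _) _ ?_
      by_contra hc
      exact absurd (hmax i ⟨hi.2, hc⟩) (not_le.2 hlt)
  have h1 : c j * E j j ∈ N := by
    have := N.sub_mem hsum hrest
    rwa [add_sub_cancel_right] at this
  obtain ⟨u, hu, hu1⟩ := hd j
  have h2 := hN u hu _ h1
  rw [show u * (c j * E j j) = c j * (u * E j j) by ring, hu1, mul_one] at h2
  exact hj.2 h2

end Entries

section DiagramOperators

variable {S : Type u} {k : Type*} [CommRing k] {L : Type*} [Field L] {A : Matrix S S k}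
  {φ : k →+* L} (W : PathWeights A φ) {s t : S} (hst : s ≠ t)

/-- The matrix of a diagram made of cups. -/
def cupEntry (s t : S) {m n : ℕ} (d : HalfDiagram m n) : ℤ → List Bool → List Bool → L :=
  d.entry (fun m h => W.r (color s t m) (color s t (m + 1)) h) (fun _ _ => 1)

/-- The matrix of a diagram made of caps. -/
def capEntry (s t : S) {m n : ℕ} (d : HalfDiagram m n) : ℤ → List Bool → List Bool → L :=
  d.entry (fun _ _ => 1) (fun m h => (W.r (color s t (m + 1)) (color s t m) (h - 1))⁻¹)

theorem homOp_cupHom {m n : ℕ} (d : HalfDiagram m n) :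
    ∀ (h : ℤ) (ψ : List Bool → L) (μ : List Bool), μ.length = m →
    homOp W (cupHom A hst d) h ψ μ = pathSum n fun τ => cupEntry W s t d h μ τ * ψ τ := by
  induction d with
  | nil =>
    intro h ψ μ hμ
    rw [List.length_eq_zero_iff] at hμ
    simp [hμ, cupHom, homOp_id, truncOp_apply, pathSum, cupEntry, HalfDiagram.entry]
  | thr d ih =>
    rintro h ψ (_ | ⟨ε, μ⟩) hμ
    · simp at hμ
    · simp only [cupHom]
      rw [homOp_whisk_cons, ih _ _ _ (by simpa using hμ)]
      cases ε <;> simp [pathSum, cupEntry, HalfDiagram.entry, pathSum_zero]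
  | @arc m n d ih =>
    intro h ψ μ hμ
    simp only [cupHom]
    rw [homOp_comp, homOp_step]
    simp only [Pi.mul_apply, Module.End.mul_apply, truncOp_apply]
    rw [if_pos (by simp [hμ])]
    simp only [altCup, Step.op, List.length_nil, shiftOp_zero, cupOp_apply]
    rw [homOp_whisk_cons, homOp_whisk_cons, ih _ _ _ (by simp [hμ]), ih _ _ _ (by simp [hμ])]
    simp [pathSum, cupEntry, HalfDiagram.entry, mul_assoc, pathSum_mul]

theorem homOp_flip_cupHom {m n : ℕ} (d : HalfDiagram m n) :
    ∀ (h : ℤ) (ψ : List Bool → L) (τ : List Bool), τ.length = n →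
    homOp W (flip (cupHom A hst d)) h ψ τ
      = pathSum m fun μ => capEntry W s t d h μ τ * ψ μ := by
  induction d with
  | nil =>
    intro h ψ τ hτ
    rw [List.length_eq_zero_iff] at hτ
    simp [hτ, cupHom, flip_id, homOp_id, truncOp_apply, pathSum, capEntry, HalfDiagram.entry]
  | thr d ih =>
    rintro h ψ (_ | ⟨ε, τ⟩) hτ
    · simp at hτ
    · simp only [cupHom, flip_whisk]
      rw [homOp_whisk_cons, ih _ _ _ (by simpa using hτ)]
      cases ε <;> simp [pathSum, capEntry, HalfDiagram.entry, pathSum_zero]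
  | @arc m n d ih =>
    rintro h ψ (_ | ⟨ε, τ⟩) hτ
    · simp at hτ
    simp only [cupHom, flip_comp, flip_whisk, flip_step]
    rw [homOp_comp, homOp_step]
    simp only [Pi.mul_apply, Module.End.mul_apply]
    rw [homOp_whisk_cons, ih _ _ _ (by simpa using hτ)]
    have hT : ∀ μ : List Bool, μ.length = m + 1 →
        (truncOp L (altUp s t (m + 2)).length h ((altCup hst m).flip.op W h ψ)) (ε :: μ)
          = capOp (W.r (color s t (m + 1)) (color s t m)) h ψ (ε :: μ) := by
      intro μ hμ
      rw [truncOp_apply, if_pos (by simp [hμ])]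
      rfl
    rw [pathSum_congr fun μ hμ => by rw [hT μ hμ]]
    cases ε <;> simp [pathSum, capEntry, HalfDiagram.entry, pathSum_zero, mul_assoc,
      mul_left_comm, pathSum_mul]

/-- The matrix of a diagram. -/
def diagramEntry (s t : S) {m n : ℕ} (D : Σ j, HalfDiagram j m × HalfDiagram j n) (h : ℤ)
    (σ τ : List Bool) : L :=
  pathSum D.1 fun μ => capEntry W s t D.2.1 h μ σ * cupEntry W s t D.2.2 h μ τ

theorem homOp_diagram {m n : ℕ} (D : Σ j, HalfDiagram j m × HalfDiagram j n) (h : ℤ)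
    (σ τ : List Bool) (hσ : σ.length = m) (hτ : τ.length = n) :
    homOp W (diagram A hst D) h (Pi.single τ 1) σ = diagramEntry W s t D h σ τ := by
  rw [diagram, homOp_comp]
  simp only [Pi.mul_apply, Module.End.mul_apply]
  rw [homOp_flip_cupHom W hst _ _ _ _ hσ, diagramEntry]
  refine pathSum_congr fun μ hμ => ?_
  rw [homOp_cupHom W hst _ _ _ _ hμ, pathSum_single _ τ hτ]
  · simp
  · intro τ' _ hne
    rw [Pi.single_eq_of_ne hne, mul_zero]

/-- The paths at which a diagram has its leading entry. -/
def diagramWeight {m n : ℕ} (D : Σ j, HalfDiagram j m × HalfDiagram j n) : ℤ :=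
  pathWeight D.2.1.lead + pathWeight D.2.2.lead

/-- An entry sums over paths in the middle. A non-zero summand bounds the weights of both halves,
and equality in both bounds forces the two diagrams to coincide. -/
theorem diagramEntry_lead_ne_zero {m n : ℕ} {D D' : Σ j, HalfDiagram j m × HalfDiagram j n}
    (hne : D' ≠ D) (h : ℤ) (h0 : diagramEntry W s t D h D'.2.1.lead D'.2.2.lead ≠ 0) :
    diagramWeight D' < diagramWeight D := by
  obtain ⟨μ, hμ, hμ0⟩ := exists_ne_zero_of_pathSum h0
  obtain ⟨-, h1, h2⟩ := D.2.1.entry_ne_zero _ _ h μ _ hμ (HalfDiagram.length_lead _)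
    (left_ne_zero_of_mul hμ0)
  obtain ⟨-, h3, h4⟩ := D.2.2.entry_ne_zero _ _ h μ _ hμ (HalfDiagram.length_lead _)
    (right_ne_zero_of_mul hμ0)
  refine lt_of_le_of_ne (add_le_add h1 h3) fun h5 => hne ?_
  rw [diagramWeight, diagramWeight] at h5
  have h6 := (h2 (by omega)).1
  have h7 := (h4 (by omega)).1
  obtain ⟨j, d₁, d₂⟩ := D
  obtain ⟨j', d₁', d₂'⟩ := D'
  cases HalfDiagram.lead_injective _ _ h6
  cases HalfDiagram.lead_injective _ _ h7
  rfl

theorem diagramEntry_mem (L₀ : Subring L) (hr : ∀ b c h, W.r b c h ∈ L₀ ∧ (W.r b c h)⁻¹ ∈ L₀)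
    {m n : ℕ} (D : Σ j, HalfDiagram j m × HalfDiagram j n) (h : ℤ) (σ τ : List Bool) :
    diagramEntry W s t D h σ τ ∈ L₀ :=
  pathSum_mem L₀ _ fun _ => L₀.mul_mem
    (HalfDiagram.entry_mem _ _ L₀ (fun _ _ => L₀.one_mem) (fun _ _ => (hr _ _ _).2) _ _ _ _)
    (HalfDiagram.entry_mem _ _ L₀ (fun _ _ => (hr _ _ _).1) (fun _ _ => L₀.one_mem) _ _ _ _)

/-- Only the middle path that always goes down contributes, so the entry is a product of two
invertible leading entries. -/
theorem diagramEntry_lead (L₀ : Subring L) (hr : ∀ b c h, W.r b c h ∈ L₀ ∧ (W.r b c h)⁻¹ ∈ L₀)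
    {m n : ℕ} (D : Σ j, HalfDiagram j m × HalfDiagram j n) (h : ℤ) :
    ∃ u ∈ L₀, u * diagramEntry W s t D h D.2.1.lead D.2.2.lead = 1 := by
  obtain ⟨u, hu, hu1⟩ := D.2.1.entry_lead (fun _ _ => (1 : L))
    (fun m h => (W.r (color s t (m + 1)) (color s t m) (h - 1))⁻¹) L₀
    (fun _ _ => ⟨1, L₀.one_mem, one_mul 1⟩) h
  obtain ⟨v, hv, hv1⟩ := D.2.2.entry_lead
    (fun m h => W.r (color s t m) (color s t (m + 1)) h) (fun _ _ => (1 : L)) L₀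
    (fun _ _ => ⟨_, (hr _ _ _).2, inv_mul_cancel₀ (W.ne_zero _ _ _)⟩) h
  refine ⟨u * v, L₀.mul_mem hu hv, ?_⟩
  rw [diagramEntry, pathSum_single _ (List.replicate D.1 false) (by simp)]
  · rw [capEntry, cupEntry, mul_mul_mul_comm, hu1, hv1, one_mul]
  · intro μ hμ hne
    by_contra h0
    exact hne ((D.2.1.entry_ne_zero _ _ h μ _ hμ (HalfDiagram.length_lead _)
      (left_ne_zero_of_mul h0)).2.2 rfl).2

/-- The coefficients of a combination of diagrams lie in `N` if the entries of its matrix do. -/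
theorem diagram_coeff_mem (L₀ : Subring L) (hr : ∀ b c h, W.r b c h ∈ L₀ ∧ (W.r b c h)⁻¹ ∈ L₀)
    (N : AddSubgroup L) (hN : ∀ a ∈ L₀, ∀ x ∈ N, a * x ∈ N) {m n : ℕ}
    (c : (Σ j, HalfDiagram j m × HalfDiagram j n) →₀ k) (h : ℤ)
    (H : ∀ σ τ : List Bool, σ.length = m → τ.length = n →
      homOp W (c.sum fun D a => a • diagram A hst D) h (Pi.single τ 1) σ ∈ N)
    (D : Σ j, HalfDiagram j m × HalfDiagram j n) : φ (c D) ∈ N := by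
  have key : ∀ σ τ : List Bool, σ.length = m → τ.length = n →
      homOp W (c.sum fun D a => a • diagram A hst D) h (Pi.single τ 1) σ
        = c.sum fun D a => φ a * diagramEntry W s t D h σ τ := by
    intro σ τ hσ hτ
    rw [Finsupp.sum, Finsupp.sum]
    generalize c.support = T
    classical
    induction T using Finset.induction_on with
    | empty => simp [homOp_zero]
    | insert D T hD ih =>
      rw [Finset.sum_insert hD, Finset.sum_insert hD, homOp_add, homOp_smul, ← ih,
        ← homOp_diagram W hst D h σ τ hσ hτ]
      rfl
  have := coeff_mem_of_triangular L₀ N hN (c.mapRange φ (map_zero φ))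
    (fun D D' => diagramEntry W s t D h D'.2.1.lead D'.2.2.lead) diagramWeight
    (fun D D' => diagramEntry_mem W L₀ hr D h _ _) (fun D => diagramEntry_lead W L₀ hr D h)
    (fun D D' hne h0 => diagramEntry_lead_ne_zero W hne h h0)
    (fun D => by
      rw [Finsupp.sum_mapRange_index (by simp), ← key _ _ (HalfDiagram.length_lead _)
        (HalfDiagram.length_lead _)]
      exact H _ _ (HalfDiagram.length_lead _) (HalfDiagram.length_lead _)) D
  simpa using this

end DiagramOperators

end ColoredTL

namespace ColoredTL

open CategoryTheory

/-! ### Recursion for the top idempotents of alternating sequences over a field -/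

section Recursion

variable {S : Type u} {k : Type v} [CommRing k] {A : Matrix S S k}

theorem whisk_mem_lowerIdeal (p q : List S) {x X : List S} (hX hX' : X = p ++ x ++ q)
    {f : (⟨x⟩ : STL A) ⟶ ⟨x⟩} (hf : f ∈ lowerIdeal A x) : whisk p q f hX hX' ∈ lowerIdeal A X := by
  induction hf using Submodule.span_induction with
  | mem f hf =>
    obtain ⟨y, g, h, hy, rfl⟩ := hf
    refine Submodule.subset_span ⟨p ++ y ++ q, whisk p q g hX rfl, whisk p q h rfl hX', ?_, ?_⟩
    · simp only [hX, List.length_append]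
      omega
    · rw [whisk_comp]
  | zero => rw [whisk_zero]; exact Submodule.zero_mem _
  | add f g _ _ h1 h2 => rw [whisk_add]; exact Submodule.add_mem _ h1 h2
  | smul a f _ h1 => rw [whisk_smul]; exact Submodule.smul_mem _ a h1

theorem HasIdentityCoeff.whisk (p q : List S) {x X : List S} (hX hX' : X = p ++ x ++ q)
    {f : (⟨x⟩ : STL A) ⟶ ⟨x⟩} {a : k} (hf : HasIdentityCoeff A x f a) :
    HasIdentityCoeff A X (ColoredTL.whisk p q f hX hX') a := by
  have := whisk_mem_lowerIdeal p q hX hX' hf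
  rwa [whisk_sub, whisk_smul, whisk_id] at this

theorem Step.cup_congr {x y : List S} {l l' : List S} {b b' c c' : S} {r r' : List S}
    (hl : l = l') (hb : b = b') (hc : c = c') (hr : r = r') (hbc hbc' hx hx' hy hy') :
    (Step.cup l b c r hbc hx hy : Step x y) = Step.cup l' b' c' r' hbc' hx' hy' := by
  subst hl hb hc hr
  rfl

theorem mem_perp_iff {x : List S} {f : (⟨x⟩ : STL A) ⟶ ⟨x⟩} :
    f ∈ perp A x ↔ ∀ (y : List S) (z : Step y x), z.IsCup → z.hom A ≫ f = 0 := by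
  constructor
  · rintro hf y (⟨l, b, c, r, hbc, rfl, hx⟩ | _) hz
    · exact hf l b c r hbc hx
    · exact hz.elim
  · intro hf l b c r hbc hx
    exact hf _ (.cup l b c r hbc rfl hx) trivial

variable {s t : S} (hst : s ≠ t)

/-- Add a strand on the left. -/
def addStrand {n : ℕ} (f : (⟨altUp s t n⟩ : STL A) ⟶ ⟨altUp s t n⟩) :
    (⟨altUp s t (n + 1)⟩ : STL A) ⟶ ⟨altUp s t (n + 1)⟩ :=
  whisk [color s t (n + 1)] [] f (altUp_succ n) (altUp_succ n)

theorem addStrand_comp {n : ℕ} (f g : (⟨altUp s t n⟩ : STL A) ⟶ ⟨altUp s t n⟩) :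
    addStrand (f ≫ g) = addStrand f ≫ addStrand g := whisk_comp ..

theorem altCup_comp_addStrand {n : ℕ} (f : (⟨altUp s t n⟩ : STL A) ⟶ ⟨altUp s t n⟩) :
    (altCup hst n).hom A ≫ addStrand (addStrand f) = f ≫ (altCup hst n).hom A :=
  altCup_comp_whisk hst f _ _ _ _

theorem flip_addStrand {n : ℕ} (f : (⟨altUp s t n⟩ : STL A) ⟶ ⟨altUp s t n⟩) :
    flip (addStrand f) = addStrand (flip f) := flip_whisk ..

theorem addStrand_comp_altCap {n : ℕ} (f : (⟨altUp s t n⟩ : STL A) ⟶ ⟨altUp s t n⟩) :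
    addStrand (addStrand f) ≫ (altCup hst n).flip.hom A = (altCup hst n).flip.hom A ≫ f := by
  have := congrArg flip (altCup_comp_addStrand hst (flip f))
  rwa [flip_comp, flip_comp, flip_addStrand, flip_addStrand, flip_flip, flip_step] at this

theorem altCup_comp_altCap (n : ℕ) :
    (altCup hst n).hom A ≫ (altCup hst n).flip.hom A
      = A (color s t n) (color s t (n + 1)) • 𝟙 _ := hom_circle ..

theorem altUp_succ' (n : ℕ) :
    altUp s t (n + 1) = [color s t (n + 3)] ++ altUp s t n ++ [] := by
  rw [color_add_two s t (n + 1)]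
  exact altUp_succ n

theorem altCup_zigzag_left (n : ℕ) :
    (altCup hst (n + 1)).hom A ≫ whisk [color s t (n + 3)] [] ((altCup hst n).flip.hom A)
      (altUp_succ (n + 2)) (altUp_succ' n) = 𝟙 _ := by
  rw [whisk_of]
  have h : altUp s t (n + 1) = [] ++ color s t (n + 1) :: color s t n :: altTail s t n := by
    rw [altUp, altUp_eq]; rfl
  have h' : altUp s t (n + 1 + 2) = [] ++ color s t (n + 1) :: color s t n :: color s t (n + 1)
      :: color s t n :: altTail s t n := by
    rw [altUp, altUp, altUp, altUp_eq, color_add_two s t (n + 1), color_add_two s t n]; rfl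
  have key := hom_zigzag_left (A := A) [] (color s t (n + 1)) (color s t n) (altTail s t n)
    (color_ne hst n).symm (color_ne hst n) h h' h h'
  convert key using 2
  · exact congrArg (Step.hom A)
      (Step.cup_congr rfl rfl (color_add_two s t n) (altUp_eq s t n) _ _ _ _ _ _)
  · simp [altCup, Step.whisker, Step.flip, color_add_two s t (n + 1)]

theorem altCup_zigzag_right (n : ℕ) :
    whisk [color s t (n + 3)] [] ((altCup hst n).hom A)
      (altUp_succ' n) (altUp_succ (n + 2)) ≫
        (altCup hst (n + 1)).flip.hom A = 𝟙 _ := by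
  have := congrArg flip (altCup_zigzag_left (A := A) hst n)
  rw [flip_comp, flip_whisk] at this
  exact this

theorem cup_eq_altCup {n : ℕ} {y r : List S} {b c : S} (hbc : b ≠ c) (hx : y = [] ++ b :: r)
    (hy : altUp s t (n + 2) = [] ++ b :: c :: b :: r) :
    ∃ h : y = altUp s t n, (Step.cup [] b c r hbc hx hy).hom A
      = eqToHom (congrArg STL.mk h) ≫ (altCup hst n).hom A := by
  have h := hy
  rw [altUp, altUp, altUp_eq, List.nil_append] at h
  simp only [List.cons.injEq] at h
  obtain ⟨-, h1, h2, h3⟩ := h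
  obtain rfl : y = altUp s t n := by rw [hx, altUp_eq, h2, h3]; rfl
  refine ⟨rfl, ?_⟩
  rw [eqToHom_refl, Category.id_comp]
  exact congrArg (Step.hom A) (Step.cup_congr rfl h2.symm h1.symm h3.symm _ _ _ _ _ _)

theorem cup_cons_comp_addStrand {n : ℕ} {y l r : List S} {b c e : S} (hbc : b ≠ c)
    (hx : y = e :: l ++ b :: r) (hy : altUp s t (n + 1) = e :: l ++ b :: c :: b :: r)
    {f : (⟨altUp s t n⟩ : STL A) ⟶ ⟨altUp s t n⟩} (hf : f ∈ perp A (altUp s t n)) :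
    (Step.cup (e :: l) b c r hbc hx hy).hom A ≫ addStrand f = 0 := by
  have hy' := hy
  rw [altUp] at hy'
  simp only [List.cons_append, List.cons.injEq] at hy'
  obtain ⟨rfl, hy'⟩ := hy'
  have e1 : (Step.cup (color s t (n + 1) :: l) b c r hbc hx hy).hom A
      = whisk [color s t (n + 1)] [] (cupInto A (altUp s t n) l b c r hbc hy') (by simp [hx])
        (altUp_succ n) := by
    refine Eq.trans ?_ (whisk_of ..).symm
    simp [Step.whisker]
  rw [e1, addStrand, ← whisk_comp, hf, whisk_zero]

/-- This is the partial trace of `F ≫ a ≫ b ≫ F`: the outer copies of `F` slide off as `f`, and the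
remaining arcs straighten. -/
theorem comp_eq_of_zigzag {C : Type*} [Category C] {X Y : C} {f : X ⟶ X} {F G : Y ⟶ Y}
    {p : X ⟶ Y} {q : Y ⟶ X} {a : Y ⟶ X} {b : X ⟶ Y} (hp : p ≫ F = f ≫ p) (hq : F ≫ q = q ≫ f)
    (hpa : p ≫ a = 𝟙 _) (hbq : b ≫ q = 𝟙 _) (hf : f ≫ f = f) (hG : G = F ≫ a ≫ b ≫ F) :
    p ≫ G ≫ q = f := by
  rw [hG]
  simp only [Category.assoc]
  rw [hq, reassoc_of% hbq, reassoc_of% hp, reassoc_of% hpa, hf]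

/-- The construction of top idempotents of alternating sequences: `g` is the top idempotent for
`n` strands, and `f` the one for `n + 1` strands. -/
theorem exists_wenzl {k : Type v} [Field k] {A : Matrix S S k} (q : ℕ → k) (hq0 : q 0 = 0)
    (hq1 : q 1 = 1)
    (hq : ∀ n, q (n + 2) = -A (color s t n) (color s t (n + 1)) * q (n + 1) - q n)
    (hne : ∀ n, q (n + 1) ≠ 0) (n : ℕ) :
    ∃ g ∈ perp A (altUp s t n), HasIdentityCoeff A _ g 1 ∧
      ∃ f ∈ perp A (altUp s t (n + 1)), HasIdentityCoeff A _ f 1 ∧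
        (altCup hst n).hom A ≫ addStrand f ≫ (altCup hst n).flip.hom A
          = (-q (n + 2) * (q (n + 1))⁻¹) • g := by
  induction n with
  | zero =>
    refine ⟨𝟙 _, ?_, by simp [HasIdentityCoeff], 𝟙 _, ?_, by simp [HasIdentityCoeff], ?_⟩
    · intro l b c r _ hx
      have := congrArg List.length hx
      simp [altUp] at this
      omega
    · intro l b c r _ hx
      have := congrArg List.length hx
      simp [altUp] at this
      omega
    · rw [addStrand, whisk_id, Category.id_comp, altCup_comp_altCap, hq, hq0, hq1]
      simp
  | succ n ih =>
    obtain ⟨g, hg, hg1, f, hf, hf1, hgf⟩ := ih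
    -- Adding a strand to `g` keeps its identity coefficient 1, and its lower terms are killed by
    -- `f`.
    have hgf' : addStrand g ≫ f = f := by
      have := comp_perp_of_coeff (hg1.whisk [color s t (n + 1)] [] (altUp_succ n) (altUp_succ n)) hf
      rwa [_root_.one_smul] at this
    have hff : f ≫ f = f := by
      rw [comp_perp_of_coeff hf1 hf, _root_.one_smul]
    have hcup : g ≫ (altCup hst n).hom A ≫ addStrand f = (altCup hst n).hom A ≫ addStrand f := by
      rw [← Category.assoc, ← altCup_comp_addStrand, Category.assoc, ← addStrand_comp, hgf']
    have h1 := hne n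
    have h2 := hne (n + 1)
    -- Wenzl's formula: the coefficient is minus the inverse of the partial trace factor in the
    -- induction hypothesis, so that the leftmost cup is killed.
    refine ⟨f, hf, hf1, addStrand f + (q (n + 1) * (q (n + 2))⁻¹) •
      (addStrand f ≫ (altCup hst n).flip.hom A ≫ (altCup hst n).hom A ≫ addStrand f), ?_, ?_, ?_⟩
    · rw [mem_perp_iff]
      rintro y (⟨_ | ⟨e, l⟩, b, c, r, hbc, hx, hy⟩ | _) hz
      · obtain ⟨rfl, e1⟩ := cup_eq_altCup (A := A) hst hbc hx hy
        rw [e1, eqToHom_refl, Category.id_comp, Preadditive.comp_add, Linear.comp_smul]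
        -- The first cup and cap form the partial trace of `f`, a multiple of `g`; this `g` is
        -- absorbed by `hcup`.
        have e2 : (altCup hst n).hom A ≫ addStrand f ≫ (altCup hst n).flip.hom A ≫
            (altCup hst n).hom A ≫ addStrand f
            = (-q (n + 2) * (q (n + 1))⁻¹) • ((altCup hst n).hom A ≫ addStrand f) := by
          rw [← hcup, ← Linear.smul_comp, ← hgf]
          simp only [Category.assoc]
          rw [hcup]
        rw [e2, smul_smul, show q (n + 1) * (q (n + 2))⁻¹ * (-q (n + 2) * (q (n + 1))⁻¹) = -1 by
          field_simp, neg_one_smul, add_neg_cancel]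
      · have e1 := cup_cons_comp_addStrand hbc hx hy hf
        rw [Preadditive.comp_add, Linear.comp_smul, ← Category.assoc, e1, Limits.zero_comp,
          smul_zero, add_zero]
      · exact hz.elim
    · have e1 := hf1.whisk [color s t (n + 2)] [] (altUp_succ (n + 1)) (altUp_succ (n + 1))
      have e2 : (q (n + 1) * (q (n + 2))⁻¹) • (addStrand f ≫ (altCup hst n).flip.hom A ≫
          (altCup hst n).hom A ≫ addStrand f) ∈ lowerIdeal A (altUp s t (n + 2)) :=
        Submodule.smul_mem _ _ (Submodule.subset_span ⟨altUp s t n, addStrand f ≫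
          (altCup hst n).flip.hom A, (altCup hst n).hom A ≫ addStrand f, by simp, by simp⟩)
      have := Submodule.add_mem _ e1 e2
      rwa [sub_add_eq_add_sub] at this
    · have e1 : (altCup hst (n + 1)).hom A ≫ addStrand (addStrand f) ≫
          (altCup hst (n + 1)).flip.hom A
          = A (color s t (n + 1)) (color s t (n + 2)) • f := by
        rw [addStrand_comp_altCap, ← Category.assoc, altCup_comp_altCap, Linear.smul_comp,
          Category.id_comp]
      -- In the correction term the traced strand straightens to `f ≫ f`, so the partial trace
      -- factor is the circle scalar plus `q (n + 1) / q (n + 2)`.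
      have e2 : (altCup hst (n + 1)).hom A ≫ addStrand (addStrand f ≫ (altCup hst n).flip.hom A ≫
          (altCup hst n).hom A ≫ addStrand f) ≫ (altCup hst (n + 1)).flip.hom A = f := by
        have e3 : addStrand (addStrand f ≫ (altCup hst n).flip.hom A ≫
            (altCup hst n).hom A ≫ addStrand f) = addStrand (addStrand f) ≫
            whisk [color s t (n + 3)] [] ((altCup hst n).flip.hom A) (altUp_succ (n + 2))
              (altUp_succ' n) ≫
            whisk [color s t (n + 3)] [] ((altCup hst n).hom A)
              (altUp_succ' n) (altUp_succ (n + 2)) ≫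
            addStrand (addStrand f) := by
          rw [addStrand, whisk_comp _ _ _ (altUp_succ (n + 2)), whisk_comp _ _ _ (altUp_succ' n),
            whisk_comp _ _ _ (altUp_succ (n + 2))]
          rfl
        exact comp_eq_of_zigzag (altCup_comp_addStrand hst f) (addStrand_comp_altCap hst f)
          (altCup_zigzag_left hst n) (altCup_zigzag_right hst n) hff e3
      have e4 : addStrand (addStrand f + (q (n + 1) * (q (n + 2))⁻¹) • (addStrand f ≫
          (altCup hst n).flip.hom A ≫ (altCup hst n).hom A ≫ addStrand f))
          = addStrand (addStrand f) + (q (n + 1) * (q (n + 2))⁻¹) • addStrand (addStrand f ≫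
          (altCup hst n).flip.hom A ≫ (altCup hst n).hom A ≫ addStrand f) := by
        simp only [addStrand, whisk_add, whisk_smul]
      rw [e4, Preadditive.add_comp, Preadditive.comp_add, e1, Linear.smul_comp, Linear.comp_smul,
        e2, ← add_smul, hq (n + 1)]
      congr 1
      field_simp
      ring

end Recursion

end ColoredTL

namespace ColoredTL

open CategoryTheory

/-! ### Integrality -/

section Integrality

open Polynomial

variable {R : Type v} [CommRing R]

/-- Polynomials that are prime to all constants. -/
def primitiveMonoid (R : Type v) [CommRing R] : Submonoid R[X] where
  carrier := {h | ∀ (d : R) (e : R[X]), C d ∣ e * h → C d ∣ e}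
  one_mem' := by simp
  mul_mem' := by
    intro h h' H H' d e hd
    exact H d e (H' d _ (by rwa [mul_assoc]))

theorem ne_zero_of_mem_primitiveMonoid [Nontrivial R] {h : R[X]} (hh : h ∈ primitiveMonoid R) : h ≠ 0 := by
  rintro rfl
  simpa using hh 0 1 (by simp)

/-- Modulo any `d` the coefficients still generate the unit ideal, so by McCoy's theorem the
polynomial is not a zero divisor there. No factoriality of `R` is used. -/
theorem linear_mem_primitiveMonoid {a b : R} (hab : IsCoprime a b) :
    C a + C b * X ∈ primitiveMonoid R := by
  intro d e hd
  have hmem : map (Ideal.Quotient.mk (Ideal.span {d})) (C a + C b * X)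
      ∈ nonZeroDivisors (R ⧸ Ideal.span {d})[X] := by
    rw [Polynomial.mem_nonZeroDivisors_iff]
    intro r hr
    have h0 := congrArg (coeff · 0) hr
    have h1 := congrArg (coeff · 1) hr
    simp at h0 h1
    obtain ⟨u, v, huv⟩ := hab
    have := congrArg (Ideal.Quotient.mk (Ideal.span {d})) huv
    simp only [map_add, map_mul, map_one] at this
    linear_combination -r * this + Ideal.Quotient.mk _ u * h0 + Ideal.Quotient.mk _ v * h1
  have hdvd : ∀ p : R[X], C d ∣ p ↔ map (Ideal.Quotient.mk (Ideal.span {d})) p = 0 := by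
    intro p
    rw [C_dvd_iff_dvd_coeff, Polynomial.ext_iff]
    simp [Ideal.Quotient.eq_zero_iff_mem, Ideal.mem_span_singleton]
  rw [hdvd] at hd ⊢
  rw [Polynomial.map_mul] at hd
  exact (mul_right_mem_nonZeroDivisors_eq_zero_iff hmem).1 hd

variable [IsDomain R]

/-- Polynomials as rational functions over the fraction field. -/
noncomputable def polyToFrac (R : Type v) [CommRing R] [IsDomain R] :
    R[X] →+* FractionRing (FractionRing R)[X] :=
  (algebraMap _ _).comp (mapRingHom (algebraMap R (FractionRing R)))

theorem polyToFrac_injective : Function.Injective (polyToFrac R) :=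
  (IsFractionRing.injective (FractionRing R)[X] _).comp
    (map_injective _ (IsFractionRing.injective R (FractionRing R)))

/-- Constants as rational functions. -/
noncomputable def constToFrac (R : Type v) [CommRing R] [IsDomain R] :
    FractionRing R →+* FractionRing (FractionRing R)[X] :=
  (algebraMap _ _).comp C

theorem constToFrac_algebraMap (a : R) :
    constToFrac R (algebraMap R _ a) = polyToFrac R (C a) := by
  simp [constToFrac, polyToFrac]

/-- Fractions with primitive denominators. -/
noncomputable def integralFractions (R : Type v) [CommRing R] [IsDomain R] :
    Subring (FractionRing (FractionRing R)[X]) where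
  carrier := {x | ∃ h ∈ primitiveMonoid R, ∃ e, x * polyToFrac R h = polyToFrac R e}
  one_mem' := ⟨1, Submonoid.one_mem _, 1, by simp⟩
  zero_mem' := ⟨1, Submonoid.one_mem _, 0, by simp⟩
  neg_mem' := by
    rintro x ⟨h, hh, e, he⟩
    exact ⟨h, hh, -e, by rw [neg_mul, he, map_neg]⟩
  mul_mem' := by
    rintro x y ⟨h, hh, e, he⟩ ⟨h', hh', e', he'⟩
    exact ⟨h * h', Submonoid.mul_mem _ hh hh', e * e', by
      rw [map_mul, map_mul, ← he, ← he']; ring⟩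
  add_mem' := by
    rintro x y ⟨h, hh, e, he⟩ ⟨h', hh', e', he'⟩
    exact ⟨h * h', Submonoid.mul_mem _ hh hh', e * h' + e' * h, by
      rw [map_mul, map_add, map_mul, map_mul, ← he, ← he']; ring⟩

theorem polyToFrac_mem (e : R[X]) : polyToFrac R e ∈ integralFractions R :=
  ⟨1, Submonoid.one_mem _, e, by simp⟩

theorem inv_polyToFrac_mem {h : R[X]} (hh : h ∈ primitiveMonoid R) :
    (polyToFrac R h)⁻¹ ∈ integralFractions R :=
  ⟨h, hh, 1, by
    rw [map_one, inv_mul_cancel₀]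
    rw [Ne, map_eq_zero_iff _ polyToFrac_injective]
    exact ne_zero_of_mem_primitiveMonoid hh⟩

/-- If `a / d` has a primitive denominator `h`, then `d` divides `a * h`, hence `a`. Integrality can
thus be tested in the larger ring of fractions. -/
theorem exists_of_constToFrac_mem {x : FractionRing R}
    (hx : constToFrac R x ∈ integralFractions R) : ∃ a, algebraMap R _ a = x := by
  obtain ⟨h, hh, e, he⟩ := hx
  obtain ⟨a, d, hd, rfl⟩ := IsFractionRing.div_surjective (A := R) x
  have hd0 : algebraMap R (FractionRing R) d ≠ 0 := by
    rw [Ne, map_eq_zero_iff _ (IsFractionRing.injective R _)]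
    exact nonZeroDivisors.ne_zero hd
  have h1 : polyToFrac R (C a * h) = polyToFrac R (C d * e) := by
    rw [map_mul, map_mul, ← he, ← constToFrac_algebraMap, ← constToFrac_algebraMap, ← mul_assoc,
      ← map_mul, mul_div_cancel₀ _ hd0]
  have h2 : C d ∣ C a := hh d (C a) ⟨e, polyToFrac_injective h1⟩
  obtain ⟨b, rfl⟩ := by simpa using (C_dvd_iff_dvd_coeff _ _).1 h2 0
  exact ⟨b, by rw [map_mul]; field_simp⟩

end Integrality

section BoxMem

variable {L : Type*} [Field L]

theorem boxWeight_mem (L₀ : Subring L) (g : ℤ → L) (hg : ∀ h, g h ∈ L₀) (σ : List Bool) :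
    ∀ (p m : ℕ) (h : ℤ), boxWeight g p m h σ ∈ L₀ := by
  induction σ with
  | nil =>
    intro p m h
    simp only [boxWeight]
    split_ifs
    · exact L₀.one_mem
    · exact L₀.zero_mem
  | cons ε σ ih =>
    intro p m h
    cases ε
    · cases m with
      | zero => simp
      | succ m =>
        rw [boxWeight_succ_false]
        exact L₀.mul_mem (L₀.prod_mem fun _ _ => hg _) (ih _ _ _)
    · cases p with
      | zero => simp
      | succ p =>
        rw [boxWeight_succ_true]
        exact ih _ _ _

end BoxMem

/-! ### Existence for alternating sequences by clearing denominators and specialising. -/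

section GenericExistence

open Polynomial

variable {S : Type u}

theorem isolatedAlt_altUp {s t : S} (hst : s ≠ t) (n : ℕ) :
    IsolatedAlt (altUp s t n) (color s t n) (color s t (n + 1)) 0 0 n where
  ne := color_ne hst n
  split := ⟨[], [], rfl, rfl, by simp [altFrom_eq_altUp]⟩
  cap l d e r h := by
    have := congrArg List.length h
    simp at this
    omega

/-- The functional that kills caps multiplies by the identity coefficient; it is evaluated at a
function where it is non-zero. -/
theorem hasIdentityCoeff_unique {k : Type*} [CommRing k] {L : Type*} [Field L] {A : Matrix S S k}
    {φ : k →+* L} (W : PathWeights A φ) {s t : S} (hst : s ≠ t) {n : ℕ}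
    {f : (⟨altUp s t n⟩ : STL A) ⟶ ⟨altUp s t n⟩} {a a' : k} (ha : HasIdentityCoeff A _ f a)
    (ha' : HasIdentityCoeff A _ f a') : φ a = φ a' := by
  have I := isolatedAlt_altUp hst n
  have hl : (List.replicate n true).length = n := by simp
  have h1 := capFunctional_of_coeff (W := W) I n 0 ha
    (Pi.single (extendPath 0 0 (List.replicate n true)) 1)
  rw [capFunctional_of_coeff I n 0 ha', capFunctional_single _ _ _ _ _ _ _ _ hl] at h1
  have h2 := boxWeight_ne_zero (W.capFactor (color s t n) (color s t (n + 1)))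
    (fun h => neg_ne_zero.2 (W.alt_ne_zero _ _ _)) (List.replicate n true) 0
  simp only [List.count_replicate_self, List.count_replicate, Bool.true_beq] at h2
  exact (mul_right_cancel₀ h2 h1).symm

/-- The matrix of the top idempotent has denominators bounded by quantum binomials. -/
theorem binom_mul_homOp_mem {k : Type v} [CommRing k] {L : Type*} [Field L] {A : Matrix S S k}
    {φ : k →+* L} (N : S → S → ℤ → L)
    (H : ∀ b c, QuantumSequence (twoPeriodic (φ (-A b c)) (φ (-A c b))) (N b c))
    (L₀ : Subring L) (hN : ∀ b c h, N b c h ∈ L₀ ∧ (N b c h)⁻¹ ∈ L₀) {s t : S} (hst : s ≠ t) {n : ℕ}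
    {f : (⟨altUp s t n⟩ : STL A) ⟶ ⟨altUp s t n⟩} (hf : f ∈ perp A _)
    (hf1 : HasIdentityCoeff A _ f 1) (σ τ : List Bool) (hσ : σ.length = n) (hτ : τ.length = n) :
    φ (qbinom₂ (-A (color s t n) (color s t (n + 1))) (-A (color s t (n + 1)) (color s t n)) n
        (σ.count false)) *
      homOp (PathWeights.ofSequences N H) f 0 (Pi.single τ 1) σ ∈ L₀ := by
  set b := color s t n
  set c := color s t (n + 1)
  set W := PathWeights.ofSequences N H
  have I := isolatedAlt_altUp hst n
  obtain ⟨p, hp⟩ : ∃ p, σ.count true = p := ⟨_, rfl⟩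
  obtain ⟨m, hm⟩ : ∃ m, σ.count false = m := ⟨_, rfl⟩
  have hpm : p + m = n := by
    have := List.count_true_add_count_false σ
    omega
  have key := homOp_perp_mul (W := W) I hf hf1 p m (Pi.single (extendPath 0 0 τ) 1) σ hσ hp hm
  rw [capFunctional_single _ _ _ _ _ _ _ _ hτ] at key
  have hext : ∀ σ, extendPath 0 0 σ = σ := fun σ => by simp [extendPath]
  simp only [hext, Nat.cast_zero, neg_zero, map_one, one_mul] at key
  have hsum := (H b c).pathSum_boxWeight n p m 0 hpm
  simp only [← PathWeights.ofSequences_cupFactor_mul N H b c] at hsum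
  simp only [twoPeriodic, Even.zero, zero_add, if_true] at hsum
  rw [if_neg (by decide), ← map_qbinom₂, hpm] at hsum
  rw [hm]
  have hne : ∏ i ∈ Finset.range m, N b c ((p : ℤ) - 1 - i) ≠ 0 :=
    Finset.prod_ne_zero_iff.2 fun i _ => (H b c).ne_zero _
  -- The path sum in the rank-one formula is traded for the binomial, at the cost of products of
  -- values of `N` and their inverses, all in `L₀`.
  have e : φ (qbinom₂ (-A b c) (-A c b) n m) * homOp W f 0 (Pi.single τ 1) σ
      = boxWeight (W.cupFactor b c) p m 0 σ * boxWeight (W.capFactor b c) p m 0 τ *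
        ((∏ i ∈ Finset.range m, N b c (0 - 1 - i)) *
          ∏ i ∈ Finset.range m, (N b c ((p : ℤ) - 1 - i))⁻¹) := by
    rw [← key, Finset.prod_inv_distrib, ← mul_assoc, mul_assoc (homOp W f 0 _ σ), hsum]
    field_simp
  have halt : ∀ h, W.alt b c h ∈ L₀ := fun h => by
    rw [PathWeights.ofSequences_alt]
    exact L₀.neg_mem (L₀.mul_mem (hN _ _ _).1 (hN _ _ _).2)
  rw [e]
  exact L₀.mul_mem (L₀.mul_mem (boxWeight_mem L₀ _ (fun h => L₀.neg_mem (halt _)) _ _ _ _)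
    (boxWeight_mem L₀ _ (fun h => L₀.neg_mem (halt _)) _ _ _ _))
    (L₀.mul_mem (L₀.prod_mem fun _ _ => (hN _ _ _).1) (L₀.prod_mem fun _ _ => (hN _ _ _).2))

theorem baseChange_sum_diagram {R : Type*} {k : Type*} [CommRing R] [CommRing k]
    {B : Matrix S S R} {A : Matrix S S k} (φ : R →+* k) (hA : ∀ b c, A b c = φ (B b c)) {s t : S}
    (hst : s ≠ t) {m n : ℕ} (T : Finset (Σ j, HalfDiagram j m × HalfDiagram j n))
    (a : (Σ j, HalfDiagram j m × HalfDiagram j n) → R) :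
    baseChange φ hA (∑ D ∈ T, a D • diagram B hst D) = ∑ D ∈ T, φ (a D) • diagram A hst D := by
  classical
  induction T using Finset.induction_on with
  | empty => exact baseChange_zero φ hA _ _
  | insert D T hD ih =>
    rw [Finset.sum_insert hD, Finset.sum_insert hD, baseChange_add, baseChange_smul, ih,
      baseChange_diagram]

/-- Injective change of scalars is injective on morphisms if there is a path representation. -/
theorem baseChange_eq_zero {R : Type*} {k : Type*} [CommRing R] [CommRing k] {L : Type*} [Field L]
    {B : Matrix S S R} {A : Matrix S S k} {j : R →+* k} (hj : Function.Injective j)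
    (hA : ∀ b c, A b c = j (B b c)) {φ : k →+* L} (hφ : Function.Injective φ)
    (W : PathWeights A φ) {s t : S} (hst : s ≠ t) {m n : ℕ}
    {x : (⟨altUp s t m⟩ : STL B) ⟶ ⟨altUp s t n⟩} (hx : baseChange j hA x = 0) : x = 0 := by
  obtain ⟨a, rfl⟩ := Finsupp.mem_span_range_iff_exists_finsupp.1 (mem_span_diagram hst x)
  rw [Finsupp.sum, baseChange_sum_diagram] at hx
  refine Finset.sum_eq_zero fun D _ => ?_
  have h1 : (a.mapRange j (map_zero j)).sum (fun D a => a • diagram A hst D) = 0 := by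
    rw [Finsupp.sum_mapRange_index (by simp)]
    exact hx
  -- For the zero subgroup the coefficient criterion is the linear independence of the diagrams.
  have h2 := diagram_coeff_mem W hst ⊤ (fun _ _ _ => ⟨trivial, trivial⟩) ⊥
    (fun _ _ x hx => by rw [AddSubgroup.mem_bot] at hx ⊢; rw [hx, mul_zero])
    (a.mapRange j (map_zero j)) 0 (fun σ τ _ _ => by rw [h1, homOp_zero]; rfl) D
  rw [AddSubgroup.mem_bot, map_eq_zero_iff _ hφ, Finsupp.mapRange_apply, map_eq_zero_iff _ hj] at h2
  rw [h2]
  exact zero_smul _ _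

/-- Over a domain with non-zero quantum numbers, the product of the quantum binomials clears the
denominators of the top idempotent. -/
theorem exists_perp_coeff_prod_qbinom₂ {R : Type v} [CommRing R] [IsDomain R] {B : Matrix S S R}
    {s t : S} (hst : s ≠ t) (q : ℕ → R) (hq0 : q 0 = 0) (hq1 : q 1 = 1)
    (hq : ∀ n, q (n + 2) = -B (color s t n) (color s t (n + 1)) * q (n + 1) - q n)
    (hne : ∀ n, q (n + 1) ≠ 0) (n : ℕ) :
    ∃ f ∈ perp B (altUp s t n), HasIdentityCoeff B _ f (∏ m ∈ Finset.range (n + 1),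
      qbinom₂ (-B (color s t n) (color s t (n + 1))) (-B (color s t (n + 1)) (color s t n)) n m) := by
  set K := FractionRing R
  let j : R →+* K := algebraMap R K
  have hj : Function.Injective j := IsFractionRing.injective R K
  let A : Matrix S S K := fun b c => j (B b c)
  have hA : ∀ b c, A b c = j (B b c) := fun _ _ => rfl
  set g := ∏ m ∈ Finset.range (n + 1),
    qbinom₂ (-B (color s t n) (color s t (n + 1))) (-B (color s t (n + 1)) (color s t n)) n m
    with hg
  obtain ⟨f, hf, hf1, -⟩ := exists_wenzl (A := A) hst (fun n => j (q n)) (by simp [hq0])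
    (by simp [hq1]) (fun n => by rw [hq n, map_sub, map_mul, map_neg]) (fun n => by
      rw [Ne, map_eq_zero_iff _ hj]
      exact hne n) n
  let φ : K →+* FractionRing K[X] := constToFrac R
  have hseq : ∀ b c : S, ∃ N : ℤ → FractionRing K[X],
      QuantumSequence (twoPeriodic (φ (-A b c)) (φ (-A c b))) N ∧
        ∀ h, N h ∈ integralFractions R ∧ (N h)⁻¹ ∈ integralFractions R := by
    intro b c
    -- The recursion is solved over `R` itself, so the values are primitive polynomials and are
    -- invertible in `integralFractions R`.
    obtain ⟨U, V, hUV, hrec⟩ := exists_linear_sequence (twoPeriodic (-B b c) (-B c b))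
    have hM := fun h => linear_mem_primitiveMonoid (hUV h)
    refine ⟨fun h => polyToFrac R (C (U h) + C (V h) * X), ⟨?_, ?_, ?_⟩, fun h =>
      ⟨polyToFrac_mem _, inv_polyToFrac_mem (hM h)⟩⟩
    · intro h
      simp [twoPeriodic]
    · intro h h0
      rw [map_eq_zero_iff _ polyToFrac_injective] at h0
      exact ne_zero_of_mem_primitiveMonoid (hM h) h0
    · intro h
      rw [← map_add, hrec, map_mul, ← constToFrac_algebraMap]
      congr 1
      simp only [twoPeriodic, hA]
      split_ifs <;> exact congrArg (constToFrac R) (map_neg j _)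
  choose N hN hNL using hseq
  have hr : ∀ b c h, (PathWeights.ofSequences N hN).r b c h ∈ integralFractions R ∧
      ((PathWeights.ofSequences N hN).r b c h)⁻¹ ∈ integralFractions R := by
    intro b c h
    simp only [PathWeights.ofSequences]
    split_ifs <;> rw [inv_neg, mul_inv, inv_inv] <;>
      exact ⟨neg_mem (mul_mem (hNL _ _ _).1 (hNL _ _ _).2),
        neg_mem (mul_mem (hNL _ _ _).2 (hNL _ _ _).1)⟩
  obtain ⟨a, ha⟩ := Finsupp.mem_span_range_iff_exists_finsupp.1 (mem_span_diagram hst f)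
  have hint : ∀ D, ∃ e : R, j e = j g * a D := by
    intro D
    apply exists_of_constToFrac_mem
    have hgL : ∀ r : R, φ (j r) ∈ integralFractions R := fun r => by
      rw [constToFrac_algebraMap]
      exact polyToFrac_mem _
    -- The subgroup consists of the elements that become integral after multiplication by the
    -- product `g` of all binomials.
    have := diagram_coeff_mem (PathWeights.ofSequences N hN) hst (integralFractions R) hr
      ((integralFractions R).toAddSubgroup.comap (AddMonoidHom.mulLeft (φ (j g))))
      (fun x hx y hy => by
        have := (integralFractions R).mul_mem hx hy
        rwa [AddMonoidHom.coe_mulLeft, mul_left_comm] at this) a 0 (fun σ τ hσ hτ => by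
        have h1 := binom_mul_homOp_mem N hN (integralFractions R) hNL hst hf hf1 σ τ hσ hτ
        have h2 : σ.count false ∈ Finset.range (n + 1) := by
          have := List.count_le_length (a := false) (l := σ)
          rw [Finset.mem_range]
          omega
        obtain ⟨r, hr⟩ := Finset.dvd_prod_of_mem (fun m => qbinom₂
          (-B (color s t n) (color s t (n + 1))) (-B (color s t (n + 1)) (color s t n)) n m) h2
        have h3 := (integralFractions R).mul_mem (hgL r) h1
        rw [ha]
        change φ (j g) * _ ∈ integralFractions R
        rw [hg, hr, map_mul, map_mul, map_qbinom₂ j, map_neg, map_neg, mul_comm (φ _) (φ (j r)),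
          mul_assoc]
        exact h3) D
    rw [map_mul]
    exact this
  choose e he using hint
  let F : (⟨altUp s t n⟩ : STL B) ⟶ ⟨altUp s t n⟩ := ∑ D ∈ a.support, e D • diagram B hst D
  have hF : baseChange j hA F = j g • f := by
    rw [baseChange_sum_diagram, ← ha, Finsupp.sum, Finset.smul_sum]
    exact Finset.sum_congr rfl fun D _ => by rw [he, smul_smul]
  refine ⟨F, ?_, ?_⟩
  · intro l b c r hbc hx
    obtain ⟨m, rfl, h⟩ := altUp_split s t hx
    have key : ∀ (y : List S) (hy : y = altUp s t m) (z : (⟨y⟩ : STL B) ⟶ ⟨altUp s t (m + 2)⟩),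
        baseChange j hA (z ≫ F) = 0 → z ≫ F = 0 := by
      rintro y rfl z hz
      exact baseChange_eq_zero hj hA φ.injective (PathWeights.ofSequences N hN) hst hz
    refine key _ h _ ?_
    rw [baseChange_comp, hF, Linear.comp_smul]
    have := hf l b c r hbc hx
    exact (congrArg (j g • ·) this).trans (smul_zero _)
  · obtain ⟨d, hd⟩ := exists_hasIdentityCoeff F
    have h1 := hd.baseChange j hA
    rw [hF] at h1
    have h2 := Submodule.smul_mem _ (j g) hf1
    rw [smul_sub, smul_smul, mul_one] at h2
    have h3 := hasIdentityCoeff_unique (PathWeights.ofSequences N hN) hst h1 h2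
    rwa [← hj (φ.injective h3)]

/-- The top idempotent of an alternating sequence exists if quantum binomials are invertible. -/
theorem topIdempotentExists_altUp {k : Type v} [CommRing k] (A : Matrix S S k) {s t : S}
    (hst : s ≠ t) (n : ℕ) (H : ∀ m ≤ n, IsUnit
      (qbinom₂ (-A (color s t n) (color s t (n + 1))) (-A (color s t (n + 1)) (color s t n)) n m)) :
    TopIdempotentExists A (altUp s t n) := by
  -- The universal matrix: its base ring is a domain with non-zero quantum numbers, and it
  -- specialises to every `A`.
  let B : Matrix S S (MvPolynomial (S × S) ℤ) := fun b c => MvPolynomial.X (b, c)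
  -- The step from `n` and `n + 1` to `n + 2` is the recursion at `h = n + 1`, whence the shift by
  -- one; parameters at `h ≤ 0` are irrelevant.
  obtain ⟨N, hN0, hN1, hN⟩ := exists_recursive_sequence (fun h : ℤ =>
    -B (color s t (h.toNat - 1)) (color s t (h.toNat - 1 + 1))) 0 1
  have hq : ∀ n : ℕ, N ((n + 2 : ℕ) : ℤ)
      = -B (color s t n) (color s t (n + 1)) * N ((n + 1 : ℕ) : ℤ) - N (n : ℤ) := by
    intro n
    have h1 := hN ((n + 1 : ℕ) : ℤ)
    simp only [Int.toNat_natCast, Nat.add_sub_cancel] at h1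
    rw [← h1]
    push_cast
    rw [add_sub_cancel_right, add_assoc]
    norm_num
  have hne : ∀ n : ℕ, N ((n + 1 : ℕ) : ℤ) ≠ 0 := by
    -- If all circles are `-2`, the quantum numbers become the integers.
    have hev : ∀ n : ℕ, MvPolynomial.eval (fun _ : S × S => (-2 : ℤ)) (N (n : ℤ)) = n := by
      intro n
      induction n using Nat.strong_induction_on with
      | _ n ih =>
        obtain _ | _ | n := n
        · simp [hN0]
        · simp [hN1]
        · rw [hq, map_sub, map_mul, ih (n + 1) (by omega), ih n (by omega)]
          simp only [B, map_neg, MvPolynomial.eval_X]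
          push_cast
          ring
    intro n h0
    have := hev (n + 1)
    rw [h0, map_zero] at this
    omega
  obtain ⟨f, hf, hf1⟩ := exists_perp_coeff_prod_qbinom₂ (B := B) hst (fun n => N n) hN0
    (by simpa using hN1) hq hne n
  let π : MvPolynomial (S × S) ℤ →+* k :=
    MvPolynomial.eval₂Hom (Int.castRingHom k) fun b => A b.1 b.2
  have hπ : ∀ b c, A b c = π (B b c) := fun b c => by simp [π, B]
  refine ⟨_, baseChange_mem_perp π hπ hf, _, ?_, hf1.baseChange π hπ⟩
  rw [map_prod, IsUnit.prod_iff]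
  intro m hm
  rw [map_qbinom₂, map_neg, map_neg, ← hπ, ← hπ]
  exact H m (by rw [Finset.mem_range] at hm; omega)

/-- The two conventions for the parameters of the quantum binomials of an alternating
sequence. -/
theorem qbinom₂_color {k : Type v} [CommRing k] (A : Matrix S S k) (s t : S) {n m : ℕ}
    (hm : m ≤ n) :
    qbinom₂ (-A (color s t n) (color s t (n + 1))) (-A (color s t (n + 1)) (color s t n)) n m
      = qbinom₂ (-A s t) (-A t s) n m := by
  by_cases h : Even n
  · simp [color, h, Nat.even_add_one]
  · obtain ⟨p, rfl⟩ : ∃ p, n = p + m := ⟨n - m, by omega⟩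
    -- For odd `n` the first colour is `t` rather than `s`, and the binomials are symmetric in the
    -- colours.
    rw [qbinom₂_swap _ _ p m h]
    simp [color, h, Nat.even_add_one]

end GenericExistence

end ColoredTL

namespace ColoredTL

open CategoryTheory

/-! ### Maximal alternating subsequences -/

section MaximalAlternating

variable {S : Type u}

theorem length_altWord (s t : S) (n : ℕ) : (altWord s t n).length = n := by
  induction n generalizing s t with
  | zero => simp [altWord]
  | succ n ih => simp [altWord, ih]

theorem getElem?_altWord (s t : S) (n j : ℕ) (hj : j < n) :
    (altWord s t n)[j]? = some (if Even (n - 1 - j) then s else t) := by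
  induction n generalizing s t with
  | zero => omega
  | succ n ih =>
    rw [altWord]
    by_cases h : j < n
    · rw [List.getElem?_append_left (by rw [length_altWord]; exact h), ih t s h]
      have e : n + 1 - 1 - j = (n - 1 - j) + 1 := by omega
      rw [e]
      by_cases h' : Even (n - 1 - j) <;> simp [h', Nat.even_add_one]
    · obtain rfl : j = n := by omega
      rw [List.getElem?_append_right (by rw [length_altWord]), length_altWord]
      simp

theorem length_seg {x : List S} {i n : ℕ} (h : i + n ≤ x.length) : (seg x i n).length = n := by
  simp [seg]
  omega

theorem getElem?_seg (x : List S) {i n j : ℕ} (hj : j < n) : (seg x i n)[j]? = x[i + j]? := by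
  simp [seg, hj]

/-- A sequence is alternating if and only if it has period two. -/
theorem isAlternating_seg_iff {x : List S} {i n : ℕ} (hn : 0 < n) (h : i + n ≤ x.length) :
    IsAlternating (seg x i n) ↔ ∀ j, i ≤ j → j + 2 < i + n → x[j]? = x[j + 2]? := by
  constructor
  · rintro ⟨s, t, hst⟩ j hij hj
    rw [length_seg h] at hst
    obtain ⟨j, rfl⟩ := Nat.exists_eq_add_of_le hij
    rw [← getElem?_seg x (n := n) (by omega), add_assoc, ← getElem?_seg x (n := n) (by omega), hst,
      getElem?_altWord _ _ _ _ (by omega), getElem?_altWord _ _ _ _ (by omega)]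
    have e : n - 1 - j = n - 1 - (j + 2) + 2 := by omega
    rw [e]
    simp [Nat.even_add]
  · intro hp
    have key : ∀ n, i + n ≤ x.length → (∀ j, i ≤ j → j + 2 < i + n → x[j]? = x[j + 2]?) →
        0 < n → ∃ s t, seg x i n = altWord s t n := by
      intro n
      induction n with
      | zero => intro _ _ h; omega
      | succ n ih =>
        intro h hp _
        have hsucc : ∀ n, (h : i + n < x.length) → seg x i (n + 1) = seg x i n ++ [x[i + n]] := by
          intro n h
          rw [seg, List.take_add_one, List.getElem?_drop, List.getElem?_eq_getElem h]
          rfl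
        rw [hsucc n (by omega)]
        obtain _ | _ | n := n
        · exact ⟨_, x[i + 0], by simp [seg, altWord]; rfl⟩
        · exact ⟨x[i + (0 + 1)], x[i], by rw [hsucc 0 (by omega)]; simp [seg, altWord]⟩
        · obtain ⟨s, t, hst⟩ := ih (by omega) (fun j h1 h2 => hp j h1 (by omega)) (by omega)
          refine ⟨t, s, ?_⟩
          rw [altWord, ← hst]
          have h1 := getElem?_seg x (i := i) (n := n + 2) (j := n) (by omega)
          rw [hst, getElem?_altWord _ _ _ _ (by omega), hp _ (by omega) (by omega),
            List.getElem?_eq_getElem (by omega)] at h1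
          simp at h1
          rw [h1]
          rfl
    obtain ⟨s, t, hst⟩ := key n h hp hn
    exact ⟨s, t, by rw [length_seg h]; exact hst⟩

/-- Distinct maximal alternating subsequences share at most one term. -/
theorem IsMaxAlt.disjoint {x : List S} {i n i' n' : ℕ} (h : IsMaxAlt x i n)
    (h' : IsMaxAlt x i' n') (hne : (i, n) ≠ (i', n')) (hi : i ≤ i') : i + n ≤ i' + 1 := by
  by_contra! hlt
  obtain ⟨h1, h2, h3, h4⟩ := h
  obtain ⟨h1', h2', h3', h4'⟩ := h'
  have hle : ¬ i' + n' ≤ i + n := fun hle => by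
    obtain ⟨rfl, rfl⟩ := h4' i n hi hle h2 h3
    exact hne rfl
  -- With two terms in common, every three consecutive terms of the union lie in one of the two
  -- runs, so the union has period two.
  have hu : IsAlternating (seg x i (i' + n' - i)) := by
    rw [isAlternating_seg_iff (by omega) (by omega)]
    rw [isAlternating_seg_iff h1 h2] at h3
    rw [isAlternating_seg_iff h1' h2'] at h3'
    intro j hj hj'
    by_cases hjn : j + 2 < i + n
    · exact h3 j hj hjn
    · exact h3' j (by omega) (by omega)
  have := h4 i (i' + n' - i) le_rfl (by omega) (by omega) hu
  omega

/-- Each alternating subsequence lies in a maximal one. -/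
theorem exists_isMaxAlt {x : List S} {a m : ℕ} (hm : 0 < m) (ham : a + m ≤ x.length)
    (h : IsAlternating (seg x a m)) : ∃ i n, IsMaxAlt x i n ∧ i ≤ a ∧ a + m ≤ i + n := by
  classical
  let P : ℕ → Prop := fun n => ∃ i, i ≤ a ∧ a + m ≤ i + n ∧ i + n ≤ x.length ∧
    IsAlternating (seg x i n)
  have hP : P (Nat.findGreatest P x.length) :=
    Nat.findGreatest_spec (m := m) (by omega) ⟨a, le_rfl, le_rfl, ham, h⟩
  obtain ⟨i, hi, hai, hix, halt⟩ := hP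
  refine ⟨i, _, ⟨by omega, hix, halt, fun i' n' h1 h2 h3 h4 => ?_⟩, hi, hai⟩
  have := Nat.le_findGreatest (P := P) (m := n') (n := x.length) (by omega)
    ⟨i', by omega, by omega, h3, h4⟩
  omega

theorem mem_maxAlts {x : List S} {p : ℕ × ℕ} : p ∈ maxAlts x ↔ IsMaxAlt x p.1 p.2 := by
  classical
  simp only [maxAlts, List.mem_filter, decide_eq_true_eq, and_iff_right_iff_imp]
  rintro ⟨h1, h2, -⟩
  obtain ⟨i, n⟩ := p
  exact List.mem_product.2 ⟨List.mem_range.2 (by grind), List.mem_range.2 (by grind)⟩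

/-- A cap straddling an end would show that the run continues alternating by one more term, against
maximality. -/
theorem IsMaxAlt.isolatedAlt {x : List S} {i n : ℕ} {s t : S}
    (h : IsMaxAlt x i (n + 1)) (hst : seg x i (n + 1) = altWord s t (n + 1)) (hne : s ≠ t) :
    IsolatedAlt x (color s t n) (color s t (n + 1)) i (x.length - (i + n + 1)) n where
  ne := color_ne hne n
  split := ⟨x.take i, (x.drop i).drop (n + 1), by have := h.2.1; simp; omega, by simp; omega, by
    rw [altFrom_eq_altUp, ← altWord_succ_eq_altUp, ← hst, seg_split]⟩
  cap l d e r hl := by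
    obtain ⟨-, h2, h3, h4⟩ := h
    rw [isAlternating_seg_iff (by omega) h2] at h3
    have hlen := congrArg List.length hl
    simp only [List.length_append, List.length_cons] at hlen
    have hd : x[l.length]? = x[l.length + 2]? := by
      rw [hl, List.getElem?_append_right le_rfl, List.getElem?_append_right (by omega)]
      simp
    constructor
    · intro hi
      have := h4 (i - 1) (n + 2) (by omega) (by omega) (by omega) (by
        rw [isAlternating_seg_iff (by omega) (by omega)]
        intro j hj hj'
        by_cases hji : i ≤ j
        · exact h3 j hji (by omega)
        · obtain rfl : j = l.length := by omega
          exact hd)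
      omega
    · intro hi
      have := h4 i (n + 2) (by omega) (by omega) (by omega) (by
        rw [isAlternating_seg_iff (by omega) (by omega)]
        intro j hj hj'
        by_cases hji : j + 2 < i + (n + 1)
        · exact h3 j hj hji
        · obtain rfl : j = l.length := by omega
          exact hd)
      omega

theorem ne_of_seg_eq_altWord {x : List S} (hx : x.IsChain (· ≠ ·)) {i n : ℕ} {s t : S}
    (hst : seg x i (n + 2) = altWord s t (n + 2)) : s ≠ t := by
  have h : (seg x i (n + 2)).IsChain (· ≠ ·) := (hx.drop i).take _
  rw [hst, altWord, altWord, List.append_assoc] at h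
  have := h.right_of_append
  simp only [List.cons_append, List.nil_append, List.isChain_pair] at this
  exact this.symm

end MaximalAlternating

/-! ### The horizontal composite and the proof for arbitrary sequences. -/

section SideBySideComposite

variable {S : Type u} {k : Type v} [CommRing k] {A : Matrix S S k}

theorem whisk_congr {p p' q q' x y X Y : List S} (hp : p = p') (hq : q = q')
    {f : (⟨x⟩ : STL A) ⟶ ⟨y⟩} {hX : X = p ++ x ++ q} {hY : Y = p ++ y ++ q} :
    whisk p q f hX hY = whisk p' q' f (by rw [hX, hp, hq]) (by rw [hY, hp, hq]) := by
  subst hp hq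
  rfl

theorem place_eq_whisk (x : List S) (i n : ℕ) (f : (⟨seg x i n⟩ : STL A) ⟶ ⟨seg x i n⟩) :
    place A x i n f = whisk (x.take i) ((x.drop i).drop n) f (seg_split x i n).symm
      (seg_split x i n).symm := rfl

/-- The two subsequences have no strand in common, so interchange applies, glued along the region
`x[i']`. -/
theorem commute_place {x : List S} {i n i' n' : ℕ} (hn : i + n ≤ i' + 1)
    (hn' : 0 < n') (hx : i' + n' ≤ x.length) (f : (⟨seg x i n⟩ : STL A) ⟶ ⟨seg x i n⟩)
    (g : (⟨seg x i' n'⟩ : STL A) ⟶ ⟨seg x i' n'⟩) :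
    place A x i n f ≫ place A x i' n' g = place A x i' n' g ≫ place A x i n f := by
  rw [place_eq_whisk, place_eq_whisk]
  have hd : x.drop i' = x[i'] :: x.drop (i' + 1) := List.drop_eq_getElem_cons (by omega)
  have hp : x.take (i' + 1) = x.take i' ++ [x[i']] := by simp
  have hX : x = x.take i' ++ x[i'] :: x.drop (i' + 1) := by rw [← hd, List.take_append_drop]
  have h1 : x.take i' ++ [x[i']] = x.take i ++ seg x i n ++ (x.take (i' + 1)).drop (i + n) := by
    have := List.take_append_drop (i + n) (x.take (i' + 1))
    rw [List.take_take, min_eq_left hn] at this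
    rw [← hp, seg, ← List.take_add, this]
  have h2 : x[i'] :: x.drop (i' + 1) = [] ++ seg x i' n' ++ (x.drop i').drop n' := by
    rw [← hd]
    simp [seg]
  have h3 : (x.drop i).drop n = (x.take (i' + 1)).drop (i + n) ++ x.drop (i' + 1) := by
    rw [List.drop_drop, ← List.drop_append_of_le_length (by simp; omega), List.take_append_drop]
  have key := interchange (A := A) (x.take i') (x.take i') x[i'] (x.drop (i' + 1))
    (x.drop (i' + 1)) (whisk _ _ f h1 h1) (whisk _ _ g h2 h2) hX hX hX hX
  simp only [whisk_whisk] at key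
  rw [whisk_congr (p := x.take i) (p' := [] ++ x.take i) rfl h3,
    whisk_congr (p := x.take i') (p' := x.take i' ++ []) (q' := (x.drop i').drop n' ++ []) (by simp) (by simp)]
  exact key

theorem commute_place_of_isMaxAlt {x : List S} {p p' : ℕ × ℕ} (h : IsMaxAlt x p.1 p.2)
    (h' : IsMaxAlt x p'.1 p'.2) :
    Commute (place A x p.1 p.2 (JW A (seg x p.1 p.2)))
      (place A x p'.1 p'.2 (JW A (seg x p'.1 p'.2))) := by
  by_cases hne : p = p'
  · rw [hne]
  rcases le_total p.1 p'.1 with hi | hi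
  · exact (commute_place (h.disjoint h' hne hi) h'.1 h'.2.1 _ _).symm
  · exact commute_place (h'.disjoint h (Ne.symm hne) hi) h.1 h.2.1 _ _

theorem HasIdentityCoeff.comp {x : List S} {f g : (⟨x⟩ : STL A) ⟶ ⟨x⟩}
    (hf : HasIdentityCoeff A x f 1) (hg : HasIdentityCoeff A x g 1) :
    HasIdentityCoeff A x (f ≫ g) 1 := by
  rw [HasIdentityCoeff, _root_.one_smul] at *
  have h : (f - 𝟙 _) ≫ g ∈ lowerIdeal A x := by
    refine comp_mem_of_span (Q := {g}) ?_ hf (Submodule.subset_span rfl)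
    rintro _ ⟨y, u, v, hy, rfl⟩ w _
    exact Submodule.subset_span ⟨y, u, v ≫ w, hy, by simp⟩
  have := Submodule.add_mem _ h hg
  simpa using this

theorem cup_comp_place {x : List S} {i n : ℕ} {f : (⟨seg x i n⟩ : STL A) ⟶ ⟨seg x i n⟩}
    (hf : f ∈ perp A (seg x i n)) {y : List S} (l : List S) (b c : S) (r : List S) (hbc : b ≠ c)
    (hy : y = l ++ b :: r) (hx : x = l ++ b :: c :: b :: r) (hi : i ≤ l.length)
    (hn : l.length + 3 ≤ i + n) (hin : i + n ≤ x.length) :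
    (Step.cup l b c r hbc hy hx).hom A ≫ place A x i n f = 0 := by
  have hsplit := (seg_split x i n).trans hx
  obtain ⟨l', rfl⟩ : ∃ l', l = x.take i ++ l' := by
    refine ⟨l.drop i, ?_⟩
    rw [hx, List.take_append_of_le_length hi, List.take_append_drop]
  rw [List.append_assoc, List.append_assoc, List.append_cancel_left_eq] at hsplit
  have hl : (x.take i).length = i := by simp; omega
  rw [List.length_append, hl] at hn
  obtain ⟨r', hr', hs⟩ : ∃ r', r = r' ++ (x.drop i).drop n ∧
      seg x i n = l' ++ b :: c :: b :: r' := by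
    rw [show l' ++ b :: c :: b :: r = (l' ++ [b, c, b]) ++ r by simp] at hsplit
    rcases List.append_eq_append_iff.1 hsplit with ⟨a, h1, h2⟩ | ⟨a, h1, h2⟩
    · have h3 := congrArg List.length h1
      simp only [List.length_append, length_seg hin, List.length_cons, List.length_nil] at h3
      obtain rfl : a = [] := by
        rw [← List.length_eq_zero_iff]
        omega
      exact ⟨[], by simpa using h2.symm, by simpa using h1.symm⟩
    · exact ⟨a, h2, by simpa using h1⟩
  have e : (Step.cup (x.take i ++ l') b c r hbc hy hx).hom A
      = whisk (x.take i) ((x.drop i).drop n) (cupInto A (seg x i n) l' b c r' hbc hs)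
        (by rw [hy, hr']; simp) (seg_split x i n).symm := by
    refine Eq.trans ?_ (whisk_of ..).symm
    exact congrArg (Step.hom A) (Step.cup_congr rfl rfl rfl hr' _ _ _ _ _ _)
  rw [e, place_eq_whisk, ← whisk_comp, hf, whisk_zero]

/-- The horizontal composite of the top idempotents of maximal alternating subsequences. -/
theorem sideBySide_spec {x : List S}
    (H : ∀ i n, IsMaxAlt x i n → IsTopIdempotent A (seg x i n) (JW A (seg x i n))) :
    sideBySide A x ∈ perp A x ∧ HasIdentityCoeff A x (sideBySide A x) 1 := by
  constructor
  · rw [mem_perp_iff]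
    rintro y (⟨l, b, c, r, hbc, hy, hx⟩ | _) hz
    · have hlen := congrArg List.length hx
      simp only [List.length_append, List.length_cons] at hlen
      -- The three colours `bcb` of the cup alternate, so they lie in a maximal alternating
      -- subsequence, whose top idempotent kills the cup.
      obtain ⟨i, n, hmax, hi, hn⟩ := exists_isMaxAlt (x := x) (a := l.length) (m := 3) (by omega)
        (by omega) (by
          rw [isAlternating_seg_iff (by omega) (by omega)]
          intro j hj hj'
          obtain rfl : j = l.length := by omega
          rw [hx, List.getElem?_append_right le_rfl, List.getElem?_append_right (by omega)]
          simp)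
      have h0 := cup_comp_place (H i n hmax).1 l b c r hbc hy hx hi hn hmax.2.1
      obtain ⟨Q, hQ⟩ : ∃ Q : End (⟨x⟩ : STL A), sideBySide A x
          = (place A x i n (JW A (seg x i n)) : (⟨x⟩ : STL A) ⟶ ⟨x⟩) ≫ Q := by
        obtain ⟨T, T', hT⟩ := List.append_of_mem ((mem_maxAlts (p := (i, n))).2 hmax)
        -- In a product of endomorphisms the rightmost factor is applied first; commutation moves
        -- the relevant factor there, directly after the cup.
        have hcomm : Commute (place A x i n (JW A (seg x i n)))
            (T'.map fun p => place A x p.1 p.2 (JW A (seg x p.1 p.2))).prod := by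
          refine Commute.list_prod_right _ _ fun u hu => ?_
          obtain ⟨p, hp, rfl⟩ := List.mem_map.1 hu
          have hp' : IsMaxAlt x p.1 p.2 := mem_maxAlts.1 (by
            rw [hT]
            exact List.mem_append_right _ (List.mem_cons_of_mem _ hp))
          exact commute_place_of_isMaxAlt (p := (i, n)) hmax hp'
        refine ⟨(T.map fun p => place A x p.1 p.2 (JW A (seg x p.1 p.2))).prod *
          (T'.map fun p => place A x p.1 p.2 (JW A (seg x p.1 p.2))).prod, ?_⟩
        rw [← End.mul_def, mul_assoc, ← hcomm.eq, sideBySide, hT]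
        simp
      rw [hQ, ← Category.assoc, h0, Limits.zero_comp]
    · exact hz.elim
  · rw [sideBySide]
    have : ∀ p ∈ maxAlts x, HasIdentityCoeff A x (place A x p.1 p.2 (JW A (seg x p.1 p.2))) 1 := by
      intro p hp
      exact (H p.1 p.2 (mem_maxAlts.1 hp)).2.2.whisk _ _ (seg_split x p.1 p.2).symm
        (seg_split x p.1 p.2).symm
    generalize maxAlts x = T at this
    induction T with
    | nil => simp [HasIdentityCoeff]
    | cons p T ih =>
      rw [List.map_cons, List.prod_cons]
      exact HasIdentityCoeff.comp (ih fun p hp => this p (List.mem_cons_of_mem _ hp))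
        (this p List.mem_cons_self)

theorem topIdempotentExists_altWord (s t : S) (n : ℕ)
    (hst : 0 < n → s ≠ t) (H : ∀ m ≤ n, IsUnit (qbinom₂ (-A s t) (-A t s) n m)) :
    TopIdempotentExists A (altWord s t (n + 1)) := by
  rw [altWord_succ_eq_altUp]
  obtain _ | n := n
  · refine ⟨𝟙 _, ?_, 1, isUnit_one, by simp [HasIdentityCoeff]⟩
    intro l b c r _ hx
    have := congrArg List.length hx
    simp [altUp] at this
    omega
  · refine topIdempotentExists_altUp A (hst (by omega)) _ fun m hm => ?_
    rw [qbinom₂_color A s t hm]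
    exact H m hm

/-- The composite lies in `B(x)` with identity coefficient 1, so existence and the formula both
follow from uniqueness. -/
theorem isTopIdempotent_of_qbinom₂ {x : List S} (hx : x.IsChain (· ≠ ·))
    (H : ∀ s t i n, IsMaxAlt x i (n + 1) → seg x i (n + 1) = altWord s t (n + 1) →
      ∀ m ≤ n, IsUnit (qbinom₂ (-A s t) (-A t s) n m)) :
    TopIdempotentExists A x ∧ IsTopIdempotent A x (JW A x) ∧
      (∀ i n, IsMaxAlt x i n → IsTopIdempotent A (seg x i n) (JW A (seg x i n))) ∧
      JW A x = sideBySide A x := by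
  have hseg : ∀ i n, IsMaxAlt x i n → IsTopIdempotent A (seg x i n) (JW A (seg x i n)) := by
    intro i n hmax
    obtain ⟨n, rfl⟩ := Nat.exists_eq_add_one.2 hmax.1
    obtain ⟨s, t, hst⟩ := hmax.2.2.1
    rw [length_seg hmax.2.1] at hst
    have hne : 0 < n → s ≠ t := by
      intro hn
      obtain ⟨n, rfl⟩ := Nat.exists_eq_add_one.2 hn
      exact ne_of_seg_eq_altWord hx hst
    obtain ⟨f, hf, hf1⟩ := exists_coeff_one
      (topIdempotentExists_altWord s t n hne (H s t i n hmax hst))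
    rw [hst]
    exact isTopIdempotent_JW hf hf1
  obtain ⟨h1, h2⟩ := sideBySide_spec hseg
  have h3 := isTopIdempotent_JW h1 h2
  exact ⟨⟨_, h1, 1, isUnit_one, h2⟩, h3, hseg, perp_unique h3.1 h3.2.2 h1 h2⟩

theorem not_topIdempotentExists_of_qbinom₂ {x : List S} (hx : x.IsChain (· ≠ ·)) {s t : S}
    {i n m : ℕ} (hmax : IsMaxAlt x i (n + 1)) (hst : seg x i (n + 1) = altWord s t (n + 1))
    (hm : m ≤ n) (hq : ¬ IsUnit (qbinom₂ (-A s t) (-A t s) n m)) : ¬ TopIdempotentExists A x := by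
  obtain _ | n := n
  -- A single colour does not force `s ≠ t`, but its only binomial is 1.
  · obtain rfl : m = 0 := by omega
    rw [qbinom₂_zero_right] at hq
    exact absurd isUnit_one hq
  · refine not_topIdempotentExists_of_isolatedAlt A
      (hmax.isolatedAlt hst (ne_of_seg_eq_altWord hx hst)) m hm ?_
    rwa [qbinom₂_color A s t hm]

end SideBySideComposite

end ColoredTL

open ColoredTL in
theorem mainTheorem3 {S : Type u} {k : Type v} [CommRing k]
    (x : List S) (hne : x ≠ []) (hx : x.IsChain (· ≠ ·)) :
    -- one parameter: every circle is `-δ`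
    (∀ δ : k, ∀ A : Matrix S S k, A = Matrix.of (fun _ _ => -δ) →
      ((∀ i n, IsMaxAlt x i (n + 1) → ∀ m ≤ n, IsUnit (qbinom δ n m)) →
        TopIdempotentExists A x ∧ IsTopIdempotent A x (JW A x) ∧
        (∀ i n, IsMaxAlt x i n → IsTopIdempotent A (seg x i n) (JW A (seg x i n))) ∧
        JW A x = sideBySide A x) ∧
      ((∃ i n m, IsMaxAlt x i (n + 1) ∧ m ≤ n ∧ ¬ IsUnit (qbinom δ n m)) →
        ¬ TopIdempotentExists A x)) ∧
    -- two-coloured version: a circle with `c` inside and `b` outside is `A b c`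
    (∀ A : Matrix S S k,
      ((∀ s t i n, IsMaxAlt x i (n + 1) → seg x i (n + 1) = altWord s t (n + 1) →
          ∀ m ≤ n, IsUnit (qbinom₂ (-A s t) (-A t s) n m)) →
        TopIdempotentExists A x ∧ IsTopIdempotent A x (JW A x) ∧
        (∀ i n, IsMaxAlt x i n → IsTopIdempotent A (seg x i n) (JW A (seg x i n))) ∧
        JW A x = sideBySide A x) ∧
      ((∃ s t i n m, IsMaxAlt x i (n + 1) ∧ seg x i (n + 1) = altWord s t (n + 1) ∧
          m ≤ n ∧ ¬ IsUnit (qbinom₂ (-A s t) (-A t s) n m)) →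
        ¬ TopIdempotentExists A x)) := by
  have part₂ : ∀ A : Matrix S S k,
      ((∀ s t i n, IsMaxAlt x i (n + 1) → seg x i (n + 1) = altWord s t (n + 1) →
          ∀ m ≤ n, IsUnit (qbinom₂ (-A s t) (-A t s) n m)) →
        TopIdempotentExists A x ∧ IsTopIdempotent A x (JW A x) ∧
        (∀ i n, IsMaxAlt x i n → IsTopIdempotent A (seg x i n) (JW A (seg x i n))) ∧
        JW A x = sideBySide A x) ∧
      ((∃ s t i n m, IsMaxAlt x i (n + 1) ∧ seg x i (n + 1) = altWord s t (n + 1) ∧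
          m ≤ n ∧ ¬ IsUnit (qbinom₂ (-A s t) (-A t s) n m)) →
        ¬ TopIdempotentExists A x) := by
    intro A
    refine ⟨isTopIdempotent_of_qbinom₂ hx, ?_⟩
    rintro ⟨s, t, i, n, m, hmax, hst, hm, hq⟩
    exact not_topIdempotentExists_of_qbinom₂ hx hmax hst hm hq
  refine ⟨?_, part₂⟩
  rintro δ A rfl
  obtain ⟨h₁, h₂⟩ := part₂ (Matrix.of fun _ _ => -δ)
  simp only [Matrix.of_apply, neg_neg] at h₁ h₂
  constructor
  · intro H
    refine h₁ fun s t i n hmax _ m hm => ?_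
    rw [← qbinom_eq_qbinom₂ δ hm]
    exact H i n hmax m hm
  · rintro ⟨i, n, m, hmax, hm, hq⟩
    -- Any colours exhibiting the subsequence as alternating will do, since with equal parameters
    -- the binomial does not depend on them.
    obtain ⟨s, t, hst⟩ := hmax.2.2.1
    rw [length_seg hmax.2.1] at hst
    rw [qbinom_eq_qbinom₂ δ hm] at hq
    exact h₂ ⟨s, t, i, n, m, hmax, hst, hm, hq⟩
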